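/- Let $\varepsilon\in(0,2)$ and, on $(0,1)$, put $$p(x)=(1-x)^{1+1/\varepsilon}(x+1)^{1-1/\varepsilon},\qquad w(x)=x^{-1}(1-x)^{1/\varepsilon}(x+1)^{-1/\varepsilon}.$$ Let $L$ be the operator $Lf=-w^{-1}(pf')'$ in the complex Hilbert space $L^2((0,1),w(x)\,dx)$ with domain $\{f\in C^\infty([0,1]) : f(0)=0\}$. Let $$\beta=\int_0^1 y^{-1/2}(1-y)^{-1/2}(1+y)^{-1/2}\,dy,\qquad \psi(t)=\int_0^t\sqrt{w(y)/p(y)}\,dy\quad(0\le t\le 1),$$ so that $\psi:[0,1]\to[0,\beta]$ is a bijection; let $\varphi=\psi^{-1}$, and for $s\in(0,\beta)$ put $$c(s)=\bigl(w(\varphi(s))\,p(\varphi(s))\bigr)^{-1/4},\qquad V(s)=-c(s)c''(s)\frac{p(\varphi(s))}{\varphi'(s)}-c(s)c'(s)\frac{d}{ds}\left(\frac{p(\varphi(s))}{\varphi'(s)}\right).$$ Then the eigenvalues of $L$ (all of them real) can be listed in increasing order, repeated according to multiplicity, as an infinite sequence $(\mu_n)_{n\ge1}$, and this sequence satisfies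 $$\lim_{n\to\infty}n^{-2}\mu_n=\frac{\pi^2}{\beta^2}.$$ Moreover, $\alpha=\min\{V(s):s\in(0,\beta)\}$ exists, $$\mu_n\ \ge\ \frac{n^2\pi^2}{\beta^2}+\alpha\qquad\text{for all } n\ge1,$$ and $$\mu_n\ \le\ \frac{n^2\pi^2}{\beta^2}+O(n^{4/3})\qquad\text{as } n\to\infty,$$ where the implied constant may depend on $\varepsilon$. -/

import Mathlib

open Set Filter Topology MeasureTheory Asymptotics
open scoped ContDiff ENNReal

namespace SturmLiouville

noncomputable section

/-- The coefficient `p(x) = (1-x)^(1+1/ε) (x+1)^(1-1/ε)`. -/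
def p (ε x : ℝ) : ℝ := (1 - x) ^ (1 + 1 / ε) * (x + 1) ^ (1 - 1 / ε)

/-- The weight `w(x) = x⁻¹ (1-x)^(1/ε) (x+1)^(-1/ε)`. -/
def w (ε x : ℝ) : ℝ := x⁻¹ * (1 - x) ^ (1 / ε) * (x + 1) ^ (-1 / ε)

/-- The measure `w(x) dx` on the interval `(0,1)`. -/
def weightMeasure (ε : ℝ) : Measure ℝ :=
  (volume.restrict (Ioo (0 : ℝ) 1)).withDensity fun x => ENNReal.ofReal (w ε x)

/-- The complex Hilbert space `L²((0,1), w(x) dx)`. -/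
abbrev L2w (ε : ℝ) : Type := Lp ℂ 2 (weightMeasure ε)

/-- `f` is smooth on the closed interval `[0,1]` and `f(0) = 0`. -/
def IsSmoothVanishing (f : ℝ → ℂ) : Prop :=
  ContDiffOn ℝ ∞ f (Icc 0 1) ∧ f 0 = 0

/-- The differential expression `-w⁻¹ (p f')'`, to be used at points of `(0,1)`. -/
def slExpr (ε : ℝ) (f : ℝ → ℂ) (x : ℝ) : ℂ :=
  -((w ε x)⁻¹ • deriv (fun y => p ε y • deriv f y) x)

theorem ae_weightMeasure_mem (ε : ℝ) : ∀ᵐ x ∂(weightMeasure ε), x ∈ Ioo (0 : ℝ) 1 :=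
  (withDensity_absolutelyContinuous _ _).ae_le (ae_restrict_mem measurableSet_Ioo)

theorem w_pos (ε : ℝ) {x : ℝ} (hx : x ∈ Ioo (0 : ℝ) 1) : 0 < w ε x := by
  have h1 : 0 < 1 - x := by linarith [hx.2]
  have h2 : 0 < x + 1 := by linarith [hx.1]
  have h3 : 0 < x := hx.1
  unfold w
  positivity

theorem differentiableAt_p (ε : ℝ) {x : ℝ} (hx : x ∈ Ioo (0 : ℝ) 1) :
    DifferentiableAt ℝ (p ε) x := by
  have h1 : (1 - x) ≠ 0 := by linarith [hx.2]
  have h2 : (x + 1) ≠ 0 := by linarith [hx.1]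
  unfold p
  exact (((differentiableAt_const _).sub differentiableAt_id).rpow_const (Or.inl h1)).mul
    ((differentiableAt_id.add (differentiableAt_const _)).rpow_const (Or.inl h2))

theorem IsSmoothVanishing.contDiffAt {f : ℝ → ℂ} (hf : IsSmoothVanishing f) {x : ℝ}
    (hx : x ∈ Ioo (0 : ℝ) 1) : ContDiffAt ℝ ∞ f x :=
  (hf.1 x (Ioo_subset_Icc_self hx)).contDiffAt (Icc_mem_nhds hx.1 hx.2)

theorem IsSmoothVanishing.differentiableAt_flux {f : ℝ → ℂ} (hf : IsSmoothVanishing f) (ε : ℝ)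
    {x : ℝ} (hx : x ∈ Ioo (0 : ℝ) 1) :
    DifferentiableAt ℝ (fun y => p ε y • deriv f y) x := by
  have hO : ContDiffOn ℝ 1 (deriv f) (Ioo 0 1) :=
    (hf.1.mono Ioo_subset_Icc_self).deriv_of_isOpen isOpen_Ioo (by
      norm_num
      exact WithTop.coe_le_coe.2 le_top)
  have h : ContDiffAt ℝ 1 (deriv f) x := (hO x hx).contDiffAt (Ioo_mem_nhds hx.1 hx.2)
  exact (differentiableAt_p ε hx).smul (h.differentiableAt one_ne_zero)

theorem slExpr_congr (ε : ℝ) {f g : ℝ → ℂ} (h : EqOn f g (Ioo 0 1)) {x : ℝ}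
    (hx : x ∈ Ioo (0 : ℝ) 1) : slExpr ε f x = slExpr ε g x := by
  have key : (fun y => p ε y • deriv f y) =ᶠ[𝓝 x] fun y => p ε y • deriv g y := by
    filter_upwards [Ioo_mem_nhds hx.1 hx.2] with y hy
    have : f =ᶠ[𝓝 y] g := by
      filter_upwards [Ioo_mem_nhds hy.1 hy.2] with z hz using h hz
    rw [this.deriv_eq]
  simp only [slExpr, key.deriv_eq]

theorem slExpr_add (ε : ℝ) {f g : ℝ → ℂ} (hf : IsSmoothVanishing f) (hg : IsSmoothVanishing g)
    {x : ℝ} (hx : x ∈ Ioo (0 : ℝ) 1) : slExpr ε (f + g) x = slExpr ε f x + slExpr ε g x := by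
  have key : (fun y => p ε y • deriv (f + g) y) =ᶠ[𝓝 x]
      (fun y => p ε y • deriv f y) + fun y => p ε y • deriv g y := by
    filter_upwards [Ioo_mem_nhds hx.1 hx.2] with y hy
    have h1 := (hf.contDiffAt hy).differentiableAt (by simp)
    have h2 := (hg.contDiffAt hy).differentiableAt (by simp)
    rw [deriv_add h1 h2]
    simp [smul_add]
  have h1 := hf.differentiableAt_flux ε hx
  have h2 := hg.differentiableAt_flux ε hx
  simp only [slExpr, key.deriv_eq]
  rw [deriv_add h1 h2, smul_add, neg_add]

theorem slExpr_smul (ε : ℝ) {f : ℝ → ℂ} (c : ℂ) (x : ℝ) :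
    slExpr ε (c • f) x = c • slExpr ε f x := by
  have key : (fun y => p ε y • deriv (c • f) y) = c • fun y => p ε y • deriv f y := by
    funext y
    rw [deriv_const_smul_field]
    simp only [Pi.smul_apply]
    rw [smul_comm]
  simp only [slExpr, key]
  rw [deriv_const_smul_field, smul_comm, smul_neg]

/-- The graph of the Sturm-Liouville operator: all pairs `(f, -w⁻¹ (p f')')` of elements of
`L²((0,1), w dx)` with `f` smooth on `[0,1]` and `f(0) = 0`. -/
def slGraph (ε : ℝ) : Submodule ℂ (L2w ε × L2w ε) where
  carrier := {q | ∃ f : ℝ → ℂ, IsSmoothVanishing f ∧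
    (q.1 : ℝ → ℂ) =ᵐ[weightMeasure ε] f ∧ (q.2 : ℝ → ℂ) =ᵐ[weightMeasure ε] slExpr ε f}
  zero_mem' := by
    refine ⟨0, ⟨contDiffOn_const, rfl⟩, Lp.coeFn_zero _ _ _, ?_⟩
    have h0 : slExpr ε (0 : ℝ → ℂ) = 0 := by
      funext x
      simpa using slExpr_smul ε (f := 0) 0 x
    rw [h0]
    exact Lp.coeFn_zero _ _ _
  add_mem' := by
    rintro a b ⟨f, hf, hf1, hf2⟩ ⟨g, hg, hg1, hg2⟩
    refine ⟨f + g, ⟨hf.1.add hg.1, by simp [hf.2, hg.2]⟩,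
      (Lp.coeFn_add _ _).trans (hf1.add hg1), (Lp.coeFn_add _ _).trans ?_⟩
    filter_upwards [hf2, hg2, ae_weightMeasure_mem ε] with x h1 h2 hx
    rw [slExpr_add ε hf hg hx, Pi.add_apply, h1, h2]
  smul_mem' := by
    rintro c a ⟨f, hf, hf1, hf2⟩
    refine ⟨c • f, ⟨contDiffOn_const.smul hf.1, by simp [hf.2]⟩,
      (Lp.coeFn_smul _ _).trans (hf1.const_smul c), (Lp.coeFn_smul _ _).trans ?_⟩
    filter_upwards [hf2] with x h1
    rw [slExpr_smul, Pi.smul_apply, h1]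

/-- The Sturm-Liouville operator `L f = -w⁻¹ (p f')'` in `L²((0,1), w dx)` whose domain consists
of the functions that are smooth on `[0,1]` and vanish at `0`. -/
def slOperator (ε : ℝ) : L2w ε →ₗ.[ℂ] L2w ε := (slGraph ε).toLinearPMap

theorem eqOn_of_ae_weightMeasure (ε : ℝ) {f g : ℝ → ℂ} (hf : ContinuousOn f (Ioo 0 1))
    (hg : ContinuousOn g (Ioo 0 1)) (h : f =ᵐ[weightMeasure ε] g) : EqOn f g (Ioo 0 1) := by
  have hw : Measurable fun x => ENNReal.ofReal (w ε x) := by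
    unfold w
    fun_prop
  have h1 : f =ᵐ[volume.restrict (Ioo (0 : ℝ) 1)] g := by
    have h2 := (ae_withDensity_iff hw).1 h
    filter_upwards [h2, ae_restrict_mem measurableSet_Ioo] with x hx hx'
    exact hx (ENNReal.ofReal_pos.2 (w_pos ε hx')).ne'
  exact Measure.eqOn_of_ae_eq h1 hf hg (by
    rw [interior_Ioo]
    exact subset_closure)

theorem slOperator_graph (ε : ℝ) : (slOperator ε).graph = slGraph ε := by
  refine Submodule.toLinearPMap_graph_eq _ ?_
  rintro ⟨a, b⟩ ⟨f, hf, hf1, hf2⟩ ha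
  simp only at ha hf1 hf2 ⊢
  subst ha
  have hf0 : EqOn f 0 (Ioo 0 1) := eqOn_of_ae_weightMeasure ε
    (hf.1.continuousOn.mono Ioo_subset_Icc_self) continuousOn_const
    (hf1.symm.trans (Lp.coeFn_zero _ _ _))
  refine Lp.ext (hf2.trans (EventuallyEq.trans ?_ (Lp.coeFn_zero _ _ _).symm))
  filter_upwards [ae_weightMeasure_mem ε] with x hx
  rw [slExpr_congr ε hf0 hx]
  simpa using slExpr_smul ε (f := 0) 0 x

theorem memLp_weight_of_bound {ε : ℝ} (hε : 0 < ε) {g : ℝ → ℂ} (hg : ContinuousOn g (Ioo 0 1))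
    {C : ℝ} (hC : ∀ x ∈ Ioo (0 : ℝ) 1, ‖g x‖ ≤ C * x) : MemLp g 2 (weightMeasure ε) := by
  have hwm : Measurable fun x => ENNReal.ofReal (w ε x) := by
    unfold w
    fun_prop
  have hm : AEStronglyMeasurable g (weightMeasure ε) :=
    (hg.aestronglyMeasurable measurableSet_Ioo).mono_ac (withDensity_absolutelyContinuous _ _)
  refine ⟨hm, ?_⟩
  rw [eLpNorm_lt_top_iff_lintegral_rpow_enorm_lt_top two_ne_zero ENNReal.ofNat_ne_top]
  rw [weightMeasure, lintegral_withDensity_eq_lintegral_mul_non_measurable _ hwm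
    (Eventually.of_forall fun x => ENNReal.ofReal_lt_top)]
  have hb : ∀ x ∈ Ioo (0 : ℝ) 1, ((fun x => ENNReal.ofReal (w ε x)) *
      fun x => ‖g x‖ₑ ^ (ENNReal.toReal 2)) x ≤ ENNReal.ofReal (C ^ 2) := by
    intro x hx
    have h1 : 0 < 1 - x := by linarith [hx.2]
    have h3 : 0 < x := hx.1
    have hw1 : w ε x ≤ x⁻¹ := by
      unfold w
      have e1 : (1 - x) ^ (1 / ε) ≤ 1 := Real.rpow_le_one h1.le (by linarith) (by positivity)
      have e2 : (x + 1) ^ (-1 / ε) ≤ 1 := Real.rpow_le_one_of_one_le_of_nonpos (by linarith)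
        (div_nonpos_of_nonpos_of_nonneg (by norm_num) hε.le)
      have e3 : 0 ≤ (x + 1) ^ (-1 / ε) := Real.rpow_nonneg (by linarith) _
      calc x⁻¹ * (1 - x) ^ (1 / ε) * (x + 1) ^ (-1 / ε) ≤ x⁻¹ * 1 * 1 := by gcongr
        _ = x⁻¹ := by ring
    have hn : ‖g x‖ₑ ^ (ENNReal.toReal 2) = ENNReal.ofReal (‖g x‖ ^ 2) := by
      rw [← ofReal_norm, ENNReal.toReal_ofNat,
        ENNReal.ofReal_rpow_of_nonneg (norm_nonneg _) (by norm_num)]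
      norm_num
    simp only [Pi.mul_apply]
    rw [hn, ← ENNReal.ofReal_mul (w_pos ε hx).le]
    refine ENNReal.ofReal_le_ofReal ?_
    have h4 := pow_le_pow_left₀ (norm_nonneg _) (hC x hx) 2
    calc w ε x * ‖g x‖ ^ 2 ≤ x⁻¹ * (C * x) ^ 2 := by
          have := w_pos ε hx
          gcongr
      _ = C ^ 2 * x := by field_simp
      _ ≤ C ^ 2 * 1 := by
          have := hx.2.le
          gcongr
      _ = C ^ 2 := mul_one _
  refine (setLIntegral_mono measurable_const hb).trans_lt ?_
  simp [ENNReal.ofReal_lt_top]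

theorem hasDerivAt_p (ε : ℝ) {x : ℝ} (hx : x ∈ Ioo (0 : ℝ) 1) :
    HasDerivAt (p ε) (w ε x * (x * (-2 / ε - 2 * x))) x := by
  have h1 : 0 < 1 - x := by linarith [hx.2]
  have h2 : 0 < x + 1 := by linarith [hx.1]
  have h3 : x ≠ 0 := hx.1.ne'
  have a1 := ((hasDerivAt_id x).const_sub 1).rpow_const (p := 1 + 1 / ε) (Or.inl h1.ne')
  have a2 := ((hasDerivAt_id x).add_const 1).rpow_const (p := 1 - 1 / ε) (Or.inl h2.ne')
  refine (a1.mul a2).congr_deriv ?_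
  simp only [id]
  have e1 : (1 - x) ^ (1 + 1 / ε - 1) = (1 - x) ^ (1 / ε) := by congr 1; ring
  have e2 : (1 - x) ^ (1 + 1 / ε) = (1 - x) * (1 - x) ^ (1 / ε) := by
    rw [Real.rpow_add h1, Real.rpow_one]
  have e3 : (x + 1) ^ (1 - 1 / ε - 1) = (x + 1) ^ (-1 / ε) := by congr 1; ring
  have e4 : (x + 1) ^ (1 - 1 / ε) = (x + 1) * (x + 1) ^ (-1 / ε) := by
    rw [show 1 - 1 / ε = 1 + -1 / ε by ring, Real.rpow_add h2, Real.rpow_one]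
  rw [e1, e2, e3, e4]
  unfold w
  field_simp
  ring

theorem p_eq (ε : ℝ) {x : ℝ} (hx : x ∈ Ioo (0 : ℝ) 1) :
    p ε x = w ε x * (x * (1 - x ^ 2)) := by
  have h1 : 0 < 1 - x := by linarith [hx.2]
  have h2 : 0 < x + 1 := by linarith [hx.1]
  have h3 : x ≠ 0 := hx.1.ne'
  unfold p w
  rw [Real.rpow_add h1, Real.rpow_one, show 1 - 1 / ε = 1 + -1 / ε by ring, Real.rpow_add h2,
    Real.rpow_one]
  field_simp
  ring

/-- Every smooth function on `[0,1]` that vanishes at `0` belongs to the domain of the operator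
(together with its image under the differential expression it is square integrable). -/
theorem IsSmoothVanishing.memLp {ε : ℝ} (hε : 0 < ε) {f : ℝ → ℂ} (hf : IsSmoothVanishing f) :
    MemLp f 2 (weightMeasure ε) ∧ MemLp (slExpr ε f) 2 (weightMeasure ε) := by
  have hu : UniqueDiffOn ℝ (Icc (0 : ℝ) 1) := uniqueDiffOn_Icc one_pos
  set f1 := derivWithin f (Icc 0 1) with hf1
  have c1 : ContDiffOn ℝ ∞ f1 (Icc 0 1) := hf.1.derivWithin hu (by simp)
  set f2 := derivWithin f1 (Icc 0 1) with hf2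
  have c2 : ContDiffOn ℝ ∞ f2 (Icc 0 1) := c1.derivWithin hu (by simp)
  obtain ⟨A, hA⟩ := isCompact_Icc.exists_bound_of_continuousOn c1.continuousOn
  obtain ⟨B, hB⟩ := isCompact_Icc.exists_bound_of_continuousOn c2.continuousOn
  have hA0 : 0 ≤ A := (norm_nonneg _).trans (hA 0 ⟨le_rfl, zero_le_one⟩)
  have hB0 : 0 ≤ B := (norm_nonneg _).trans (hB 0 ⟨le_rfl, zero_le_one⟩)
  have d1 : ∀ x ∈ Ioo (0 : ℝ) 1, deriv f x = f1 x := fun x hx =>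
    (derivWithin_of_mem_nhds (Icc_mem_nhds hx.1 hx.2)).symm
  have d2 : ∀ x ∈ Ioo (0 : ℝ) 1, HasDerivAt f1 (f2 x) x := fun x hx =>
    ((c1.differentiableOn (by simp)) x (Ioo_subset_Icc_self hx)).hasDerivWithinAt.hasDerivAt
      (Icc_mem_nhds hx.1 hx.2)
  constructor
  · refine memLp_weight_of_bound hε (hf.1.continuousOn.mono Ioo_subset_Icc_self) (C := A) ?_
    intro x hx
    have := (convex_Icc (0 : ℝ) 1).norm_image_sub_le_of_norm_derivWithin_le
      (hf.1.differentiableOn (by simp)) hA ⟨le_rfl, zero_le_one⟩ (Ioo_subset_Icc_self hx)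
    simpa [hf.2, abs_of_pos hx.1] using this
  · have key : ∀ x ∈ Ioo (0 : ℝ) 1, slExpr ε f x =
        -((x * (1 - x ^ 2)) • f2 x + (x * (-2 / ε - 2 * x)) • f1 x) := by
      intro x hx
      have e : (fun y => p ε y • deriv f y) =ᶠ[𝓝 x] fun y => p ε y • f1 y := by
        filter_upwards [Ioo_mem_nhds hx.1 hx.2] with y hy
        rw [d1 y hy]
      have hw := (w_pos ε hx).ne'
      have hd : HasDerivAt (fun y => p ε y • f1 y) _ x := (hasDerivAt_p ε hx).smul (d2 x hx)
      simp only [slExpr, e.deriv_eq]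
      rw [hd.deriv, p_eq ε hx, smul_add, smul_smul, smul_smul, inv_mul_cancel_left₀ hw,
        inv_mul_cancel_left₀ hw]
    have hc : ContinuousOn (fun x : ℝ =>
        -((x * (1 - x ^ 2)) • f2 x + (x * (-2 / ε - 2 * x)) • f1 x)) (Ioo 0 1) := by
      have k1 := c1.continuousOn.mono Ioo_subset_Icc_self
      have k2 := c2.continuousOn.mono Ioo_subset_Icc_self
      fun_prop
    refine memLp_weight_of_bound hε (hc.congr key) (C := B + (2 / ε + 2) * A) ?_
    intro x hx
    have hx0 := hx.1.le
    have hx1 := hx.2.le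
    have n1 : ‖(x * (1 - x ^ 2)) • f2 x‖ ≤ x * B := by
      have h0 : 0 ≤ 1 - x ^ 2 := by nlinarith
      have h1 : 1 - x ^ 2 ≤ 1 := by nlinarith
      rw [norm_smul, Real.norm_eq_abs, abs_of_nonneg (by positivity)]
      have := hB x (Ioo_subset_Icc_self hx)
      calc x * (1 - x ^ 2) * ‖f2 x‖ ≤ x * 1 * B := by gcongr
        _ = x * B := by ring
    have n2 : ‖(x * (-2 / ε - 2 * x)) • f1 x‖ ≤ x * ((2 / ε + 2) * A) := by
      have h0 : |-2 / ε - 2 * x| ≤ 2 / ε + 2 := by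
        have : 0 < 2 / ε := by positivity
        rw [abs_le, neg_div]
        constructor <;> linarith
      rw [norm_smul, Real.norm_eq_abs, abs_mul, abs_of_nonneg hx0]
      have := hA x (Ioo_subset_Icc_self hx)
      calc x * |-2 / ε - 2 * x| * ‖f1 x‖ ≤ x * (2 / ε + 2) * A := by gcongr
        _ = x * ((2 / ε + 2) * A) := by ring
    rw [key x hx, norm_neg]
    calc _ ≤ _ := norm_add_le _ _
      _ ≤ x * B + x * ((2 / ε + 2) * A) := add_le_add n1 n2
      _ = (B + (2 / ε + 2) * A) * x := by ring

/-- The eigenspace of a (possibly unbounded) operator `T` at `z`. -/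
def eigenspace {E : Type*} [AddCommGroup E] [Module ℂ E] (T : E →ₗ.[ℂ] E) (z : ℂ) :
    Submodule ℂ E :=
  T.graph.comap (LinearMap.prod LinearMap.id (z • LinearMap.id))

theorem mem_eigenspace {E : Type*} [AddCommGroup E] [Module ℂ E] {T : E →ₗ.[ℂ] E} {z : ℂ}
    {x : E} : x ∈ eigenspace T z ↔ ∃ y : T.domain, (y : E) = x ∧ T y = z • x := by
  simp [eigenspace, LinearPMap.mem_graph_iff]

/-- `μ 1 ≤ μ 2 ≤ …` is the list of all eigenvalues of `T` in increasing order, each of them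
repeated according to its multiplicity (all complex eigenvalues are listed, so they are real). -/
def IsEigenvalueSequence {E : Type*} [AddCommGroup E] [Module ℂ E] (T : E →ₗ.[ℂ] E)
    (μ : ℕ+ → ℝ) : Prop :=
  Monotone μ ∧
    ∀ z : ℂ, Module.rank ℂ (eigenspace T z) =
      Cardinal.lift (Cardinal.mk {n : ℕ+ // (μ n : ℂ) = z})

/-- `β = ∫₀¹ y^(-1/2) (1-y)^(-1/2) (1+y)^(-1/2) dy`. -/
def β : ℝ :=
  ∫ y in (0 : ℝ)..1, y ^ (-1 / 2 : ℝ) * (1 - y) ^ (-1 / 2 : ℝ) * (1 + y) ^ (-1 / 2 : ℝ)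

/-- `ψ(t) = ∫₀ᵗ √(w/p) dy`, an increasing bijection of `[0,1]` onto `[0,β]`. -/
def ψ (ε t : ℝ) : ℝ := ∫ y in (0 : ℝ)..t, √(w ε y / p ε y)

/-- The inverse function `φ : [0,β] → [0,1]` of `ψ`. -/
def φ (ε : ℝ) : ℝ → ℝ := Function.invFunOn (ψ ε) (Icc 0 1)

/-- `c(s) = (w(φ(s)) p(φ(s)))^(-1/4)`. -/
def c (ε s : ℝ) : ℝ := (w ε (φ ε s) * p ε (φ ε s)) ^ (-1 / 4 : ℝ)

/-- The potential `V = -c c'' (p∘φ)/φ' - c c' ((p∘φ)/φ')'` on `(0,β)`. -/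
def V (ε s : ℝ) : ℝ :=
  -(c ε s * deriv (deriv (c ε)) s * (p ε (φ ε s) / deriv (φ ε) s)) -
    c ε s * deriv (c ε) s * deriv (fun t => p ε (φ ε t) / deriv (φ ε) t) s

end

end SturmLiouville

namespace SturmLiouville

noncomputable section

open Real (sin cos arctan exp sinc)

/-! ### Calculus on open intervals -/

/-! The Liouville substitution s = ψ(x), g = (wp)^(1/4) f turns -(p f')' = l w f into -g'' + V g = l
g on (0, β) (`IsSol.hasDerivAt_liouville`, `V_eq`). Here V tends to +∞ at both ends, at most like
the inverse square of the distance; at β this needs ε < 2.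

Both endpoints are regular singular points. Smoothness on [0,1] together with f(0) = 0 leaves one
solution u at 0 and one solution v at 1, up to scalars, each given by a power series. A real l is an
eigenvalue exactly when u and v are proportional, that is, when their Wronskian vanishes at 1/2
(`IsClassical.matching`, `exists_isClassical`), and it is then simple. Nonreal eigenvalues are
excluded by the symmetry of the operator.

Let θ₁ and θ₂ be the Prüfer angles of the transformed u and v, measured from the left and from the
right end up to the common point ψ(1/2). The Wronskian is a nonzero multiple of sin(Θ), where Θ(l) =
θ₁ + θ₂ (`exists_angles`). Θ is continuous and strictly increasing in l
(`IsPrueferAngle.strictMono_continuous`), lies below π at l = min V and is unbounded, so μ_n is the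
unique root of Θ = nπ.

The bounds compare with constant coefficients. An angle A with tan A = κ tan θ grows at speed at
most κ where l - V ≤ κ² and at least κ where l - V ≥ κ², and this rescaling preserves the condition
"sum equal to nπ". Taking κ² = l - α on all of (0, β) gives nπ ≤ κβ, the lower bound. At distance at
least δ from the ends V ≤ C/δ², so κ² = l - C/δ² gives κ(β - 2δ) ≤ nπ; the errors n²δ and δ⁻²
balance at δ ~ n^(-2/3), which produces n^(4/3) (`IsTotalAngle.le_eigenvalue`,
`IsTotalAngle.exists_eigenvalue_le`). The limit of μ_n/n² follows from the two bounds. -/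

theorem monotoneOn_Ioo_of_hasDerivAt {f f' : ℝ → ℝ} {a b : ℝ}
    (h : ∀ x ∈ Ioo a b, HasDerivAt f (f' x) x) (h0 : ∀ x ∈ Ioo a b, 0 ≤ f' x) :
    MonotoneOn f (Ioo a b) := by
  refine monotoneOn_of_deriv_nonneg (convex_Ioo a b)
    (fun x hx => (h x hx).continuousAt.continuousWithinAt) ?_ ?_ <;> rw [interior_Ioo]
  · exact fun x hx => (h x hx).differentiableAt.differentiableWithinAt
  · exact fun x hx => (h x hx).deriv ▸ h0 x hx

theorem antitoneOn_Ioo_of_hasDerivAt {f f' : ℝ → ℝ} {a b : ℝ}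
    (h : ∀ x ∈ Ioo a b, HasDerivAt f (f' x) x) (h0 : ∀ x ∈ Ioo a b, f' x ≤ 0) :
    AntitoneOn f (Ioo a b) := by
  have := monotoneOn_Ioo_of_hasDerivAt (f := fun x => -f x) (fun x hx => (h x hx).neg)
    (fun x hx => neg_nonneg.2 (h0 x hx))
  exact fun x hx y hy hxy => neg_le_neg_iff.1 (this hx hy hxy)

theorem strictMonoOn_Ioo_of_hasDerivAt {f f' : ℝ → ℝ} {a b : ℝ}
    (h : ∀ x ∈ Ioo a b, HasDerivAt f (f' x) x) (h0 : ∀ x ∈ Ioo a b, 0 < f' x) :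
    StrictMonoOn f (Ioo a b) := by
  refine strictMonoOn_of_deriv_pos (convex_Ioo a b)
    (fun x hx => (h x hx).continuousAt.continuousWithinAt) ?_
  rw [interior_Ioo]
  exact fun x hx => (h x hx).deriv ▸ h0 x hx

theorem eq_of_hasDerivAt_zero {E : Type*} [NormedAddCommGroup E] [NormedSpace ℝ E] {f : ℝ → E}
    {a b : ℝ} (h : ∀ x ∈ Ioo a b, HasDerivAt f 0 x) {x y : ℝ} (hx : x ∈ Ioo a b)
    (hy : y ∈ Ioo a b) : f x = f y :=
  isOpen_Ioo.is_const_of_deriv_eq_zero isPreconnected_Ioo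
    (fun z hz => (h z hz).differentiableAt.differentiableWithinAt) (fun z hz => (h z hz).deriv)
    hx hy

theorem exists_primitive {K : ℝ → ℝ} {a b x₀ : ℝ} (hK : ContinuousOn K (Ioo a b))
    (hx : x₀ ∈ Ioo a b) : ∃ M : ℝ → ℝ, M x₀ = 0 ∧ ∀ x ∈ Ioo a b, HasDerivAt M (K x) x := by
  refine ⟨fun t => ∫ y in x₀..t, K y, by simp, fun x h => ?_⟩
  have hsub : uIcc x₀ x ⊆ Ioo a b := (ordConnected_Ioo).uIcc_subset hx h
  refine intervalIntegral.integral_hasDerivAt_right ((hK.mono hsub).intervalIntegrable) ?_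
    (hK.continuousAt (Ioo_mem_nhds h.1 h.2))
  exact hK.stronglyMeasurableAtFilter isOpen_Ioo x h

/-- If a monotone function on `(0,b)` tends to `0` at `0`, it is nonnegative. -/
theorem nonneg_of_monotoneOn_of_tendsto {f : ℝ → ℝ} {b l : ℝ} (hf : MonotoneOn f (Ioo 0 b))
    (h0 : Tendsto f (𝓝[>] 0) (𝓝 l)) {x : ℝ} (hx : x ∈ Ioo 0 b) : l ≤ f x := by
  refine le_of_tendsto h0 ?_
  filter_upwards [Ioo_mem_nhdsGT hx.1] with y hy
  exact hf ⟨hy.1, hy.2.trans hx.2⟩ hx hy.2.le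

/-! ### Rescaled angles -/

/-- The increasing reparametrization of angles with `tan (rescale κ θ) = κ * tan θ`. -/
def rescale (κ θ : ℝ) : ℝ :=
  θ + arctan ((κ - 1) * (sin θ * cos θ) / (cos θ ^ 2 + κ * sin θ ^ 2))

theorem cos_sq_add_mul_sin_sq_pos {κ : ℝ} (hκ : 0 < κ) (θ : ℝ) :
    0 < cos θ ^ 2 + κ * sin θ ^ 2 := by
  have h := Real.sin_sq_add_cos_sq θ
  rcases eq_or_ne (sin θ) 0 with h0 | h0
  · rw [h0] at h ⊢; nlinarith
  · have := sq_pos_of_ne_zero h0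
    positivity

/-- If tan A = κ tan θ, the argument of `arctan` in `rescale` is tan(A - θ). Its denominator never
vanishes, so the formula is smooth on all of ℝ and needs no choice of branch. -/
theorem hasDerivAt_rescale {κ : ℝ} (hκ : 0 < κ) (θ : ℝ) :
    HasDerivAt (rescale κ) (κ / (cos θ ^ 2 + κ ^ 2 * sin θ ^ 2)) θ := by
  have h := Real.sin_sq_add_cos_sq θ
  have hD := cos_sq_add_mul_sin_sq_pos hκ θ
  have hE := cos_sq_add_mul_sin_sq_pos (pow_pos hκ 2) θ
  have hs := Real.hasDerivAt_sin θ
  have hc := Real.hasDerivAt_cos θ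
  have h1 := ((hs.mul hc).const_mul (κ - 1)).div ((hc.pow 2).add ((hs.pow 2).const_mul κ)) hD.ne'
  have h2 := (hasDerivAt_id θ).add h1.arctan
  refine h2.congr_deriv ?_
  simp only [Pi.mul_apply, Pi.pow_apply, Pi.div_apply, Pi.add_apply]
  set s := sin θ
  set c := cos θ
  have hc2 : c ^ 2 = 1 - s ^ 2 := by linarith
  -- This is (c² + κs²)² + ((κ - 1)sc)² = (c² + s²)(c² + κ²s²) with c² + s² = 1.
  have e1 : 1 + ((κ - 1) * (s * c) / (c ^ 2 + κ * s ^ 2)) ^ 2 =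
      (c ^ 2 + κ ^ 2 * s ^ 2) / (c ^ 2 + κ * s ^ 2) ^ 2 := by
    rw [eq_div_iff (by positivity), add_mul, div_pow, div_mul_cancel₀ _ (by positivity), one_mul,
      mul_pow, mul_pow]
    rw [hc2]; ring
  rw [e1]
  field_simp
  have hc4 : c ^ 4 = (1 - s ^ 2) ^ 2 := by rw [← hc2]; ring
  ring_nf
  rw [hc4, hc2]
  ring

theorem rescale_strictMono {κ : ℝ} (hκ : 0 < κ) : StrictMono (rescale κ) :=
  strictMono_of_deriv_pos fun θ => by
    rw [(hasDerivAt_rescale hκ θ).deriv]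
    exact div_pos hκ (cos_sq_add_mul_sin_sq_pos (pow_pos hκ 2) θ)

theorem rescale_zero (κ : ℝ) : rescale κ 0 = 0 := by simp [rescale]

/-- Two angles with sum nπ keep that sum after rescaling, for every κ. Hence the angles coming from
the two endpoints can be rescaled separately although neither one is a multiple of π. -/
theorem rescale_nat_mul_pi_sub (κ : ℝ) (n : ℕ) (θ : ℝ) :
    rescale κ (n * Real.pi - θ) = n * Real.pi - rescale κ θ := by
  have h1 : sin (n * Real.pi - θ) * cos (n * Real.pi - θ) = -(sin θ * cos θ) := by
    rw [Real.sin_nat_mul_pi_sub, Real.cos_nat_mul_pi_sub]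
    have : ((-1 : ℝ) ^ n) * (-1) ^ n = 1 := by rw [← mul_pow]; simp
    linear_combination (-(sin θ * cos θ)) * this
  have h2 : sin (n * Real.pi - θ) ^ 2 = sin θ ^ 2 := by
    rw [Real.sin_nat_mul_pi_sub, neg_sq, mul_pow, ← pow_mul, mul_comm n 2, pow_mul]; simp
  have h3 : cos (n * Real.pi - θ) ^ 2 = cos θ ^ 2 := by
    rw [Real.cos_nat_mul_pi_sub, mul_pow, ← pow_mul, mul_comm n 2, pow_mul]; simp
  unfold rescale
  rw [h1, h2, h3, mul_neg, neg_div, Real.arctan_neg]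
  ring

theorem rescale_lt (κ θ : ℝ) : rescale κ θ < θ + Real.pi / 2 := by
  unfold rescale
  have := Real.arctan_lt_pi_div_two ((κ - 1) * (sin θ * cos θ) / (cos θ ^ 2 + κ * sin θ ^ 2))
  linarith

/-! ### Prüfer angles at a singular endpoint -/

/-- `θ` is a Prüfer angle of `g'' + q g = 0` on `(0,b)`, normalized to vanish at `0`. -/
structure IsPrueferAngle (q : ℝ → ℝ) (b : ℝ) (θ : ℝ → ℝ) : Prop where
  hasDerivAt : ∀ s ∈ Ioo 0 b, HasDerivAt θ (cos (θ s) ^ 2 + q s * sin (θ s) ^ 2) s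
  tendsto : Tendsto θ (𝓝[>] 0) (𝓝 0)
  pos : ∀ s ∈ Ioo 0 b, 0 < θ s

/-- The rescaled angle moves at speed κ(cos² + q sin²)/(cos² + κ² sin²), which is at most κ when q ≤
κ². The comparison starts from the limit 0 at the singular endpoint. -/
theorem IsPrueferAngle.rescale_le {q θ : ℝ → ℝ} {b κ s : ℝ} (h : IsPrueferAngle q b θ)
    (hκ : 0 < κ) (hq : ∀ s ∈ Ioo 0 b, q s ≤ κ ^ 2) (hs : s ∈ Ioo 0 b) :
    rescale κ (θ s) ≤ κ * s := by
  have hd : ∀ t ∈ Ioo 0 b, HasDerivAt (fun t => κ * t - rescale κ (θ t))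
      (κ - κ / (cos (θ t) ^ 2 + κ ^ 2 * sin (θ t) ^ 2) *
        (cos (θ t) ^ 2 + q t * sin (θ t) ^ 2)) t := fun t ht => by
    exact (((hasDerivAt_id t).const_mul κ).sub
      ((hasDerivAt_rescale hκ (θ t)).comp t (h.hasDerivAt t ht))).congr_deriv (by simp)
  have hm := monotoneOn_Ioo_of_hasDerivAt hd fun t ht => by
    have hE := cos_sq_add_mul_sin_sq_pos (pow_pos hκ 2) (θ t)
    have : cos (θ t) ^ 2 + q t * sin (θ t) ^ 2 ≤ cos (θ t) ^ 2 + κ ^ 2 * sin (θ t) ^ 2 := by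
      have := hq t ht
      gcongr
    rw [sub_nonneg, div_mul_eq_mul_div, div_le_iff₀ hE]
    gcongr
  have h0 : Tendsto (fun t => κ * t - rescale κ (θ t)) (𝓝[>] 0) (𝓝 0) := by
    have h1 := (hasDerivAt_rescale hκ 0).continuousAt.tendsto.comp h.tendsto
    have h2 : Tendsto (fun t : ℝ => κ * t) (𝓝[>] 0) (𝓝 (κ * 0)) :=
      ((continuous_const_mul κ).tendsto 0).mono_left nhdsWithin_le_nhds
    simpa [rescale_zero] using h2.sub h1
  have := nonneg_of_monotoneOn_of_tendsto hm h0 hs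
  linarith

/-- The speed of the rescaled angle is at least κ from δ on. Nothing but positivity of the angle is
used at δ, which costs the term κδ. -/
theorem IsPrueferAngle.le_rescale {q θ : ℝ → ℝ} {b κ δ s : ℝ} (h : IsPrueferAngle q b θ)
    (hκ : 0 < κ) (hδ : 0 < δ) (hq : ∀ t ∈ Ioo 0 b, δ ≤ t → κ ^ 2 ≤ q t) (hδs : δ ≤ s)
    (hs : s < b) : κ * (s - δ) ≤ rescale κ (θ s) := by
  have hsub : Icc δ s ⊆ Ioo 0 b := fun t ht => ⟨hδ.trans_le ht.1, ht.2.trans_lt hs⟩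
  have hd : ∀ t ∈ Icc δ s, HasDerivAt (fun t => rescale κ (θ t) - κ * t)
      (κ / (cos (θ t) ^ 2 + κ ^ 2 * sin (θ t) ^ 2) *
        (cos (θ t) ^ 2 + q t * sin (θ t) ^ 2) - κ) t := fun t ht => by
    exact (((hasDerivAt_rescale hκ (θ t)).comp t (h.hasDerivAt t (hsub ht))).sub
      ((hasDerivAt_id t).const_mul κ)).congr_deriv (by simp)
  have hm : MonotoneOn (fun t => rescale κ (θ t) - κ * t) (Icc δ s) := by
    refine monotoneOn_of_deriv_nonneg (convex_Icc δ s)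
      (fun x hx => (hd x hx).continuousAt.continuousWithinAt)
      (fun x hx => (hd x (interior_subset hx)).differentiableAt.differentiableWithinAt) ?_
    intro t ht
    have ht := interior_subset ht
    rw [(hd t ht).deriv]
    have hE := cos_sq_add_mul_sin_sq_pos (pow_pos hκ 2) (θ t)
    have : cos (θ t) ^ 2 + κ ^ 2 * sin (θ t) ^ 2 ≤ cos (θ t) ^ 2 + q t * sin (θ t) ^ 2 := by
      have := hq t (hsub ht) ht.1
      gcongr
    rw [sub_nonneg, div_mul_eq_mul_div, le_div_iff₀ hE]
    gcongr
  have h1 := hm ⟨le_rfl, hδs⟩ ⟨hδs, le_rfl⟩ hδs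
  have h2 := rescale_strictMono hκ (h.pos δ (hsub ⟨le_rfl, hδs⟩))
  rw [rescale_zero] at h2
  simp only at h1
  linarith

/-- A Prüfer angle stays below `π/2` as long as `q` is negative. -/
theorem IsPrueferAngle.le_pi_div_two {q θ : ℝ → ℝ} {b s₁ : ℝ} (h : IsPrueferAngle q b θ)
    (hs₁ : s₁ < b) (hq : ∀ t ∈ Ioc 0 s₁, q t < 0) {s : ℝ} (hs : s ∈ Ioc 0 s₁) :
    θ s ≤ Real.pi / 2 := by
  have hev : ∀ᶠ t in 𝓝[>] (0 : ℝ), θ t < Real.pi / 2 :=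
    h.tendsto.eventually_lt_const (by positivity)
  obtain ⟨t, ht, ht0, hts⟩ := (hev.and (Ioo_mem_nhdsGT hs.1)).exists
  have hsub : Icc t s ⊆ Ioo 0 b := fun x hx =>
    ⟨ht0.trans_le hx.1, (hx.2.trans hs.2).trans_lt hs₁⟩
  -- At height π/2 the derivative of θ equals q, which is negative, so θ cannot cross this barrier
  -- upwards.
  refine image_le_of_deriv_right_lt_deriv_boundary' (f := θ) (a := t) (b := s)
    (f' := fun x => cos (θ x) ^ 2 + q x * sin (θ x) ^ 2)
    (B := fun _ => Real.pi / 2) (B' := fun _ => 0)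
    (fun x hx => (h.hasDerivAt x (hsub hx)).continuousAt.continuousWithinAt)
    (fun x hx => (h.hasDerivAt x (hsub (Ico_subset_Icc_self hx))).hasDerivWithinAt)
    ht.le continuousOn_const (fun x _ => hasDerivWithinAt_const _ _ _) ?_ ⟨hts.le, le_rfl⟩
  intro x hx hx2
  simp only [hx2, Real.cos_pi_div_two, Real.sin_pi_div_two]
  have := hq x ⟨ht0.trans_le hx.1, hx.2.le.trans hs.2⟩
  linarith

/-- Writing sin(x - y) through `sinc` makes the difference of two Prüfer equations linear in the
difference of the angles, with a coefficient that stays continuous where the angles coincide. -/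
theorem sin_sq_sub_sin_sq (x y : ℝ) : sin x ^ 2 - sin y ^ 2 = sinc (x - y) * sin (x + y) * (x - y) := by
  have h : sinc (x - y) * (x - y) = sin (x - y) := by
    rcases eq_or_ne (x - y) 0 with h | h
    · simp [h]
    · rw [Real.sinc_of_ne_zero h, div_mul_cancel₀ _ h]
  rw [mul_right_comm, h, Real.sin_sub, Real.sin_add]
  have h1 := Real.sin_sq_add_cos_sq x
  have h2 := Real.sin_sq_add_cos_sq y
  linear_combination (sin y ^ 2) * h1 - (sin x ^ 2) * h2

theorem sinc_nonneg_of_abs_le {x : ℝ} (hx : |x| ≤ Real.pi) : 0 ≤ sinc x := by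
  have h0 : sinc x = sinc |x| := by
    rcases abs_choice x with h | h <;> rw [h]
    rw [Real.sinc_neg]
  rw [h0]
  rcases eq_or_ne |x| 0 with h | h
  · simp [h]
  · rw [Real.sinc_of_ne_zero h]
    exact div_nonneg (Real.sin_nonneg_of_nonneg_of_le_pi (abs_nonneg x) hx) (abs_nonneg x)

/-- Comparison of the Prüfer angles for two spectral parameters. -/
theorem IsPrueferAngle.lt_and_sub_le {V θ₁ θ₂ : ℝ → ℝ} {B b s₁ k l₁ l₂ : ℝ}
    (hV : ContinuousOn V (Ioo 0 B)) (h₁ : IsPrueferAngle (fun s => l₁ - V s) B θ₁)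
    (h₂ : IsPrueferAngle (fun s => l₂ - V s) B θ₂) (hl : l₁ < l₂) (hs₁ : 0 < s₁) (hsb : s₁ < b)
    (hb : b < B) (hV₁ : ∀ s ∈ Ioc 0 s₁, l₂ < V s) (hk : ∀ s ∈ Icc s₁ b, |l₂ - 1 - V s| ≤ k) :
    θ₁ b < θ₂ b ∧ θ₂ b - θ₁ b ≤ (l₂ - l₁) * (exp (k * b) * b) := by
  have hs₁B : s₁ < B := hsb.trans hb
  -- The difference D = θ₂ - θ₁ satisfies D' = K D + (l₂ - l₁) sin² θ₁.
  set K : ℝ → ℝ := fun s => (l₂ - 1 - V s) * (sinc (θ₂ s - θ₁ s) * sin (θ₂ s + θ₁ s)) with hK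
  have c₁ : ContinuousOn θ₁ (Ioo 0 B) := fun s hs =>
    (h₁.hasDerivAt s hs).continuousAt.continuousWithinAt
  have c₂ : ContinuousOn θ₂ (Ioo 0 B) := fun s hs =>
    (h₂.hasDerivAt s hs).continuousAt.continuousWithinAt
  have hKc : ContinuousOn K (Ioo 0 B) :=
    (continuousOn_const.sub hV).mul ((Real.continuous_sinc.comp_continuousOn (c₂.sub c₁)).mul
      (Real.continuous_sin.comp_continuousOn (c₂.add c₁)))
  have hd : ∀ s ∈ Ioo 0 B, HasDerivAt (fun s => θ₂ s - θ₁ s)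
      (K s * (θ₂ s - θ₁ s) + (l₂ - l₁) * sin (θ₁ s) ^ 2) s := by
    intro s hs
    refine ((h₂.hasDerivAt s hs).sub (h₁.hasDerivAt s hs)).congr_deriv ?_
    have e := sin_sq_sub_sin_sq (θ₂ s) (θ₁ s)
    have e1 := Real.sin_sq_add_cos_sq (θ₁ s)
    have e2 := Real.sin_sq_add_cos_sq (θ₂ s)
    simp only [hK]
    linear_combination (l₂ - 1 - V s) * e + e2 - e1
  obtain ⟨M, hM0, hM⟩ := exists_primitive hKc ⟨hs₁.trans hsb, hb⟩
  have hp₁ : ∀ s ∈ Ioc 0 s₁, θ₁ s ≤ Real.pi / 2 := fun s hs => h₁.le_pi_div_two hs₁B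
    (fun t ht => by have := hV₁ t ht; linarith) hs
  have hp₂ : ∀ s ∈ Ioc 0 s₁, θ₂ s ≤ Real.pi / 2 := fun s hs => h₂.le_pi_div_two hs₁B
    (fun t ht => by have := hV₁ t ht; linarith) hs
  -- V is unbounded near 0, but only an upper bound for K is needed. There both angles lie in (0,
  -- π/2], so the trigonometric factors are nonnegative while l₂ - 1 - V is negative.
  have hKneg : ∀ s ∈ Ioc 0 s₁, K s ≤ 0 := by
    intro s hs
    have hsB : s ∈ Ioo 0 B := ⟨hs.1, hs.2.trans_lt hs₁B⟩
    have a1 := h₁.pos s hsB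
    have a2 := h₂.pos s hsB
    have a3 := hp₁ s hs
    have a4 := hp₂ s hs
    refine mul_nonpos_of_nonpos_of_nonneg (by have := hV₁ s hs; linarith)
      (mul_nonneg (sinc_nonneg_of_abs_le ?_)
        (Real.sin_nonneg_of_nonneg_of_le_pi (by linarith) (by linarith)))
    rw [abs_le]
    constructor <;> linarith [Real.pi_pos]
  have hk0 : 0 ≤ k := (abs_nonneg _).trans (hk b ⟨hsb.le, le_rfl⟩)
  have hKle : ∀ s ∈ Ioc 0 b, K s ≤ k := by
    intro s hs
    rcases le_or_gt s s₁ with h | h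
    · exact (hKneg s ⟨hs.1, h⟩).trans hk0
    · refine (le_abs_self _).trans ?_
      rw [hK, abs_mul, abs_mul]
      have b1 := hk s ⟨h.le, hs.2⟩
      have b2 := Real.abs_sinc_le_one (θ₂ s - θ₁ s)
      have b3 := Real.abs_sin_le_one (θ₂ s + θ₁ s)
      calc _ ≤ k * (1 * 1) := by gcongr
        _ = k := by ring
  have hsub : Ioo 0 b ⊆ Ioo 0 B := Ioo_subset_Ioo_right hb.le
  -- Integrating factor: M' = K and M(b) = 0, hence Y' = (l₂ - l₁) sin² θ₁ exp(-M) ≥ 0 and Y(b) =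
  -- D(b). The upper bound on K gives -M ≤ kb, which bounds Y' above and yields Y → 0 at 0.
  set Y : ℝ → ℝ := fun s => (θ₂ s - θ₁ s) * exp (-M s) with hY
  have hYd : ∀ s ∈ Ioo 0 B, HasDerivAt Y ((l₂ - l₁) * sin (θ₁ s) ^ 2 * exp (-M s)) s := by
    intro s hs
    refine ((hd s hs).mul ((hM s hs).neg.exp)).congr_deriv ?_
    simp only [Pi.neg_apply]
    ring
  have hl0 : 0 < l₂ - l₁ := sub_pos.2 hl
  have hYm := monotoneOn_Ioo_of_hasDerivAt hYd fun s _ => by positivity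
  have hYs : StrictMonoOn Y (Ioo 0 s₁) := strictMonoOn_Ioo_of_hasDerivAt
    (fun s hs => hYd s ⟨hs.1, hs.2.trans hs₁B⟩) fun s hs => by
      have := Real.sin_pos_of_pos_of_lt_pi (h₁.pos s ⟨hs.1, hs.2.trans hs₁B⟩)
        ((hp₁ s (Ioo_subset_Ioc_self hs)).trans_lt (by linarith [Real.pi_pos]))
      positivity
  have hMle : ∀ s ∈ Ioo 0 b, -M s ≤ k * b := by
    intro s hs
    have hanti : MonotoneOn (fun s => k * s - M s) (Icc s b) := by
      have hsb' : Icc s b ⊆ Ioo 0 B := fun t ht => ⟨hs.1.trans_le ht.1, ht.2.trans_lt hb⟩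
      have hd' : ∀ t ∈ Icc s b, HasDerivAt (fun s => k * s - M s) (k - K t) t := fun t ht => by
        exact (((hasDerivAt_id t).const_mul k).sub (hM t (hsb' ht))).congr_deriv (by simp)
      refine monotoneOn_of_deriv_nonneg (convex_Icc s b)
        (fun x hx => (hd' x hx).continuousAt.continuousWithinAt)
        (fun x hx => (hd' x (interior_subset hx)).differentiableAt.differentiableWithinAt) ?_
      intro t ht
      have ht := interior_subset ht
      rw [(hd' t ht).deriv, sub_nonneg]
      exact hKle t ⟨hs.1.trans_le ht.1, ht.2⟩
    have := hanti ⟨le_rfl, hs.2.le⟩ ⟨hs.2.le, le_rfl⟩ hs.2.le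
    simp only [hM0] at this
    have : 0 ≤ k * s := mul_nonneg hk0 hs.1.le
    linarith
  have hY0 : Tendsto Y (𝓝[>] 0) (𝓝 0) := by
    have h0 : Tendsto (fun s => θ₂ s - θ₁ s) (𝓝[>] 0) (𝓝 0) := by
      simpa using h₂.tendsto.sub h₁.tendsto
    refine h0.zero_mul_isBoundedUnder_le ⟨exp (k * b), ?_⟩
    rw [eventually_map]
    filter_upwards [Ioo_mem_nhdsGT (hs₁.trans hsb)] with s hs
    simpa using hMle s hs
  have hbB : b ∈ Ioo 0 B := ⟨hs₁.trans hsb, hb⟩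
  have hYb : Y b = θ₂ b - θ₁ b := by simp [hY, hM0]
  constructor
  -- Strictness comes from the neighbourhood of 0 alone, where 0 < θ₁ ≤ π/2 forces sin θ₁ > 0;
  -- afterwards Y does not decrease.
  · have m1 : s₁ / 2 ∈ Ioo 0 s₁ := ⟨by linarith, by linarith⟩
    have m2 : s₁ / 3 ∈ Ioo 0 s₁ := ⟨by linarith, by linarith⟩
    have y1 := hYs m2 m1 (by linarith)
    have y2 := hYm ⟨m1.1, m1.2.trans hs₁B⟩ hbB (by linarith)
    have y3 := nonneg_of_monotoneOn_of_tendsto hYm hY0 ⟨m2.1, m2.2.trans hs₁B⟩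
    have : 0 < Y b := by linarith
    rw [hYb] at this
    linarith
  · have hZd : ∀ s ∈ Ioo 0 b, HasDerivAt (fun s => (l₂ - l₁) * (exp (k * b) * s) - Y s)
        ((l₂ - l₁) * exp (k * b) - (l₂ - l₁) * sin (θ₁ s) ^ 2 * exp (-M s)) s := fun s hs => by
      exact ((((hasDerivAt_id s).const_mul (exp (k * b))).const_mul (l₂ - l₁)).sub
        (hYd s (hsub hs))).congr_deriv (by simp)
    have hZm := monotoneOn_Ioo_of_hasDerivAt hZd fun s hs => by
      have e1 := Real.exp_le_exp.2 (hMle s hs)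
      have e2 := Real.sin_sq_le_one (θ₁ s)
      rw [sub_nonneg, mul_assoc]
      refine mul_le_mul_of_nonneg_left ?_ hl0.le
      calc _ ≤ 1 * exp (k * b) := by gcongr
        _ = _ := one_mul _
    have hZ0 : Tendsto (fun s => (l₂ - l₁) * (exp (k * b) * s) - Y s) (𝓝[>] 0) (𝓝 0) := by
      have h2 : Tendsto (fun t : ℝ => (l₂ - l₁) * (exp (k * b) * t)) (𝓝[>] 0)
          (𝓝 ((l₂ - l₁) * (exp (k * b) * 0))) :=
        (Continuous.tendsto (by fun_prop) 0).mono_left nhdsWithin_le_nhds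
      simpa using h2.sub hY0
    have hle : ∀ᶠ s in 𝓝[<] b, 0 ≤ (l₂ - l₁) * (exp (k * b) * s) - Y s := by
      filter_upwards [Ioo_mem_nhdsLT hbB.1] with s hs
      exact nonneg_of_monotoneOn_of_tendsto hZm hZ0 hs
    have hcont : ContinuousAt (fun s => (l₂ - l₁) * (exp (k * b) * s) - Y s) b := by
      have := (hYd b hbB).continuousAt
      fun_prop
    have := ge_of_tendsto (hcont.tendsto.mono_left nhdsWithin_le_nhds) hle
    rw [hYb] at this
    linarith

/-- The Prüfer angle at a fixed point is a strictly increasing continuous function of the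
spectral parameter. -/
theorem IsPrueferAngle.strictMono_continuous {V : ℝ → ℝ} {B b : ℝ} {θ : ℝ → ℝ → ℝ}
    (hV : ContinuousOn V (Ioo 0 B)) (hV0 : Tendsto V (𝓝[>] 0) atTop)
    (h : ∀ l, IsPrueferAngle (fun s => l - V s) B (θ l)) (hb : b ∈ Ioo 0 B) :
    StrictMono (fun l => θ l b) ∧ Continuous fun l => θ l b := by
  -- The Lipschitz constant is uniform for spectral parameters in [-L, L]: one s₁ with V > L on (0,
  -- s₁] serves all of them.
  have key : ∀ L : ℝ, ∃ C, ∀ l₁ l₂, -L ≤ l₁ → l₁ < l₂ → l₂ ≤ L →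
      θ l₁ b < θ l₂ b ∧ θ l₂ b - θ l₁ b ≤ (l₂ - l₁) * C := by
    intro L
    obtain ⟨s₀, hs₀, hs₀'⟩ := mem_nhdsGT_iff_exists_Ioc_subset.1
      (hV0.eventually (eventually_gt_atTop L))
    have hs₀ : 0 < s₀ := hs₀
    set s₁ := min s₀ (b / 2) with hs₁
    have h1 : 0 < s₁ := lt_min hs₀ (half_pos hb.1)
    have h2 : s₁ < b := (min_le_right _ _).trans_lt (half_lt_self hb.1)
    obtain ⟨k, hk⟩ := isCompact_Icc.exists_bound_of_continuousOn
      (hV.mono (fun t ht => ⟨h1.trans_le ht.1, ht.2.trans_lt hb.2⟩ : Icc s₁ b ⊆ Ioo 0 B))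
    refine ⟨exp ((L + 1 + k) * b) * b, fun l₁ l₂ hl1 hl hl2 => ?_⟩
    refine IsPrueferAngle.lt_and_sub_le hV (h l₁) (h l₂) hl h1 h2 hb.2 (fun s hs => ?_)
      fun s hs => ?_
    · exact hl2.trans_lt (hs₀' ⟨hs.1, hs.2.trans (min_le_left _ _)⟩)
    · have := hk s hs
      rw [Real.norm_eq_abs, abs_le] at this
      rw [abs_le]
      constructor <;> linarith
  constructor
  · intro l₁ l₂ hl
    obtain ⟨C, hC⟩ := key (max (-l₁) l₂)
    exact (hC l₁ l₂ (by linarith [le_max_left (-l₁) l₂]) hl (le_max_right _ _)).1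
  · rw [continuous_iff_continuousAt]
    intro l
    obtain ⟨C, hC⟩ := key (|l| + 1)
    have hlip : ∀ᶠ x in 𝓝 l, dist (θ x b) (θ l b) ≤ |C| * dist x l := by
      filter_upwards [Ioo_mem_nhds (show l - 1 < l by linarith) (show l < l + 1 by linarith)]
        with x hx
      have a1 := neg_abs_le l
      have a2 := le_abs_self l
      have a3 := le_abs_self C
      rw [Real.dist_eq, Real.dist_eq]
      rcases lt_trichotomy x l with h | h | h
      · obtain ⟨h1, h2⟩ := hC x l (by linarith [hx.1]) h (by linarith)
        rw [abs_of_neg (sub_neg.2 h1), abs_of_neg (sub_neg.2 h)]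
        nlinarith [mul_nonneg (sub_nonneg.2 h.le) (sub_nonneg.2 a3)]
      · simp [h]
      · obtain ⟨h1, h2⟩ := hC l x (by linarith) h (by linarith [hx.2])
        rw [abs_of_pos (sub_pos.2 h1), abs_of_pos (sub_pos.2 h)]
        nlinarith [mul_nonneg (sub_nonneg.2 h.le) (sub_nonneg.2 a3)]
    rw [ContinuousAt, tendsto_iff_dist_tendsto_zero]
    refine squeeze_zero' (Eventually.of_forall fun _ => dist_nonneg) hlip ?_
    have : Tendsto (fun x => |C| * dist x l) (𝓝 l) (𝓝 (|C| * dist l l)) :=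
      Continuous.tendsto (by fun_prop) l
    simpa using this

/-- Polar coordinates in the phase plane for a solution with `g' / g → ∞` at `0`. -/
theorem exists_isPrueferAngle {q g G : ℝ → ℝ} {b : ℝ} (hb : 0 < b) (hq : ContinuousOn q (Ioo 0 b))
    (hg : ∀ s ∈ Ioo 0 b, HasDerivAt g (G s) s) (hG : ∀ s ∈ Ioo 0 b, HasDerivAt G (-(q s * g s)) s)
    (hne : ∀ s ∈ Ioo 0 b, g s ≠ 0 ∨ G s ≠ 0) (hpos : ∀ᶠ s in 𝓝[>] 0, 0 < g s)
    (hlim : Tendsto (fun s => G s / g s) (𝓝[>] 0) atTop) :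
    ∃ θ, IsPrueferAngle q b θ ∧ ∀ s ∈ Ioo 0 b, g s = √(g s ^ 2 + G s ^ 2) * sin (θ s) ∧
      G s = √(g s ^ 2 + G s ^ 2) * cos (θ s) := by
  have hG0 : ∀ᶠ s in 𝓝[>] 0, 0 < G s := by
    filter_upwards [hpos, hlim.eventually (eventually_gt_atTop 0)] with s h1 h2
    exact (div_pos_iff_of_pos_right h1).1 h2
  obtain ⟨s₀, hs₀, hs₀'⟩ := mem_nhdsGT_iff_exists_Ioc_subset.1
    ((hpos.and hG0).and (Ioo_mem_nhdsGT hb))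
  have hs₀ : 0 < s₀ := hs₀
  have hs₀b : s₀ ∈ Ioo 0 b := (hs₀' ⟨hs₀, le_rfl⟩).2
  have hr : ∀ s ∈ Ioo 0 b, 0 < g s ^ 2 + G s ^ 2 := fun s hs => by
    rcases hne s hs with h | h
    · have := sq_pos_of_ne_zero h; positivity
    · have := sq_pos_of_ne_zero h; positivity
  have cg : ContinuousOn g (Ioo 0 b) := fun s hs => (hg s hs).continuousAt.continuousWithinAt
  have cG : ContinuousOn G (Ioo 0 b) := fun s hs => (hG s hs).continuousAt.continuousWithinAt
  have cK : ContinuousOn (fun s => (G s ^ 2 + q s * g s ^ 2) / (g s ^ 2 + G s ^ 2)) (Ioo 0 b) :=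
    ((cG.pow 2).add (hq.mul (cg.pow 2))).div ((cg.pow 2).add (cG.pow 2)) fun s hs => (hr s hs).ne'
  obtain ⟨M, hM0, hM⟩ := exists_primitive cK hs₀b
  -- The angle is the integral of its prospective derivative, so it is defined past the zeros of G;
  -- near 0 it agrees with arctan(g/G).
  set θ : ℝ → ℝ := fun s => arctan (g s₀ / G s₀) + M s with hθ
  have hθd : ∀ s ∈ Ioo 0 b, HasDerivAt θ ((G s ^ 2 + q s * g s ^ 2) / (g s ^ 2 + G s ^ 2)) s :=
    fun s hs => (hM s hs).const_add _
  have hsmall : EqOn θ (fun s => arctan (g s / G s)) (Ioc 0 s₀) := by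
    have hd : ∀ s ∈ Ioc 0 s₀, HasDerivAt (fun s => arctan (g s / G s))
        ((G s ^ 2 + q s * g s ^ 2) / (g s ^ 2 + G s ^ 2)) s := fun s hs => by
      obtain ⟨⟨h1, h2⟩, h3⟩ := hs₀' hs
      refine (((hg s h3).div (hG s h3) h2.ne').arctan).congr_deriv ?_
      have := hr s h3
      have h4 : 0 < 1 + (g s / G s) ^ 2 := by positivity
      have h5 : 1 + (g s / G s) ^ 2 = (g s ^ 2 + G s ^ 2) / G s ^ 2 := by field_simp; ring
      simp only [Pi.div_apply]
      rw [h5]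
      field_simp
      ring
    intro s hs
    have hD : ∀ t ∈ Icc s s₀, HasDerivAt (fun t => θ t - arctan (g t / G t)) 0 t := fun t ht => by
      have ht' : t ∈ Ioc 0 s₀ := ⟨hs.1.trans_le ht.1, ht.2⟩
      exact ((hθd t (hs₀' ht').2).sub (hd t ht')).congr_deriv (sub_self _)
    have := constant_of_has_deriv_right_zero (f := fun t => θ t - arctan (g t / G t))
      (fun t ht => (hD t ht).continuousAt.continuousWithinAt)
      (fun t ht => (hD t (Ico_subset_Icc_self ht)).hasDerivWithinAt) s₀ ⟨hs.2, le_rfl⟩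
    simp only [hθ, hM0] at this ⊢
    linarith
  have hpolar : ∀ s ∈ Ioo 0 b, g s = √(g s ^ 2 + G s ^ 2) * sin (θ s) ∧
      G s = √(g s ^ 2 + G s ^ 2) * cos (θ s) := by
    have hrd : ∀ s ∈ Ioo 0 b, HasDerivAt (fun s => √(g s ^ 2 + G s ^ 2))
        ((1 - q s) * g s * G s / √(g s ^ 2 + G s ^ 2)) s := fun s hs => by
      refine ((((hg s hs).pow 2).add ((hG s hs).pow 2)).sqrt (hr s hs).ne').congr_deriv ?_
      have := Real.sqrt_pos.2 (hr s hs)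
      simp only [Pi.add_apply, Pi.pow_apply]
      field_simp
      ring
    -- C is the cosine of the difference between θ and the true phase of (G, g). It is constant and
    -- equals 1 at s₀, which forces the polar representation.
    set C : ℝ → ℝ := fun s => (G s * cos (θ s) + g s * sin (θ s)) / √(g s ^ 2 + G s ^ 2) with hC
    have hCd : ∀ s ∈ Ioo 0 b, HasDerivAt C 0 s := fun s hs => by
      have hr0 := hr s hs
      have hs0 := Real.sqrt_pos.2 hr0
      refine ((((hG s hs).mul (hθd s hs).cos).add ((hg s hs).mul (hθd s hs).sin)).div (hrd s hs)
        hs0.ne').congr_deriv ?_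
      rw [div_eq_zero_iff]
      left
      simp only [Pi.add_apply, Pi.mul_apply]
      have hsq := Real.sq_sqrt hr0.le
      set r := √(g s ^ 2 + G s ^ 2)
      rw [← hsq]
      field_simp
      rw [hsq]
      ring
    have hC1 : ∀ s ∈ Ioo 0 b, C s = 1 := by
      intro s hs
      rw [eq_of_hasDerivAt_zero hCd hs hs₀b]
      obtain ⟨⟨h1, h2⟩, h3⟩ := hs₀' ⟨hs₀, le_rfl⟩
      simp only [hC]
      rw [hsmall ⟨hs₀, le_rfl⟩]
      simp only
      have hr0 := hr s₀ h3
      have hs0 := Real.sqrt_pos.2 hr0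
      have h4 : √(1 + (g s₀ / G s₀) ^ 2) = √(g s₀ ^ 2 + G s₀ ^ 2) / G s₀ := by
        rw [show 1 + (g s₀ / G s₀) ^ 2 = (g s₀ ^ 2 + G s₀ ^ 2) / G s₀ ^ 2 by field_simp; ring,
          Real.sqrt_div hr0.le, Real.sqrt_sq h2.le]
      rw [Real.sin_arctan, Real.cos_arctan, h4, div_eq_one_iff_eq hs0.ne']
      field_simp
      rw [Real.sq_sqrt hr0.le]
      ring
    intro s hs
    have h1 := hC1 s hs
    have hs0 := Real.sqrt_pos.2 (hr s hs)
    have hsq := Real.sq_sqrt (hr s hs).le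
    simp only [hC] at h1
    rw [div_eq_one_iff_eq hs0.ne'] at h1
    have h2 := Real.sin_sq_add_cos_sq (θ s)
    set r := √(g s ^ 2 + G s ^ 2)
    have h3 : (g s - r * sin (θ s)) ^ 2 + (G s - r * cos (θ s)) ^ 2 = 0 := by
      linear_combination -hsq - 2 * r * h1 + r ^ 2 * h2
    have h4 : (g s - r * sin (θ s)) ^ 2 = 0 := by nlinarith [sq_nonneg (g s - r * sin (θ s)), sq_nonneg (G s - r * cos (θ s))]
    have h5 : (G s - r * cos (θ s)) ^ 2 = 0 := by nlinarith [sq_nonneg (g s - r * sin (θ s)), sq_nonneg (G s - r * cos (θ s))]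
    exact ⟨sub_eq_zero.1 (pow_eq_zero_iff two_ne_zero |>.1 h4),
      sub_eq_zero.1 (pow_eq_zero_iff two_ne_zero |>.1 h5)⟩
  have hθd' : ∀ s ∈ Ioo 0 b, HasDerivAt θ (cos (θ s) ^ 2 + q s * sin (θ s) ^ 2) s := fun s hs => by
    refine (hθd s hs).congr_deriv ?_
    have hr0 := hr s hs
    obtain ⟨h1, h2⟩ := hpolar s hs
    have hsq := Real.sq_sqrt hr0.le
    rw [div_eq_iff hr0.ne']
    set r := √(g s ^ 2 + G s ^ 2)
    rw [← hsq, h1, h2]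
    ring
  have hθpos : ∀ s ∈ Ioc 0 s₀, 0 < θ s := fun s hs => by
    obtain ⟨⟨h1, h2⟩, h3⟩ := hs₀' hs
    rw [hsmall hs, Real.arctan_pos]
    exact div_pos h1 h2
  refine ⟨θ, ⟨hθd', ?_, ?_⟩, hpolar⟩
  · have h1 : Tendsto (fun s => arctan ((G s / g s)⁻¹)) (𝓝[>] 0) (𝓝 (arctan 0)) :=
      (Real.continuous_arctan.tendsto 0).comp hlim.inv_tendsto_atTop
    rw [Real.arctan_zero] at h1
    refine h1.congr' ?_
    filter_upwards [Ioc_mem_nhdsGT hs₀] with s hs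
    rw [hsmall hs, inv_div]
  -- Wherever θ = 0 its derivative is 1, so θ can never pass below 0.
  · have hnn : ∀ s ∈ Ioo 0 b, 0 ≤ θ s := by
      intro s hs
      rcases le_or_gt s s₀ with h | h
      · exact (hθpos s ⟨hs.1, h⟩).le
      have hsub : Icc s₀ s ⊆ Ioo 0 b := fun x hx => ⟨hs₀.trans_le hx.1, hx.2.trans_lt hs.2⟩
      have := image_le_of_deriv_right_lt_deriv_boundary' (f := fun s => -θ s) (a := s₀) (b := s)
        (f' := fun x => -(cos (θ x) ^ 2 + q x * sin (θ x) ^ 2))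
        (B := fun _ => 0) (B' := fun _ => 0)
        (fun x hx => (hθd' x (hsub hx)).neg.continuousAt.continuousWithinAt)
        (fun x hx => (hθd' x (hsub (Ico_subset_Icc_self hx))).neg.hasDerivWithinAt)
        (by have := hθpos s₀ ⟨hs₀, le_rfl⟩; linarith) continuousOn_const
        (fun x _ => hasDerivWithinAt_const _ _ _)
        (fun x hx hx2 => by
          have : θ x = 0 := by linarith
          simp [this]) (show s ∈ Icc s₀ s from ⟨h.le, le_rfl⟩)
      simpa using this
    intro s hs
    -- A zero would be an interior minimum of θ, contradicting θ' = 1 there.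
    refine lt_of_le_of_ne (hnn s hs) fun h0 => ?_
    have hmin : IsLocalMin θ s := by
      filter_upwards [Ioo_mem_nhds hs.1 hs.2] with t ht
      rw [← h0]
      exact hnn t ht
    have := hmin.hasDerivAt_eq_zero (hθd' s hs)
    rw [← h0] at this
    simp at this

/-! ### Power series -/

/-- The sum of the power series with coefficients `a`. -/
def powerSum (a : ℕ → ℝ) (x : ℝ) : ℝ := ∑' n, a n * x ^ n

/-- The coefficients of the derived power series. -/
def derivCoeff (a : ℕ → ℝ) (n : ℕ) : ℝ := (n + 1) * a (n + 1)

/-- The coefficients grow at most like `r ^ n` for every `r > ρ`. -/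
def GrowthAtMost (ρ : ℝ) (a : ℕ → ℝ) : Prop := ∀ r > ρ, ∃ C, ∀ n, |a n| ≤ C * r ^ n

/-- The factor n + 1 is absorbed by the gap between r and the midpoint of ρ and r. This is why
growth is required for each r > ρ and not for ρ itself. -/
theorem GrowthAtMost.derivCoeff {ρ : ℝ} (hρ : 0 < ρ) {a : ℕ → ℝ} (ha : GrowthAtMost ρ a) :
    GrowthAtMost ρ (derivCoeff a) := by
  intro r hr
  set r' := (ρ + r) / 2 with hr'
  have h1 : ρ < r' := by rw [hr']; linarith
  have h2 : r' < r := by rw [hr']; linarith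
  have h0 : 0 < r' := hρ.trans h1
  have hr0 : 0 < r := h0.trans h2
  obtain ⟨C, hC⟩ := ha r' h1
  have hq1 : r' / r < 1 := (div_lt_one hr0).2 h2
  have hq0 : 0 ≤ r' / r := by positivity
  obtain ⟨D, hD⟩ := (tendsto_self_mul_const_pow_of_lt_one hq0 hq1).bddAbove_range
  refine ⟨r * |C| * D, fun n => ?_⟩
  have hD' : ((n + 1 : ℕ) : ℝ) * (r' / r) ^ (n + 1) ≤ D := hD ⟨n + 1, rfl⟩
  have hp : (r' / r) ^ (n + 1) * r ^ (n + 1) = r' ^ (n + 1) := by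
    rw [← mul_pow, div_mul_cancel₀ _ hr0.ne']
  calc |SturmLiouville.derivCoeff a n| = (n + 1) * |a (n + 1)| := by
        rw [SturmLiouville.derivCoeff, abs_mul, abs_of_nonneg (by positivity)]
    _ ≤ (n + 1) * (|C| * r' ^ (n + 1)) := by
        have := (hC (n + 1)).trans
          (mul_le_mul_of_nonneg_right (le_abs_self C) (pow_nonneg h0.le _))
        gcongr
    _ = |C| * (((n + 1 : ℕ) : ℝ) * (r' / r) ^ (n + 1)) * r ^ (n + 1) := by
        rw [← hp]; push_cast; ring
    _ ≤ |C| * D * r ^ (n + 1) := by gcongr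
    _ = r * |C| * D * r ^ n := by ring

theorem GrowthAtMost.summable_abs {ρ R : ℝ} (hρ : 0 < ρ) {a : ℕ → ℝ} (ha : GrowthAtMost ρ a)
    (hR : 0 ≤ R) (hRρ : R < 1 / ρ) : Summable fun n => |a n| * R ^ n := by
  have h1 : R * ρ < 1 := by rwa [lt_div_iff₀ hρ] at hRρ
  obtain ⟨r, hr, hr1⟩ : ∃ r > ρ, R * r < 1 := by
    have hc : ContinuousAt (fun r => R * r) ρ := by fun_prop
    have := (hc.eventually_lt_const h1).filter_mono (nhdsWithin_le_nhds (s := Ioi ρ))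
    obtain ⟨r, h, h'⟩ := (this.and self_mem_nhdsWithin).exists
    exact ⟨r, h', h⟩
  obtain ⟨C, hC⟩ := ha r hr
  have hr0 : 0 < r := hρ.trans hr
  refine Summable.of_nonneg_of_le (fun n => by positivity) (fun n => ?_)
    ((summable_geometric_of_lt_one (by positivity : 0 ≤ R * r) hr1).mul_left C)
  rw [mul_pow]
  calc |a n| * R ^ n ≤ C * r ^ n * R ^ n := by gcongr; exact hC n
    _ = _ := by ring

theorem GrowthAtMost.hasSum {ρ x : ℝ} (hρ : 0 < ρ) {a : ℕ → ℝ} (ha : GrowthAtMost ρ a)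
    (hx : |x| < 1 / ρ) : HasSum (fun n => a n * x ^ n) (powerSum a x) := by
  refine Summable.hasSum (Summable.of_norm ?_)
  simpa [abs_mul, abs_pow] using ha.summable_abs hρ (abs_nonneg x) hx

theorem GrowthAtMost.hasDerivAt {ρ x : ℝ} (hρ : 0 < ρ) {a : ℕ → ℝ} (ha : GrowthAtMost ρ a)
    (hx : |x| < 1 / ρ) :
    HasDerivAt (powerSum a) (powerSum (SturmLiouville.derivCoeff a) x) x := by
  obtain ⟨R, hxR, hR⟩ := exists_between hx
  have hR0 : 0 < R := (abs_nonneg x).trans_lt hxR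
  have hs := (ha.derivCoeff hρ).summable_abs hρ hR0.le hR
  have hs' : Summable fun n : ℕ => |a n| * (n * R ^ (n - 1)) := by
    rw [← summable_nat_add_iff 1]
    refine hs.congr fun n => ?_
    simp only [SturmLiouville.derivCoeff, Nat.add_sub_cancel]
    rw [abs_mul, abs_of_nonneg (by positivity : (0 : ℝ) ≤ n + 1)]
    push_cast
    ring
  have h := hasDerivAt_tsum_of_isPreconnected (g := fun n x => a n * x ^ n)
    (g' := fun n x => a n * (n * x ^ (n - 1))) (t := Ioo (-R) R) (y₀ := 0) (y := x) hs' isOpen_Ioo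
    isPreconnected_Ioo (fun n y _ => (hasDerivAt_pow n y).const_mul (a n))
    (fun n y hy => by
      have : |y| ≤ R := (abs_lt.2 hy).le
      simp only [Real.norm_eq_abs, abs_mul, abs_pow, Nat.abs_cast]
      gcongr)
    ⟨by linarith, hR0⟩ (ha.hasSum hρ (by simpa using hρ)).summable (abs_lt.1 hxR)
  refine h.congr_deriv ?_
  have hsx : Summable fun n : ℕ => a n * (n * x ^ (n - 1)) := by
    refine Summable.of_norm_bounded hs' fun n => ?_
    simp only [Real.norm_eq_abs, abs_mul, abs_pow, Nat.abs_cast]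
    gcongr
  rw [hsx.tsum_eq_zero_add]
  simp only [Nat.cast_zero, zero_mul, mul_zero, zero_add, powerSum, SturmLiouville.derivCoeff]
  refine tsum_congr fun n => ?_
  rw [Nat.add_sub_cancel]
  push_cast
  ring

theorem GrowthAtMost.contDiffOn {ρ : ℝ} (hρ : 0 < ρ) {a : ℕ → ℝ} (ha : GrowthAtMost ρ a) :
    ContDiffOn ℝ ∞ (powerSum a) (Ioo (-(1 / ρ)) (1 / ρ)) := by
  rw [contDiffOn_infty]
  intro n
  induction n generalizing a with
  | zero =>
    exact contDiffOn_zero.2 fun x hx => (ha.hasDerivAt hρ (abs_lt.2 hx)).continuousAt.continuousWithinAt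
  | succ n ih =>
    have := (contDiffOn_succ_iff_deriv_of_isOpen (𝕜 := ℝ) (n := n) (f := powerSum a)
      (isOpen_Ioo (a := -(1 / ρ)) (b := 1 / ρ))).2
      ⟨fun x hx => (ha.hasDerivAt hρ (abs_lt.2 hx)).differentiableAt.differentiableWithinAt,
        by simp,
        (ih (ha.derivCoeff hρ)).congr fun x hx => (ha.hasDerivAt hρ (abs_lt.2 hx)).deriv⟩
    exact_mod_cast this

theorem powerSum_zero (a : ℕ → ℝ) : powerSum a 0 = a 0 := by
  rw [powerSum, tsum_eq_single 0]
  · simp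
  · intro n hn
    simp [hn]

theorem hasSum_mul_shift {a b : ℕ → ℝ} {x s : ℝ} (h : HasSum (fun n => a n * x ^ n) s)
    (h0 : b 0 = 0) (hb : ∀ n, b (n + 1) = a n) : HasSum (fun n => b n * x ^ n) (x * s) := by
  rw [← hasSum_nat_add_iff' 1]
  simp only [Finset.range_one, Finset.sum_singleton, h0, zero_mul, sub_zero]
  refine (h.mul_left x).congr_fun fun n => ?_
  rw [hb]
  ring

/-! ### Regular singular points -/

/-- The sequence determined by a two-term linear recurrence. -/
def twoTermRec (A B : ℕ → ℝ) (x y : ℝ) : ℕ → ℝ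
  | 0 => x
  | 1 => y
  | n + 2 => A n * twoTermRec A B x y (n + 1) + B n * twoTermRec A B x y n

/-- From index N on, the recurrence propagates a bound C ρⁿ. The constant C is the sum of the first
N + 2 ratios, so that it covers the initial terms. -/
theorem growthAtMost_of_recurrence {a A B : ℕ → ℝ} {ρ : ℝ} (hρ : 0 < ρ) {N : ℕ}
    (hab : ∀ n, a (n + 2) = A n * a (n + 1) + B n * a n)
    (hAB : ∀ n ≥ N, |A n| * ρ + |B n| ≤ ρ ^ 2) : GrowthAtMost ρ a := by
  set C := ∑ k ∈ Finset.range (N + 2), |a k| / ρ ^ k with hC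
  have hC0 : 0 ≤ C := Finset.sum_nonneg fun k _ => by positivity
  have hsmall : ∀ n < N + 2, |a n| ≤ C * ρ ^ n := fun n hn => by
    rw [← div_le_iff₀ (by positivity)]
    exact Finset.single_le_sum (f := fun k => |a k| / ρ ^ k) (fun k _ => by positivity)
      (Finset.mem_range.2 hn)
  have hall : ∀ n, |a n| ≤ C * ρ ^ n := by
    intro n
    induction n using Nat.strong_induction_on with
    | _ n ih =>
      rcases lt_or_ge n (N + 2) with h | h
      · exact hsmall n h
      · obtain ⟨m, rfl⟩ := Nat.exists_eq_add_of_le' (show 2 ≤ n by omega)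
        have i1 := ih (m + 1) (by omega)
        have i2 := ih m (by omega)
        have i3 := hAB m (by omega)
        rw [hab]
        calc |A m * a (m + 1) + B m * a m| ≤ |A m| * |a (m + 1)| + |B m| * |a m| := by
              rw [← abs_mul, ← abs_mul]; exact abs_add_le _ _
          _ ≤ |A m| * (C * ρ ^ (m + 1)) + |B m| * (C * ρ ^ m) := by gcongr
          _ = C * ρ ^ m * (|A m| * ρ + |B m|) := by ring
          _ ≤ C * ρ ^ m * ρ ^ 2 := by gcongr
          _ = C * ρ ^ (m + 2) := by ring
  intro r hr
  refine ⟨C, fun n => (hall n).trans ?_⟩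
  have := hr.le
  gcongr

/-- Smooth solutions of a second order equation at a regular singular point. -/
theorem exists_smooth_solution {α₀ α₁ α₂ γ₀ γ₁ l ρ c₀ c₁ : ℝ} (hρ : 0 < ρ) (hα : 0 < α₀)
    (hγ : 0 ≤ γ₀) (hc : γ₀ * c₁ + l * c₀ = 0) (hlt : |α₁| * ρ + |α₂| < α₀ * ρ ^ 2) :
    ∃ f f' f'' : ℝ → ℝ, ContDiffOn ℝ ∞ f (Ioo (-(1 / ρ)) (1 / ρ)) ∧ f 0 = c₀ ∧ f' 0 = c₁ ∧
      ∀ x ∈ Ioo (-(1 / ρ)) (1 / ρ), HasDerivAt f (f' x) x ∧ HasDerivAt f' (f'' x) x ∧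
        x * (α₀ + α₁ * x) * f'' x + (γ₀ + γ₁ * x) * f' x +
          α₂ * x ^ 2 * (x * f'' x + 2 * f' x) + l * f x = 0 := by
  set d : ℕ → ℝ := fun n => (n + 2) * (α₀ * (n + 1) + γ₀) with hd
  have hd0 : ∀ n, 0 < d n := fun n => by simp only [hd]; positivity
  set A : ℕ → ℝ := fun n => -(α₁ * ((n + 1) * n) + γ₁ * (n + 1) + l) / d n with hA
  set B : ℕ → ℝ := fun n => -(α₂ * ((n + 1) * n)) / d n with hB
  set a := twoTermRec A B c₀ c₁ with ha
  have hrec : ∀ n, a (n + 2) = A n * a (n + 1) + B n * a n := fun n => by rw [ha, twoTermRec]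
  have hgrow : GrowthAtMost ρ a := by
    -- For large n, A n and B n approach -α₁/α₀ and -α₂/α₀. The strict inequality `hlt` leaves room
    -- for the lower-order terms in γ₁ and l, and N is chosen to make them fit.
    obtain ⟨N, hN⟩ := exists_nat_gt ((|γ₁| + |l|) * ρ / (α₀ * ρ ^ 2 - (|α₁| * ρ + |α₂|)))
    refine growthAtMost_of_recurrence hρ (N := N) hrec fun n hn => ?_
    have hdn := hd0 n
    simp only [hA, hB]
    rw [abs_div, abs_div, abs_neg, abs_neg, abs_of_pos hdn, div_mul_eq_mul_div, ← add_div,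
      div_le_iff₀ hdn]
    rw [div_lt_iff₀ (sub_pos.2 hlt)] at hN
    have hn' : (N : ℝ) ≤ n := by exact_mod_cast hn
    have hn0 : (0 : ℝ) ≤ n := by positivity
    have e1 : |α₁ * ((n + 1) * n) + γ₁ * (n + 1) + l| ≤
        |α₁| * ((n + 1) * (n + 1)) + (|γ₁| + |l|) * (n + 1) := by
      calc _ ≤ |α₁ * ((n + 1) * n)| + |γ₁ * (n + 1)| + |l| := abs_add_three _ _ _
        _ = |α₁| * ((n + 1) * n) + |γ₁| * (n + 1) + |l| * 1 := by
            rw [abs_mul α₁, abs_mul γ₁, abs_of_nonneg (by positivity : (0 : ℝ) ≤ (n + 1) * n),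
              abs_of_nonneg (by positivity : (0 : ℝ) ≤ n + 1), mul_one]
        _ ≤ |α₁| * ((n + 1) * (n + 1)) + |γ₁| * (n + 1) + |l| * (n + 1) := by gcongr <;> linarith
        _ = _ := by ring
    have e2 : |α₂ * ((n + 1) * n)| ≤ |α₂| * ((n + 1) * (n + 1)) := by
      rw [abs_mul α₂, abs_of_nonneg (by positivity : (0 : ℝ) ≤ (n + 1) * n)]
      gcongr
      linarith
    have e3 : α₀ * ((n + 1) * (n + 1)) ≤ d n := by
      simp only [hd]
      nlinarith [mul_nonneg hγ hn0, mul_pos hα (by positivity : (0 : ℝ) < n + 1)]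
    have e4 : (|γ₁| + |l|) * ρ ≤ (n + 1) * (α₀ * ρ ^ 2 - (|α₁| * ρ + |α₂|)) := by
      refine hN.le.trans (mul_le_mul_of_nonneg_right (by linarith) (sub_pos.2 hlt).le)
    calc _ ≤ (|α₁| * ((n + 1) * (n + 1)) + (|γ₁| + |l|) * (n + 1)) * ρ +
          |α₂| * ((n + 1) * (n + 1)) := by gcongr
      _ = (n + 1) * ((|γ₁| + |l|) * ρ) + (|α₁| * ρ + |α₂|) * ((n + 1) * (n + 1)) := by ring
      _ ≤ (n + 1) * ((n + 1) * (α₀ * ρ ^ 2 - (|α₁| * ρ + |α₂|))) +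
          (|α₁| * ρ + |α₂|) * ((n + 1) * (n + 1)) := by gcongr
      _ = ρ ^ 2 * (α₀ * ((n + 1) * (n + 1))) := by ring
      _ ≤ ρ ^ 2 * d n := by gcongr
  have hgrow' := hgrow.derivCoeff hρ
  have hgrow'' := hgrow'.derivCoeff hρ
  refine ⟨powerSum a, powerSum (derivCoeff a), powerSum (derivCoeff (derivCoeff a)),
    hgrow.contDiffOn hρ, by rw [powerSum_zero]; rfl, ?_, fun x hx => ?_⟩
  · rw [powerSum_zero]
    simp [derivCoeff, ha, twoTermRec]
  have hx' := abs_lt.2 hx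
  refine ⟨hgrow.hasDerivAt hρ hx', hgrow'.hasDerivAt hρ hx', ?_⟩
  have s0 := hgrow.hasSum hρ hx'
  have s1 := hgrow'.hasSum hρ hx'
  have s2 := hgrow''.hasSum hρ hx'
  set F0 := powerSum a x
  set F1 := powerSum (derivCoeff a) x
  set F2 := powerSum (derivCoeff (derivCoeff a)) x
  have t1 : HasSum (fun n : ℕ => (n * a n) * x ^ n) (x * F1) :=
    hasSum_mul_shift s1 (by simp) fun n => by simp [derivCoeff]
  have t2 : HasSum (fun n : ℕ => (n * ((n + 1) * a (n + 1))) * x ^ n) (x * F2) :=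
    hasSum_mul_shift s2 (by simp) fun n => by simp [derivCoeff]
  have t3 : HasSum (fun n : ℕ => (n * (n - 1) * a n) * x ^ n) (x * (x * F2)) :=
    hasSum_mul_shift t2 (by simp) fun n => by push_cast; ring
  have t4 : HasSum (fun n : ℕ => ((n + 1) * (n + 2) * a (n + 1)) * x ^ n) (x * F2 + 2 * F1) := by
    refine (t2.add (s1.mul_left 2)).congr_fun fun n => ?_
    simp only [derivCoeff]
    ring
  have t5 : HasSum (fun n : ℕ => (n * (n + 1) * a n) * x ^ n) (x * (x * F2 + 2 * F1)) :=
    hasSum_mul_shift t4 (by simp) fun n => by push_cast; ring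
  have t6 : HasSum (fun n : ℕ => (n * (n - 1) * a (n - 1)) * x ^ n)
      (x * (x * (x * F2 + 2 * F1))) :=
    hasSum_mul_shift t5 (by simp) fun n => by
      rw [Nat.add_sub_cancel]; push_cast; ring
  have tot := ((((t2.mul_left α₀).add (t3.mul_left α₁)).add ((s1.mul_left γ₀).add
    (t1.mul_left γ₁))).add (t6.mul_left α₂)).add (s0.mul_left l)
  have hz : HasSum (fun _ : ℕ => (0 : ℝ)) (α₀ * (x * F2) + α₁ * (x * (x * F2)) +
      (γ₀ * F1 + γ₁ * (x * F1)) + α₂ * (x * (x * (x * F2 + 2 * F1))) + l * F0) := by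
    refine tot.congr_fun fun n => ?_
    rcases n with _ | n
    · simp only [derivCoeff, ha, twoTermRec]
      push_cast
      linear_combination -hc
    · have hdn := (hd0 n).ne'
      have hr : d n * a (n + 2) = -(α₁ * ((n + 1) * n) + γ₁ * (n + 1) + l) * a (n + 1) +
          -(α₂ * ((n + 1) * n)) * a n := by
        rw [hrec]
        simp only [hA, hB]
        field_simp
      simp only [hd] at hr
      simp only [derivCoeff, Nat.add_sub_cancel]
      push_cast
      linear_combination (-x ^ (n + 1)) * hr
  have := hz.unique hasSum_zero
  linear_combination this

/-! ### The Liouville transformation in the original variable -/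

/-- The derivative `φ'` of the inverse Liouville variable, as a function of `x`. -/
def speed (x : ℝ) : ℝ := √(x * (1 - x ^ 2))

/-- The amplitude `(w p)^(1/4)`. -/
def amp (ε x : ℝ) : ℝ := √(p ε x / speed x)

/-- The logarithmic derivative of the amplitude with respect to the Liouville variable. -/
def ampLog (ε x : ℝ) : ℝ := -(1 + 4 * (1 / ε) * x + x ^ 2) / (4 * speed x)

/-- Sixteen times `x (1 - x²)` times the Liouville potential. -/
def potNum (ε x : ℝ) : ℝ :=
  -4 * (x * (1 - x ^ 2)) * (4 * (1 / ε) + 2 * x) +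
    2 * (1 + 4 * (1 / ε) * x + x ^ 2) * (1 - 3 * x ^ 2) + (1 + 4 * (1 / ε) * x + x ^ 2) ^ 2

/-- The Liouville potential as a function of `x`. -/
def pot (ε x : ℝ) : ℝ := potNum ε x / (16 * (x * (1 - x ^ 2)))

theorem mul_one_sub_sq_pos {x : ℝ} (hx : x ∈ Ioo (0 : ℝ) 1) : 0 < x * (1 - x ^ 2) := by
  have := hx.1
  have : 0 < 1 - x ^ 2 := by nlinarith [hx.1, hx.2]
  positivity

theorem speed_pos {x : ℝ} (hx : x ∈ Ioo (0 : ℝ) 1) : 0 < speed x :=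
  Real.sqrt_pos.2 (mul_one_sub_sq_pos hx)

theorem speed_sq {x : ℝ} (hx : x ∈ Ioo (0 : ℝ) 1) : speed x ^ 2 = x * (1 - x ^ 2) :=
  Real.sq_sqrt (mul_one_sub_sq_pos hx).le

theorem continuous_speed : Continuous speed := by
  unfold speed
  fun_prop

theorem p_pos (ε : ℝ) {x : ℝ} (hx : x ∈ Ioo (0 : ℝ) 1) : 0 < p ε x := by
  rw [p_eq ε hx]
  exact mul_pos (w_pos ε hx) (mul_one_sub_sq_pos hx)

theorem amp_pos (ε : ℝ) {x : ℝ} (hx : x ∈ Ioo (0 : ℝ) 1) : 0 < amp ε x :=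
  Real.sqrt_pos.2 (div_pos (p_pos ε hx) (speed_pos hx))

theorem amp_sq (ε : ℝ) {x : ℝ} (hx : x ∈ Ioo (0 : ℝ) 1) : amp ε x ^ 2 = p ε x / speed x :=
  Real.sq_sqrt (div_pos (p_pos ε hx) (speed_pos hx)).le

theorem hasDerivAt_speed {x : ℝ} (hx : x ∈ Ioo (0 : ℝ) 1) :
    HasDerivAt speed ((1 - 3 * x ^ 2) / (2 * speed x)) x := by
  have h : HasDerivAt (fun x : ℝ => x * (1 - x ^ 2)) (1 - 3 * x ^ 2) x := by
    refine ((hasDerivAt_id x).mul ((hasDerivAt_pow 2 x).const_sub 1)).congr_deriv ?_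
    simp only [id]
    push_cast
    ring
  exact h.sqrt (mul_one_sub_sq_pos hx).ne'

theorem hasDerivAt_amp (ε : ℝ) {x : ℝ} (hx : x ∈ Ioo (0 : ℝ) 1) :
    HasDerivAt (amp ε) (ampLog ε x * amp ε x / speed x) x := by
  have hs := speed_pos hx
  have hp := p_pos ε hx
  have hP := mul_one_sub_sq_pos hx
  have hM := amp_pos ε hx
  refine (((hasDerivAt_p ε hx).div (hasDerivAt_speed hx) hs.ne').sqrt
    (div_pos hp hs).ne').congr_deriv ?_
  have hM2 := amp_sq ε hx
  have hs2 := speed_sq hx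
  have hw := w_pos ε hx
  change _ / (2 * amp ε x) = _
  unfold ampLog
  rw [p_eq ε hx] at hM2 ⊢
  set M := amp ε x
  set σ := speed x
  rw [← hs2] at hM2 ⊢
  have hM2' : M ^ 2 = w ε x * σ := by rw [hM2]; field_simp
  field_simp
  rw [hM2']
  ring

/-- With M = `amp` and a dot for the derivative in the Liouville variable, this is the Riccati form
of M̈ = `pot` · M. -/
theorem hasDerivAt_ampLog (ε : ℝ) {x : ℝ} (hx : x ∈ Ioo (0 : ℝ) 1) :
    HasDerivAt (ampLog ε) ((pot ε x - ampLog ε x ^ 2) / speed x) x := by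
  have hs := speed_pos hx
  have hP := mul_one_sub_sq_pos hx
  have hN : HasDerivAt (fun x : ℝ => -(1 + 4 * (1 / ε) * x + x ^ 2)) (-(4 * (1 / ε) + 2 * x)) x := by
    refine ((((hasDerivAt_id x).const_mul (4 * (1 / ε))).const_add 1).add
      (hasDerivAt_pow 2 x)).neg.congr_deriv ?_
    simp
  refine (hN.div ((hasDerivAt_speed hx).const_mul 4) (by positivity)).congr_deriv ?_
  have hs2 := speed_sq hx
  unfold pot potNum ampLog
  rw [← hs2]
  set σ := speed x
  generalize 1 / ε = a
  field_simp
  ring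

/-- The quotient w/p equals 1/(x(1 - x²)), so ψ does not depend on ε on [0,1]; ε enters only through
the amplitude and the potential. -/
theorem sqrt_w_div_p (ε : ℝ) {x : ℝ} (hx : x ∈ Ioo (0 : ℝ) 1) :
    √(w ε x / p ε x) = (speed x)⁻¹ := by
  have hw := w_pos ε hx
  have hP := mul_one_sub_sq_pos hx
  rw [p_eq ε hx, speed, ← Real.sqrt_inv]
  congr 1
  field_simp

/-- The integrand defining `β`. -/
theorem rpow_integrand_eq {y : ℝ} (hy : y ∈ Ioo (0 : ℝ) 1) :
    y ^ (-1 / 2 : ℝ) * (1 - y) ^ (-1 / 2 : ℝ) * (1 + y) ^ (-1 / 2 : ℝ) = (speed y)⁻¹ := by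
  have h1 : 0 < 1 - y := by linarith [hy.2]
  have h2 : 0 < 1 + y := by linarith [hy.1]
  rw [← Real.mul_rpow hy.1.le h1.le, ← Real.mul_rpow (mul_pos hy.1 h1).le h2.le, neg_div,
    Real.rpow_neg (by have := hy.1; positivity), ← Real.sqrt_eq_rpow, speed]
  congr 2
  ring

theorem intervalIntegrable_speed_inv :
    IntervalIntegrable (fun y => (speed y)⁻¹) volume 0 1 := by
  have h : IntervalIntegrable
      (fun y : ℝ => y ^ (-1 / 2 : ℝ) * (1 - y) ^ (-1 / 2 : ℝ) * (1 + y) ^ (-1 / 2 : ℝ)) volume 0 1 := by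
    have hr : (-1 : ℝ) < -1 / 2 := by norm_num
    have c2 : ∀ s : Set ℝ, s ⊆ Icc 0 1 → ContinuousOn (fun y : ℝ => (1 + y) ^ (-1 / 2 : ℝ)) s :=
      fun s hs => ContinuousOn.rpow_const (by fun_prop) fun x hx => Or.inl (by
        have := (hs hx).1; positivity)
    -- Splitting at 1/2 leaves a single singular factor on each half.
    refine IntervalIntegrable.trans (b := 1 / 2) ?_ ?_
    · refine ((intervalIntegral.intervalIntegrable_rpow' hr).mul_continuousOn ?_).mul_continuousOn
        (c2 _ ?_)
      · refine ContinuousOn.rpow_const (by fun_prop) fun x hx => Or.inl ?_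
        rw [uIcc_of_le (by norm_num)] at hx
        linarith [hx.2]
      · rw [uIcc_of_le (by norm_num)]
        exact Icc_subset_Icc_right (by norm_num)
    · have h1 : IntervalIntegrable (fun y : ℝ => (1 - y) ^ (-1 / 2 : ℝ)) volume (1 / 2) 1 := by
        have := (intervalIntegral.intervalIntegrable_rpow' (a := 1 / 2) (b := 0) hr).comp_sub_left 1
        norm_num at this ⊢
        exact this
      refine IntervalIntegrable.mul_continuousOn ?_ (c2 _ ?_)
      · refine h1.continuousOn_mul ?_
        refine ContinuousOn.rpow_const (by fun_prop) fun x hx => Or.inl ?_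
        rw [uIcc_of_le (by norm_num)] at hx
        linarith [hx.1]
      · rw [uIcc_of_le (by norm_num)]
        exact Icc_subset_Icc_left (by norm_num)
  refine h.congr_ae ?_
  rw [uIoc_of_le zero_le_one, ← restrict_Ioo_eq_restrict_Ioc]
  filter_upwards [ae_restrict_mem measurableSet_Ioo] with y hy using rpow_integrand_eq hy

theorem ψ_eq (ε : ℝ) {t : ℝ} (ht : t ∈ Icc (0 : ℝ) 1) : ψ ε t = ∫ y in (0 : ℝ)..t, (speed y)⁻¹ := by
  unfold ψ
  refine intervalIntegral.integral_congr_ae_restrict ?_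
  rw [uIoc_of_le ht.1, ← restrict_Ioo_eq_restrict_Ioc]
  filter_upwards [ae_restrict_mem measurableSet_Ioo] with y hy
  exact sqrt_w_div_p ε ⟨hy.1, hy.2.trans_le ht.2⟩

theorem ψ_zero (ε : ℝ) : ψ ε 0 = 0 := by simp [ψ]

theorem ψ_one (ε : ℝ) : ψ ε 1 = β := by
  rw [ψ_eq ε ⟨zero_le_one, le_rfl⟩, β]
  refine intervalIntegral.integral_congr_ae_restrict ?_
  rw [uIoc_of_le zero_le_one, ← restrict_Ioo_eq_restrict_Ioc]
  filter_upwards [ae_restrict_mem measurableSet_Ioo] with y hy using (rpow_integrand_eq hy).symm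

theorem continuousOn_ψ (ε : ℝ) : ContinuousOn (ψ ε) (Icc 0 1) := by
  have h := intervalIntegral.continuousOn_primitive_interval
    (f := fun y => (speed y)⁻¹) (a := 0) (b := 1) (μ := volume)
    ((intervalIntegrable_iff').1 intervalIntegrable_speed_inv)
  rw [uIcc_of_le zero_le_one] at h
  exact h.congr fun t ht => ψ_eq ε ht

theorem hasDerivAt_ψ (ε : ℝ) {x : ℝ} (hx : x ∈ Ioo (0 : ℝ) 1) :
    HasDerivAt (ψ ε) (speed x)⁻¹ x := by
  have hc : ContinuousOn (fun y => (speed y)⁻¹) (Ioo 0 1) :=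
    continuous_speed.continuousOn.inv₀ fun y hy => (speed_pos hy).ne'
  have h : HasDerivAt (fun t => ∫ y in (0 : ℝ)..t, (speed y)⁻¹) (speed x)⁻¹ x := by
    refine intervalIntegral.integral_hasDerivAt_right
      (intervalIntegrable_speed_inv.mono_set ?_) (hc.stronglyMeasurableAtFilter isOpen_Ioo x hx)
      (hc.continuousAt (Ioo_mem_nhds hx.1 hx.2))
    rw [uIcc_of_le hx.1.le, uIcc_of_le zero_le_one]
    exact Icc_subset_Icc_right hx.2.le
  refine h.congr_of_eventuallyEq ?_
  filter_upwards [Ioo_mem_nhds hx.1 hx.2] with t ht using ψ_eq ε (Ioo_subset_Icc_self ht)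

theorem strictMonoOn_ψ (ε : ℝ) : StrictMonoOn (ψ ε) (Icc 0 1) := by
  refine strictMonoOn_of_deriv_pos (convex_Icc 0 1) (continuousOn_ψ ε) fun x hx => ?_
  rw [interior_Icc] at hx
  rw [(hasDerivAt_ψ ε hx).deriv]
  exact inv_pos.2 (speed_pos hx)

theorem ψ_mem (ε : ℝ) {x : ℝ} (hx : x ∈ Ioo (0 : ℝ) 1) : ψ ε x ∈ Ioo 0 β := by
  constructor
  · rw [← ψ_zero ε]
    exact strictMonoOn_ψ ε ⟨le_rfl, zero_le_one⟩ (Ioo_subset_Icc_self hx) hx.1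
  · rw [← ψ_one ε]
    exact strictMonoOn_ψ ε (Ioo_subset_Icc_self hx) ⟨zero_le_one, le_rfl⟩ hx.2

theorem β_pos : 0 < β := by
  have := ψ_mem 1 (x := 1 / 2) (by norm_num)
  exact this.1.trans this.2

theorem image_ψ (ε : ℝ) : ψ ε '' Icc 0 1 = Icc 0 β := by
  refine Subset.antisymm ?_ ?_
  · rintro _ ⟨x, hx, rfl⟩
    rw [← ψ_zero ε, ← ψ_one ε]
    exact ⟨(strictMonoOn_ψ ε).monotoneOn ⟨le_rfl, zero_le_one⟩ hx hx.1,
      (strictMonoOn_ψ ε).monotoneOn hx ⟨zero_le_one, le_rfl⟩ hx.2⟩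
  · have := intermediate_value_Icc zero_le_one (continuousOn_ψ ε)
    rwa [ψ_zero, ψ_one] at this

theorem φ_mem_Icc (ε : ℝ) {s : ℝ} (hs : s ∈ Icc 0 β) : φ ε s ∈ Icc (0 : ℝ) 1 :=
  Function.invFunOn_mem (by rwa [← image_ψ ε] at hs)

theorem ψ_φ (ε : ℝ) {s : ℝ} (hs : s ∈ Icc 0 β) : ψ ε (φ ε s) = s :=
  Function.invFunOn_eq (by rwa [← image_ψ ε] at hs)

theorem φ_ψ (ε : ℝ) {x : ℝ} (hx : x ∈ Icc (0 : ℝ) 1) : φ ε (ψ ε x) = x := by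
  have h : ψ ε x ∈ Icc 0 β := image_ψ ε ▸ mem_image_of_mem _ hx
  exact (strictMonoOn_ψ ε).injOn (φ_mem_Icc ε h) hx (ψ_φ ε h)

theorem φ_mem (ε : ℝ) {s : ℝ} (hs : s ∈ Ioo 0 β) : φ ε s ∈ Ioo (0 : ℝ) 1 := by
  have h := φ_mem_Icc ε (Ioo_subset_Icc_self hs)
  have e := ψ_φ ε (Ioo_subset_Icc_self hs)
  refine ⟨lt_of_le_of_ne h.1 fun h0 => ?_, lt_of_le_of_ne h.2 fun h0 => ?_⟩
  · rw [← h0, ψ_zero] at e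
    exact hs.1.ne e
  · rw [h0, ψ_one] at e
    exact hs.2.ne e.symm

theorem strictMonoOn_φ (ε : ℝ) : StrictMonoOn (φ ε) (Icc 0 β) := by
  intro s hs t ht hst
  refine (strictMonoOn_ψ ε).lt_iff_lt (φ_mem_Icc ε hs) (φ_mem_Icc ε ht) |>.1 ?_
  rwa [ψ_φ ε hs, ψ_φ ε ht]

theorem hasDerivAt_φ (ε : ℝ) {s : ℝ} (hs : s ∈ Ioo 0 β) :
    HasDerivAt (φ ε) (speed (φ ε s)) s := by
  have hx := φ_mem ε hs
  have hc : ContinuousAt (φ ε) s := by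
    refine ((strictMonoOn_φ ε).mono Ioo_subset_Icc_self).continuousAt_of_image_mem_nhds
      (Ioo_mem_nhds hs.1 hs.2) (mem_of_superset (Ioo_mem_nhds hx.1 hx.2) fun x h => ?_)
    exact ⟨ψ ε x, ψ_mem ε h, φ_ψ ε (Ioo_subset_Icc_self h)⟩
  have := HasDerivAt.of_local_left_inverse hc (hasDerivAt_ψ ε hx)
    (inv_ne_zero (speed_pos hx).ne') (by
      filter_upwards [Ioo_mem_nhds hs.1 hs.2] with t ht using ψ_φ ε (Ioo_subset_Icc_self ht))
  rwa [inv_inv] at this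

theorem tendsto_φ_zero (ε : ℝ) : Tendsto (φ ε) (𝓝[>] 0) (𝓝[>] 0) := by
  rw [(nhdsGT_basis (0 : ℝ)).tendsto_iff (nhdsGT_basis (0 : ℝ))]
  intro b hb
  set b' := min b (1 / 2) with hb'
  have h1 : b' ∈ Ioo (0 : ℝ) 1 :=
    ⟨lt_min hb (by norm_num), (min_le_right _ _).trans_lt (by norm_num)⟩
  have h2 := ψ_mem ε h1
  refine ⟨ψ ε b', h2.1, fun s hs => ?_⟩
  have hsβ : s ∈ Ioo 0 β := ⟨hs.1, hs.2.trans h2.2⟩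
  refine ⟨(φ_mem ε hsβ).1, lt_of_lt_of_le ?_ (min_le_left b (1 / 2))⟩
  rw [← hb', ← φ_ψ ε (Ioo_subset_Icc_self h1)]
  exact strictMonoOn_φ ε (Ioo_subset_Icc_self hsβ) (Ioo_subset_Icc_self h2) hs.2

theorem tendsto_φ_β (ε : ℝ) : Tendsto (fun t => φ ε (β - t)) (𝓝[>] 0) (𝓝[<] 1) := by
  rw [(nhdsGT_basis (0 : ℝ)).tendsto_iff (nhdsLT_basis (1 : ℝ))]
  intro b hb
  set b' := max b (1 / 2) with hb'
  have h1 : b' ∈ Ioo (0 : ℝ) 1 :=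
    ⟨lt_of_lt_of_le (by norm_num) (le_max_right _ _), max_lt hb (by norm_num)⟩
  have h2 := ψ_mem ε h1
  refine ⟨β - ψ ε b', sub_pos.2 h2.2, fun s hs => ?_⟩
  have hsβ : β - s ∈ Ioo 0 β := ⟨by linarith [hs.2, h2.1], by linarith [hs.1]⟩
  refine ⟨lt_of_le_of_lt (le_max_left b (1 / 2)) ?_, (φ_mem ε hsβ).2⟩
  rw [← hb', ← φ_ψ ε (Ioo_subset_Icc_self h1)]
  exact strictMonoOn_φ ε (Ioo_subset_Icc_self h2) (Ioo_subset_Icc_self hsβ) (by linarith [hs.2])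

/-! ### The potential -/

theorem c_eq (ε : ℝ) {s : ℝ} (hs : s ∈ Ioo 0 β) : c ε s = (amp ε (φ ε s))⁻¹ := by
  have hx := φ_mem ε hs
  have hw := w_pos ε hx
  have hp := p_pos ε hx
  have hσ := speed_pos hx
  have hM := amp_pos ε hx
  have h : w ε (φ ε s) * p ε (φ ε s) = amp ε (φ ε s) ^ 4 := by
    rw [show amp ε (φ ε s) ^ 4 = (amp ε (φ ε s) ^ 2) ^ 2 by ring, amp_sq ε hx, div_pow,
      speed_sq hx]
    have hP := mul_one_sub_sq_pos hx
    rw [eq_div_iff hP.ne', p_eq ε hx]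
    ring
  rw [c, h, neg_div, Real.rpow_neg (by positivity), ← Real.rpow_natCast, ← Real.rpow_mul hM.le]
  norm_num

theorem hasDerivAt_amp_φ (ε : ℝ) {s : ℝ} (hs : s ∈ Ioo 0 β) :
    HasDerivAt (fun s => amp ε (φ ε s)) (ampLog ε (φ ε s) * amp ε (φ ε s)) s := by
  have hx := φ_mem ε hs
  refine ((hasDerivAt_amp ε hx).comp s (hasDerivAt_φ ε hs)).congr_deriv ?_
  rw [div_mul_cancel₀ _ (speed_pos hx).ne']

theorem hasDerivAt_ampLog_φ (ε : ℝ) {s : ℝ} (hs : s ∈ Ioo 0 β) :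
    HasDerivAt (fun s => ampLog ε (φ ε s)) (pot ε (φ ε s) - ampLog ε (φ ε s) ^ 2) s := by
  have hx := φ_mem ε hs
  refine ((hasDerivAt_ampLog ε hx).comp s (hasDerivAt_φ ε hs)).congr_deriv ?_
  rw [div_mul_cancel₀ _ (speed_pos hx).ne']

/-- Put M = `amp` and let λ be its logarithmic derivative in s. Then c = 1/M and (p∘φ)/φ' = M², so
the two terms of V are `pot` - 2λ² and 2λ². -/
theorem V_eq (ε : ℝ) {s : ℝ} (hs : s ∈ Ioo 0 β) : V ε s = pot ε (φ ε s) := by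
  have hnhds : ∀ {t}, t ∈ Ioo 0 β → Ioo 0 β ∈ 𝓝 t := fun ht => Ioo_mem_nhds ht.1 ht.2
  have d1 : ∀ t ∈ Ioo 0 β, HasDerivAt (c ε) (-ampLog ε (φ ε t) * (amp ε (φ ε t))⁻¹) t := by
    intro t ht
    have hM := amp_pos ε (φ_mem ε ht)
    have h := (hasDerivAt_amp_φ ε ht).inv hM.ne'
    refine (h.congr_of_eventuallyEq ?_).congr_deriv (by field_simp)
    filter_upwards [hnhds ht] with r hr using c_eq ε hr
  have d2 : HasDerivAt (deriv (c ε))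
      ((2 * ampLog ε (φ ε s) ^ 2 - pot ε (φ ε s)) * (amp ε (φ ε s))⁻¹) s := by
    have hM := amp_pos ε (φ_mem ε hs)
    have h := (hasDerivAt_ampLog_φ ε hs).neg.mul ((hasDerivAt_amp_φ ε hs).inv hM.ne')
    refine (h.congr_of_eventuallyEq ?_).congr_deriv ?_
    · filter_upwards [hnhds hs] with r hr using (d1 r hr).deriv
    · simp only [Pi.neg_apply, Pi.inv_apply]
      field_simp
      ring
  have e3 : ∀ t ∈ Ioo 0 β, p ε (φ ε t) / deriv (φ ε) t = amp ε (φ ε t) ^ 2 := fun t ht => by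
    rw [(hasDerivAt_φ ε ht).deriv, amp_sq ε (φ_mem ε ht)]
  have d3 : HasDerivAt (fun t => p ε (φ ε t) / deriv (φ ε) t)
      (2 * ampLog ε (φ ε s) * amp ε (φ ε s) ^ 2) s := by
    refine (((hasDerivAt_amp_φ ε hs).pow 2).congr_of_eventuallyEq ?_).congr_deriv ?_
    · filter_upwards [hnhds hs] with r hr using e3 r hr
    · push_cast
      ring
  have hM := amp_pos ε (φ_mem ε hs)
  rw [V, d2.deriv, d3.deriv, (d1 s hs).deriv, e3 s hs, c_eq ε hs]
  field_simp
  ring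

theorem continuousOn_V (ε : ℝ) : ContinuousOn (V ε) (Ioo 0 β) := by
  have h : ContinuousOn (fun s => pot ε (φ ε s)) (Ioo 0 β) := by
    intro s hs
    have hx := φ_mem ε hs
    have hp : ContinuousAt (pot ε) (φ ε s) := by
      have h1 : ContinuousAt (potNum ε) (φ ε s) := by
        unfold potNum
        fun_prop
      exact h1.div (by fun_prop) (by have := mul_one_sub_sq_pos hx; positivity)
    exact (ContinuousAt.comp (f := φ ε) hp
      (hasDerivAt_φ ε hs).continuousAt).continuousWithinAt
  exact h.congr fun s hs => V_eq ε hs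

theorem tendsto_mul_one_sub_sq {x₀ : ℝ} (hx₀ : x₀ * (1 - x₀ ^ 2) = 0) {l : Filter ℝ}
    (hl : l ≤ 𝓝 x₀) (hl' : ∀ᶠ x in l, x ∈ Ioo (0 : ℝ) 1) :
    Tendsto (fun x : ℝ => x * (1 - x ^ 2)) l (𝓝[>] 0) := by
  refine tendsto_nhdsWithin_iff.2 ⟨?_, hl'.mono fun x hx => mul_one_sub_sq_pos hx⟩
  rw [← hx₀]
  exact (Continuous.tendsto (by fun_prop) x₀).mono_left hl

theorem tendsto_pot {ε x₀ : ℝ} (hx₀ : x₀ * (1 - x₀ ^ 2) = 0) (h : 0 < potNum ε x₀) {l : Filter ℝ}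
    (hl : l ≤ 𝓝 x₀) (hl' : ∀ᶠ x in l, x ∈ Ioo (0 : ℝ) 1) : Tendsto (pot ε) l atTop := by
  have h1 : Tendsto (potNum ε) l (𝓝 (potNum ε x₀)) := by
    refine Tendsto.mono_left ?_ hl
    refine Continuous.tendsto ?_ x₀
    unfold potNum
    fun_prop
  have h2 := (tendsto_mul_one_sub_sq hx₀ hl hl').inv_tendsto_nhdsGT_zero
  have h3 := h1.pos_mul_atTop h (h2.const_mul_atTop (show (0 : ℝ) < 1 / 16 by norm_num))
  refine h3.congr fun x => ?_
  simp only [pot, Pi.inv_apply, div_eq_mul_inv, mul_inv]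
  ring

theorem tendsto_V_zero (ε : ℝ) : Tendsto (V ε) (𝓝[>] 0) atTop := by
  have h : Tendsto (pot ε) (𝓝[>] 0) atTop :=
    tendsto_pot (by norm_num) (by norm_num [potNum]) nhdsWithin_le_nhds
      (Ioo_mem_nhdsGT one_pos)
  refine (h.comp (tendsto_φ_zero ε)).congr' ?_
  filter_upwards [Ioo_mem_nhdsGT β_pos] with s hs using (V_eq ε hs).symm

/-- This is where ε < 2 enters: `potNum` at 1 is (4/ε + 2)(4/ε - 2). -/
theorem tendsto_V_β {ε : ℝ} (hε0 : 0 < ε) (hε2 : ε < 2) :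
    Tendsto (fun t => V ε (β - t)) (𝓝[>] 0) atTop := by
  have ha : 1 / 2 < 1 / ε := one_div_lt_one_div_of_lt hε0 hε2
  have h : Tendsto (pot ε) (𝓝[<] 1) atTop :=
    tendsto_pot (by norm_num) (by norm_num [potNum] at ha ⊢; nlinarith) nhdsWithin_le_nhds
      (Ioo_mem_nhdsLT one_pos)
  refine (h.comp (tendsto_φ_β ε)).congr' ?_
  filter_upwards [Ioo_mem_nhdsGT β_pos] with s hs
  exact (V_eq ε ⟨by linarith [hs.2], by linarith [hs.1]⟩).symm

/-- V exceeds its value at β/2 near both ends, so its minimum over a compact middle interval is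
global. -/
theorem exists_isLeast_V {ε : ℝ} (hε0 : 0 < ε) (hε2 : ε < 2) :
    ∃ α, IsLeast (V ε '' Ioo 0 β) α := by
  have hm : β / 2 ∈ Ioo 0 β := ⟨half_pos β_pos, half_lt_self β_pos⟩
  obtain ⟨a, ha, ha'⟩ := mem_nhdsGT_iff_exists_Ioc_subset.1
    ((tendsto_V_zero ε).eventually (eventually_gt_atTop (V ε (β / 2))))
  obtain ⟨b, hb, hb'⟩ := mem_nhdsGT_iff_exists_Ioc_subset.1
    ((tendsto_V_β hε0 hε2).eventually (eventually_gt_atTop (V ε (β / 2))))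
  have ha : 0 < a := ha
  have hb : 0 < b := hb
  have hma : a < β / 2 ∨ β / 2 ≤ a := lt_or_ge _ _
  have ha2 : a < β / 2 := by
    rcases hma with h | h
    · exact h
    · have : V ε (β / 2) < V ε (β / 2) := ha' ⟨hm.1, h⟩
      exact absurd this (lt_irrefl _)
  have hb2 : b < β / 2 := by
    by_contra! h
    have : V ε (β / 2) < V ε (β - β / 2) := hb' ⟨hm.1, h⟩
    rw [sub_half] at this
    exact lt_irrefl _ this
  have hsub : Icc a (β - b) ⊆ Ioo 0 β := fun x hx => ⟨ha.trans_le hx.1, by linarith [hx.2]⟩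
  have hmI : β / 2 ∈ Icc a (β - b) := ⟨ha2.le, by linarith⟩
  obtain ⟨x, hx, hmin⟩ := isCompact_Icc.exists_isMinOn ⟨_, hmI⟩ ((continuousOn_V ε).mono hsub)
  refine ⟨V ε x, ⟨x, hsub hx, rfl⟩, ?_⟩
  rintro _ ⟨y, hy, rfl⟩
  rcases le_or_gt y a with h | h
  · have : V ε (β / 2) < V ε y := ha' ⟨hy.1, h⟩
    exact (hmin hmI).trans this.le
  rcases le_or_gt y (β - b) with h' | h'
  · exact hmin ⟨h.le, h'⟩
  · have : V ε (β / 2) < V ε (β - (β - y)) := hb' ⟨by linarith [hy.2], by linarith⟩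
    rw [sub_sub_cancel] at this
    exact (hmin hmI).trans this.le

theorem pot_le {ε : ℝ} (hε : 0 < ε) {x : ℝ} (hx : x ∈ Ioo (0 : ℝ) 1) :
    pot ε x ≤ (2 + 4 * (1 / ε)) * (4 + 4 * (1 / ε)) / (16 * (x * (1 - x ^ 2))) := by
  have hP := mul_one_sub_sq_pos hx
  unfold pot
  gcongr
  unfold potNum
  have ha : 0 < 1 / ε := by positivity
  generalize 1 / ε = a at ha
  obtain ⟨h0, h1⟩ := hx
  set k := 1 + 4 * a * x + x ^ 2 with hk
  have hk0 : 0 < k := by positivity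
  have hk1 : k ≤ 2 + 4 * a := by nlinarith
  have t1 : 0 ≤ 4 * (x * (1 - x ^ 2)) * (4 * a + 2 * x) := by positivity
  have t2 : 2 * k * (1 - 3 * x ^ 2) ≤ 2 * k * 1 := by
    have := sq_nonneg x
    gcongr
    linarith
  have t3 : k * (2 + k) ≤ (2 + 4 * a) * (2 + (2 + 4 * a)) := by gcongr
  nlinarith

/-- On this interval x(1 - x²) ≥ x/2, so ψ grows more slowly than √(8x). This converts the 1/x
singularity of `pot` into 1/s². -/
theorem ψ_le (ε : ℝ) {x : ℝ} (hx : x ∈ Ioo (0 : ℝ) (10 / 19)) : ψ ε x ^ 2 ≤ 8 * x := by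
  have hsub : ∀ {t : ℝ}, t ∈ Ioo (0 : ℝ) (10 / 19) → t ∈ Ioo (0 : ℝ) 1 := fun ht =>
    ⟨ht.1, ht.2.trans (by norm_num)⟩
  have hd : ∀ t ∈ Ioo (0 : ℝ) (10 / 19), HasDerivAt (fun t => √(8 * t) - ψ ε t)
      (8 / (2 * √(8 * t)) - (speed t)⁻¹) t := fun t ht => by
    have h8 : HasDerivAt (fun t : ℝ => 8 * t) 8 t := by
      simpa using (hasDerivAt_id t).const_mul (8 : ℝ)
    exact (h8.sqrt (by have := ht.1; positivity)).sub (hasDerivAt_ψ ε (hsub ht))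
  have hm := monotoneOn_Ioo_of_hasDerivAt hd fun t ht => by
    have ht0 := ht.1
    have hs := speed_pos (hsub ht)
    have h8 : 0 < √(8 * t) := by positivity
    rw [sub_nonneg, inv_eq_one_div, div_le_div_iff₀ hs (by positivity)]
    have h2 : √(8 * t) ≤ 4 * speed t := by
      rw [speed, Real.sqrt_le_left (by positivity), mul_pow,
        Real.sq_sqrt (mul_one_sub_sq_pos (hsub ht)).le]
      have : t ^ 2 ≤ (10 / 19) ^ 2 := by have := ht.2.le; gcongr
      nlinarith
    linarith
  have h0 : Tendsto (fun t => √(8 * t) - ψ ε t) (𝓝[>] 0) (𝓝 0) := by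
    have h1 : Tendsto (ψ ε) (𝓝[>] 0) (𝓝 0) := by
      have := (continuousOn_ψ ε) 0 ⟨le_rfl, zero_le_one⟩
      rw [ContinuousWithinAt, ψ_zero] at this
      refine this.mono_left ?_
      rw [← nhdsWithin_Ioo_eq_nhdsGT one_pos]
      exact nhdsWithin_mono _ Ioo_subset_Icc_self
    have h2 : Tendsto (fun t : ℝ => √(8 * t)) (𝓝[>] 0) (𝓝 (√(8 * 0))) :=
      (Continuous.tendsto (by fun_prop) 0).mono_left nhdsWithin_le_nhds
    simpa using h2.sub h1
  have h := nonneg_of_monotoneOn_of_tendsto hm h0 hx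
  have h1 : ψ ε x ≤ √(8 * x) := by linarith
  have h2 := pow_le_pow_left₀ (ψ_mem ε (hsub hx)).1.le h1 2
  rwa [Real.sq_sqrt (by have := hx.1; positivity)] at h2

theorem β_sub_ψ_le (ε : ℝ) {x : ℝ} (hx : x ∈ Ioo (9 / 19 : ℝ) 1) :
    (β - ψ ε x) ^ 2 ≤ 8 * (1 - x) := by
  have hsub : ∀ {t : ℝ}, t ∈ Ioo (0 : ℝ) (10 / 19) → 1 - t ∈ Ioo (0 : ℝ) 1 := fun ht =>
    ⟨by linarith [ht.2], by linarith [ht.1]⟩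
  have hd : ∀ t ∈ Ioo (0 : ℝ) (10 / 19), HasDerivAt (fun t => √(8 * t) + ψ ε (1 - t))
      (8 / (2 * √(8 * t)) + (speed (1 - t))⁻¹ * (-1)) t := fun t ht => by
    have h8 : HasDerivAt (fun t : ℝ => 8 * t) 8 t := by
      simpa using (hasDerivAt_id t).const_mul (8 : ℝ)
    exact (h8.sqrt (by have := ht.1; positivity)).add
      ((hasDerivAt_ψ ε (hsub ht)).comp t ((hasDerivAt_id t).const_sub 1))
  have hm := monotoneOn_Ioo_of_hasDerivAt hd fun t ht => by
    have ht0 := ht.1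
    have hs := speed_pos (hsub ht)
    have h8 : 0 < √(8 * t) := by positivity
    rw [mul_neg_one, ← sub_eq_add_neg, sub_nonneg, inv_eq_one_div,
      div_le_div_iff₀ hs (by positivity)]
    have h2 : √(8 * t) ≤ 4 * speed (1 - t) := by
      rw [speed, Real.sqrt_le_left (by have := Real.sqrt_nonneg ((1 - t) * (1 - (1 - t) ^ 2)); positivity), mul_pow,
        Real.sq_sqrt (mul_one_sub_sq_pos (hsub ht)).le]
      have h3 : (1 - t) * (1 - (1 - t) ^ 2) = t * ((1 - t) * (2 - t)) := by ring
      have h4 : 1 / 2 ≤ (1 - t) * (2 - t) := by nlinarith [ht.2]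
      rw [h3]
      nlinarith
    linarith
  have h0 : Tendsto (fun t => √(8 * t) + ψ ε (1 - t)) (𝓝[>] 0) (𝓝 β) := by
    have h1 : Tendsto (fun t => ψ ε (1 - t)) (𝓝[>] 0) (𝓝 β) := by
      have := (continuousOn_ψ ε) 1 ⟨zero_le_one, le_rfl⟩
      rw [ContinuousWithinAt, ψ_one] at this
      refine this.comp (tendsto_nhdsWithin_iff.2 ⟨?_, ?_⟩)
      · have : Tendsto (fun t : ℝ => 1 - t) (𝓝 0) (𝓝 (1 - 0)) := Continuous.tendsto (by fun_prop) 0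
        rw [sub_zero] at this
        exact this.mono_left nhdsWithin_le_nhds
      · filter_upwards [Ioo_mem_nhdsGT one_pos] with t ht
        exact ⟨by linarith [ht.2], by linarith [ht.1]⟩
    have h2 : Tendsto (fun t : ℝ => √(8 * t)) (𝓝[>] 0) (𝓝 (√(8 * 0))) :=
      (Continuous.tendsto (by fun_prop) 0).mono_left nhdsWithin_le_nhds
    simpa using h2.add h1
  have hx' : 1 - x ∈ Ioo (0 : ℝ) (10 / 19) := ⟨by linarith [hx.2], by linarith [hx.1]⟩
  have h := nonneg_of_monotoneOn_of_tendsto hm h0 hx'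
  simp only [sub_sub_cancel] at h
  have h1 : β - ψ ε x ≤ √(8 * (1 - x)) := by linarith
  have h2 := pow_le_pow_left₀ (by
    have := (ψ_mem ε (x := x) ⟨by linarith [hx.1], hx.2⟩).2
    linarith) h1 2
  rwa [Real.sq_sqrt (by have := hx.2; linarith)] at h2

/-- The potential has at most an inverse square singularity at `0`. -/
theorem V_le_left {ε : ℝ} (hε : 0 < ε) {s : ℝ} (hs : s ∈ Ioo 0 (ψ ε (10 / 19))) :
    V ε s ≤ (2 + 4 * (1 / ε)) * (4 + 4 * (1 / ε)) / s ^ 2 := by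
  have hm : (10 / 19 : ℝ) ∈ Ioo (0 : ℝ) 1 := by norm_num
  have hsβ : s ∈ Ioo 0 β := ⟨hs.1, hs.2.trans (ψ_mem ε hm).2⟩
  have hx := φ_mem ε hsβ
  have hx' : φ ε s ∈ Ioo (0 : ℝ) (10 / 19) := ⟨hx.1, by
    rw [← φ_ψ ε (Ioo_subset_Icc_self hm)]
    exact strictMonoOn_φ ε (Ioo_subset_Icc_self hsβ) (Ioo_subset_Icc_self (ψ_mem ε hm)) hs.2⟩
  have h := ψ_le ε hx'
  rw [ψ_φ ε (Ioo_subset_Icc_self hsβ)] at h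
  rw [V_eq ε hsβ]
  refine (pot_le hε hx).trans ?_
  have hs0 := hs.1
  gcongr
  have : φ ε s ^ 2 ≤ (10 / 19) ^ 2 := by have := hx'.1.le; have := hx'.2.le; gcongr
  nlinarith [hx'.1]

/-- The potential has at most an inverse square singularity at `β`. -/
theorem V_le_right {ε : ℝ} (hε : 0 < ε) {t : ℝ} (ht : t ∈ Ioo 0 (β - ψ ε (9 / 19))) :
    V ε (β - t) ≤ (2 + 4 * (1 / ε)) * (4 + 4 * (1 / ε)) / t ^ 2 := by
  have hm : (9 / 19 : ℝ) ∈ Ioo (0 : ℝ) 1 := by norm_num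
  have hψ := ψ_mem ε hm
  have hsβ : β - t ∈ Ioo 0 β := ⟨by linarith [ht.2, hψ.1], by linarith [ht.1]⟩
  have hx := φ_mem ε hsβ
  have hx' : φ ε (β - t) ∈ Ioo (9 / 19 : ℝ) 1 := ⟨by
    rw [← φ_ψ ε (Ioo_subset_Icc_self hm)]
    exact strictMonoOn_φ ε (Ioo_subset_Icc_self hψ) (Ioo_subset_Icc_self hsβ) (by linarith [ht.2]),
    hx.2⟩
  have h := β_sub_ψ_le ε hx'
  rw [ψ_φ ε (Ioo_subset_Icc_self hsβ), sub_sub_cancel] at h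
  rw [V_eq ε hsβ]
  refine (pot_le hε hx).trans ?_
  have ht0 := ht.1
  gcongr
  set x := φ ε (β - t)
  have h4 : 1 / 2 ≤ x * (1 + x) := by nlinarith [hx'.1]
  have h5 : x * (1 - x ^ 2) = (1 - x) * (x * (1 + x)) := by ring
  rw [h5]
  nlinarith [hx'.2]

/-! ### The first order system -/

theorem continuousOn_p {ε : ℝ} (hε : 0 < ε) : ContinuousOn (p ε) (Icc 0 1) := by
  unfold p
  refine ContinuousOn.mul (ContinuousOn.rpow_const (by fun_prop) fun x _ => Or.inr ?_)
    (ContinuousOn.rpow_const (by fun_prop) fun x hx => Or.inl ?_)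
  · positivity
  · linarith [hx.1]

theorem p_zero (ε : ℝ) : p ε 0 = 1 := by simp [p]

theorem p_one {ε : ℝ} (hε : 0 < ε) : p ε 1 = 0 := by
  have : 1 + 1 / ε ≠ 0 := by positivity
  rw [p, sub_self, Real.zero_rpow this, zero_mul]

theorem tendsto_p_zero {ε : ℝ} (hε : 0 < ε) : Tendsto (p ε) (𝓝[>] 0) (𝓝 1) := by
  have h := continuousOn_p hε 0 ⟨le_rfl, zero_le_one⟩
  rw [ContinuousWithinAt, p_zero] at h
  rw [← nhdsWithin_Ioo_eq_nhdsGT one_pos]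
  exact h.mono_left (nhdsWithin_mono _ Ioo_subset_Icc_self)

theorem tendsto_p_one {ε : ℝ} (hε : 0 < ε) : Tendsto (p ε) (𝓝[<] 1) (𝓝 0) := by
  have h := continuousOn_p hε 1 ⟨zero_le_one, le_rfl⟩
  rw [ContinuousWithinAt, p_one hε] at h
  rw [← nhdsWithin_Ioo_eq_nhdsLT one_pos]
  exact h.mono_left (nhdsWithin_mono _ Ioo_subset_Icc_self)

theorem continuousOn_w (ε : ℝ) : ContinuousOn (w ε) (Ioo 0 1) := by
  have h : ContinuousOn (fun x => p ε x / (x * (1 - x ^ 2))) (Ioo 0 1) :=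
    ContinuousOn.div (fun x hx => (differentiableAt_p ε hx).continuousAt.continuousWithinAt)
      (by fun_prop) fun x hx => (mul_one_sub_sq_pos hx).ne'
  refine h.congr fun x hx => ?_
  simp only
  rw [p_eq ε hx, mul_div_cancel_right₀ _ (mul_one_sub_sq_pos hx).ne']

/-- `f` and `F = p f'` solve the first order system equivalent to `-(p f')' = l w f`. -/
def IsSol {E : Type*} [NormedAddCommGroup E] [NormedSpace ℝ E] (ε l a b : ℝ) (f F : ℝ → E) : Prop :=
  ∀ x ∈ Ioo a b, HasDerivAt f ((p ε x)⁻¹ • F x) x ∧ HasDerivAt F (-(l * w ε x) • f x) x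

/-! ### Uniqueness and Wronskians for the first order system -/

section System

variable {E : Type*} [NormedAddCommGroup E] [NormedSpace ℝ E] {ε l a b : ℝ}

theorem IsSol.mono {f F : ℝ → E} (h : IsSol ε l a b f F) {a' b' : ℝ} (ha : a ≤ a') (hb : b' ≤ b) :
    IsSol ε l a' b' f F := fun x hx => h x (Ioo_subset_Ioo ha hb hx)

theorem IsSol.sub {f F g G : ℝ → E} (h : IsSol ε l a b f F) (h' : IsSol ε l a b g G) :
    IsSol ε l a b (fun x => f x - g x) (fun x => F x - G x) := fun x hx => by
  refine ⟨((h x hx).1.sub (h' x hx).1).congr_deriv ?_, ((h x hx).2.sub (h' x hx).2).congr_deriv ?_⟩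
  · rw [smul_sub]
  · rw [smul_sub]

theorem IsSol.smul_const {u U : ℝ → ℝ} (h : IsSol ε l a b u U) (k : E) :
    IsSol ε l a b (fun x => u x • k) (fun x => U x • k) := fun x hx => by
  refine ⟨((h x hx).1.smul_const k).congr_deriv ?_, ((h x hx).2.smul_const k).congr_deriv ?_⟩
  · rw [smul_eq_mul, mul_smul]
  · rw [smul_eq_mul, mul_smul]

/-- The coefficients are singular at 0 and 1 but bounded on a compact subinterval containing both
points, where Lipschitz uniqueness applies. -/
theorem IsSol.eq_zero {f F : ℝ → E} (h : IsSol ε l a b f F) (ha : 0 ≤ a) (hb : b ≤ 1) {x₀ : ℝ}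
    (hx₀ : x₀ ∈ Ioo a b) (h0 : f x₀ = 0) (h0' : F x₀ = 0) {x : ℝ} (hx : x ∈ Ioo a b) :
    f x = 0 ∧ F x = 0 := by
  obtain ⟨a', ha1, ha2⟩ := exists_between (lt_min hx.1 hx₀.1)
  obtain ⟨b', hb1, hb2⟩ := exists_between (max_lt hx.2 hx₀.2)
  have hsub : Icc a' b' ⊆ Ioo 0 1 := fun t ht =>
    ⟨ha.trans_lt (ha1.trans_le ht.1), (ht.2.trans_lt hb2).trans_le hb⟩
  have c1 : ContinuousOn (fun x => (p ε x)⁻¹) (Icc a' b') := ContinuousOn.inv₀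
    (fun x hx => (differentiableAt_p ε (hsub hx)).continuousAt.continuousWithinAt)
    fun x hx => (p_pos ε (hsub hx)).ne'
  have c2 : ContinuousOn (fun x => -(l * w ε x)) (Icc a' b') :=
    (continuousOn_const.mul ((continuousOn_w ε).mono hsub)).neg
  obtain ⟨A, hA⟩ := isCompact_Icc.exists_bound_of_continuousOn c1
  obtain ⟨B, hB⟩ := isCompact_Icc.exists_bound_of_continuousOn c2
  have key := ODE_solution_unique_of_mem_Ioo
    (v := fun t (y : E × E) => ((p ε t)⁻¹ • y.2, -(l * w ε t) • y.1)) (s := fun _ => univ)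
    (K := (max A B).toNNReal) (f := fun t => (f t, F t)) (g := fun _ => 0) (a := a') (b := b')
    (t₀ := x₀) ?_ ⟨ha2.trans_le (min_le_right _ _), (le_max_right _ _).trans_lt hb1⟩ ?_ ?_ ?_
    (x := x) ⟨ha2.trans_le (min_le_left _ _), (le_max_left _ _).trans_lt hb1⟩
  · simpa using key
  · intro t ht
    have hAt := hA t (Ioo_subset_Icc_self ht)
    have hBt := hB t (Ioo_subset_Icc_self ht)
    refine LipschitzWith.lipschitzOnWith (LipschitzWith.of_dist_le_mul fun y z => ?_)
    rw [Real.coe_toNNReal _ (((norm_nonneg _).trans hAt).trans (le_max_left _ _)), Prod.dist_eq,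
      dist_smul₀, dist_smul₀, Prod.dist_eq]
    refine max_le ?_ ?_
    · exact mul_le_mul (hAt.trans (le_max_left _ _)) (le_max_right _ _) dist_nonneg
        (((norm_nonneg _).trans hAt).trans (le_max_left _ _))
    · exact mul_le_mul (hBt.trans (le_max_right _ _)) (le_max_left _ _) dist_nonneg
        (((norm_nonneg _).trans hAt).trans (le_max_left _ _))
  · intro t ht
    have := h t ⟨ha1.trans ht.1, ht.2.trans hb2⟩
    exact ⟨this.1.prodMk this.2, mem_univ _⟩
  · intro t _
    refine ⟨?_, mem_univ _⟩
    exact (hasDerivAt_const t (0 : E × E)).congr_deriv (by ext <;> simp)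
  · simp [h0, h0']

theorem IsSol.wronskian {u U : ℝ → ℝ} {f F : ℝ → E} (hu : IsSol ε l a b u U)
    (hf : IsSol ε l a b f F) : ∀ x ∈ Ioo a b, HasDerivAt (fun x => u x • F x - U x • f x) 0 x := by
  intro x hx
  refine (((hu x hx).1.smul (hf x hx).2).sub ((hu x hx).2.smul (hf x hx).1)).congr_deriv ?_
  simp only [smul_smul, smul_eq_mul]
  module

/-- A solution whose Wronskian with a nontrivial real solution vanishes is a multiple of it. -/
theorem IsSol.eq_smul {u U : ℝ → ℝ} {f F : ℝ → E} (hu : IsSol ε l a b u U)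
    (hf : IsSol ε l a b f F) (ha : 0 ≤ a) (hb : b ≤ 1) {x₀ : ℝ} (hx₀ : x₀ ∈ Ioo a b)
    (hne : u x₀ ≠ 0 ∨ U x₀ ≠ 0) (hW : u x₀ • F x₀ - U x₀ • f x₀ = 0) :
    ∃ k : E, ∀ x ∈ Ioo a b, f x = u x • k ∧ F x = U x • k := by
  have hr : 0 < u x₀ ^ 2 + U x₀ ^ 2 := by
    rcases hne with h | h
    · have := sq_pos_of_ne_zero h; positivity
    · have := sq_pos_of_ne_zero h; positivity
  have hW' := sub_eq_zero.1 hW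
  -- k is the coefficient of the orthogonal projection of (f, F) onto the direction (u, U) at x₀.
  set k : E := (u x₀ ^ 2 + U x₀ ^ 2)⁻¹ • (u x₀ • f x₀ + U x₀ • F x₀) with hk
  have hk1 : f x₀ = u x₀ • k := by
    rw [hk, smul_comm, eq_inv_smul_iff₀ hr.ne', smul_add, smul_comm (u x₀) (U x₀), hW', add_smul,
      pow_two, pow_two, mul_smul, mul_smul]
  have hk2 : F x₀ = U x₀ • k := by
    rw [hk, smul_comm, eq_inv_smul_iff₀ hr.ne', smul_add, smul_comm (U x₀) (u x₀), ← hW', add_smul,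
      pow_two, pow_two, mul_smul, mul_smul]
  refine ⟨k, fun x hx => ?_⟩
  have := (hf.sub (hu.smul_const k)).eq_zero ha hb hx₀ (sub_eq_zero.2 hk1) (sub_eq_zero.2 hk2) hx
  exact ⟨sub_eq_zero.1 this.1, sub_eq_zero.1 this.2⟩

end System

/-- Dividing the equation by w leaves polynomial coefficients, which is the form the power series
can solve. -/
theorem hasDerivAt_p_mul {ε l x : ℝ} (hx : x ∈ Ioo (0 : ℝ) 1) {f f' f'' : ℝ → ℝ}
    (hf' : HasDerivAt f' (f'' x) x)
    (h : x * (1 - x ^ 2) * f'' x - x * (2 * (1 / ε) + 2 * x) * f' x + l * f x = 0) :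
    HasDerivAt (fun x => p ε x * f' x) (-(l * w ε x) • f x) x := by
  refine ((hasDerivAt_p ε hx).mul hf').congr_deriv ?_
  rw [p_eq ε hx, smul_eq_mul]
  linear_combination w ε x * h

/-! ### The solutions that are smooth at the endpoints -/

/-- The solution that is smooth at `0` and vanishes there, with its derivative. -/
structure IsLeftSol (ε l : ℝ) (u u' : ℝ → ℝ) : Prop where
  contDiffOn : ContDiffOn ℝ ∞ u (Ioo (-(10 / 19)) (10 / 19))
  zero : u 0 = 0
  deriv_zero : u' 0 = 1
  hasDerivAt : ∀ x ∈ Ioo (-(10 / 19) : ℝ) (10 / 19), HasDerivAt u (u' x) x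
  continuousAt : ∀ x ∈ Ioo (-(10 / 19) : ℝ) (10 / 19), ContinuousAt u' x
  isSol : IsSol ε l 0 (10 / 19) u fun x => p ε x * u' x

/-- The solution that is smooth at `1`, with its derivative. -/
structure IsRightSol (ε l : ℝ) (v v' : ℝ → ℝ) : Prop where
  contDiffOn : ContDiffOn ℝ ∞ v (Ioo (9 / 19) (29 / 19))
  one : v 1 = 1
  hasDerivAt : ∀ x ∈ Ioo (9 / 19 : ℝ) (29 / 19), HasDerivAt v (v' x) x
  continuousAt : ∀ x ∈ Ioo (9 / 19 : ℝ) (29 / 19), ContinuousAt v' x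
  isSol : IsSol ε l (9 / 19) 1 v fun x => p ε x * v' x

/-- The exponents at 0 are 0 and 1. Since γ₀ = 0, the value c₀ = 0 satisfies the x⁰ relation for
every l and the slope c₁ is free; it is normalized to 1. -/
theorem exists_isLeftSol (ε l : ℝ) : ∃ u u', IsLeftSol ε l u u' := by
  obtain ⟨f, f', f'', hf, h0, h1, h⟩ := exists_smooth_solution (α₀ := 1) (α₁ := 0) (α₂ := -1)
    (γ₀ := 0) (γ₁ := -(2 * (1 / ε))) (l := l) (ρ := 19 / 10) (c₀ := 0) (c₁ := 1) (by norm_num)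
    (by norm_num) le_rfl (by norm_num) (by norm_num)
  norm_num only [one_div_div] at hf h
  refine ⟨f, f', hf, h0, h1, fun x hx => (h x hx).1, fun x hx => (h x hx).2.1.continuousAt, ?_⟩
  intro x hx
  have hx1 : x ∈ Ioo (0 : ℝ) 1 := ⟨hx.1, hx.2.trans (by norm_num)⟩
  obtain ⟨a1, a2, a3⟩ := h x ⟨by linarith [hx.1], hx.2⟩
  have hp := (p_pos ε hx1).ne'
  refine ⟨a1.congr_deriv ?_, hasDerivAt_p_mul hx1 a2 ?_⟩
  · rw [smul_eq_mul, inv_mul_cancel_left₀ hp]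
  · linear_combination a3

/-- The expansion is in 1 - x. Here γ₀ > 0, so the value at 1 determines the slope. The constant ρ
must satisfy 3ρ + 1 < 2ρ² for the growth estimate and ρ < 2 for the intervals at 0 and at 1 to
overlap around 1/2; 19/10 does both. -/
theorem exists_isRightSol {ε : ℝ} (hε : 0 < ε) (l : ℝ) : ∃ v v', IsRightSol ε l v v' := by
  have hA : 0 < 1 + 1 / ε := by positivity
  obtain ⟨f, f', f'', hf, h0, h1, h⟩ := exists_smooth_solution (α₀ := 2) (α₁ := -3) (α₂ := 1)
    (γ₀ := 2 * (1 + 1 / ε)) (γ₁ := -(2 * (1 + 1 / ε) + 2)) (l := l) (ρ := 19 / 10) (c₀ := 1)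
    (c₁ := -l / (2 * (1 + 1 / ε))) (by norm_num) (by norm_num) (by positivity)
    (by field_simp; ring) (by norm_num)
  norm_num only [one_div_div] at hf h
  have hrefl : ∀ {x : ℝ}, x ∈ Ioo (9 / 19 : ℝ) (29 / 19) → 1 - x ∈ Ioo (-(10 / 19) : ℝ) (10 / 19) :=
    fun hx => ⟨by linarith [hx.2], by linarith [hx.1]⟩
  have hr : ∀ x : ℝ, HasDerivAt (fun x : ℝ => 1 - x) (-1) x := fun x =>
    (hasDerivAt_id x).const_sub 1
  refine ⟨fun x => f (1 - x), fun x => -f' (1 - x), ?_, by simpa using h0, fun x hx => ?_,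
    fun x hx => ?_, fun x hx => ?_⟩
  · exact hf.comp (by fun_prop) fun x hx => hrefl hx
  · exact ((h _ (hrefl hx)).1.comp x (hr x)).congr_deriv (by ring)
  · exact ((h _ (hrefl hx)).2.1.comp x (hr x)).continuousAt.neg
  · have hx1 : x ∈ Ioo (0 : ℝ) 1 := ⟨by linarith [hx.1], hx.2⟩
    obtain ⟨a1, a2, a3⟩ := h (1 - x) (hrefl ⟨hx.1, by linarith [hx.2]⟩)
    have hp := (p_pos ε hx1).ne'
    refine ⟨(a1.comp x (hr x)).congr_deriv ?_,
      hasDerivAt_p_mul (f := fun x => f (1 - x)) (f'' := fun x => f'' (1 - x)) hx1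
        ((a2.comp x (hr x)).neg.congr_deriv (by ring)) ?_⟩
    · rw [smul_eq_mul, inv_mul_cancel_left₀ hp]
      ring
    · linear_combination a3

/-! ### Boundary behaviour and nontriviality of the two solutions -/

section Endpoints

variable {ε l : ℝ} {u u' v v' : ℝ → ℝ}

theorem IsLeftSol.tendsto (h : IsLeftSol ε l u u') : Tendsto u (𝓝[>] 0) (𝓝 0) := by
  have := (h.hasDerivAt 0 (by norm_num)).continuousAt.tendsto
  rw [h.zero] at this
  exact this.mono_left nhdsWithin_le_nhds

theorem IsLeftSol.tendsto_deriv (h : IsLeftSol ε l u u') : Tendsto u' (𝓝[>] 0) (𝓝 1) := by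
  have := (h.continuousAt 0 (by norm_num)).tendsto
  rw [h.deriv_zero] at this
  exact this.mono_left nhdsWithin_le_nhds

theorem IsLeftSol.tendsto_div (h : IsLeftSol ε l u u') :
    Tendsto (fun x => u x / x) (𝓝[>] 0) (𝓝 1) := by
  have := (h.hasDerivAt 0 (by norm_num)).tendsto_slope_zero_right
  rw [h.deriv_zero] at this
  refine this.congr fun x => ?_
  rw [zero_add, h.zero, sub_zero, smul_eq_mul, div_eq_inv_mul]

theorem IsLeftSol.eventually_pos (h : IsLeftSol ε l u u') : ∀ᶠ x in 𝓝[>] 0, 0 < u x := by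
  filter_upwards [h.tendsto_div.eventually_const_lt one_pos, self_mem_nhdsWithin] with x h1 h2
  exact (div_pos_iff_of_pos_right h2).1 h1

theorem IsRightSol.tendsto (h : IsRightSol ε l v v') : Tendsto v (𝓝[<] 1) (𝓝 1) := by
  have := (h.hasDerivAt 1 (by norm_num)).continuousAt.tendsto
  rw [h.one] at this
  exact this.mono_left nhdsWithin_le_nhds

theorem IsRightSol.tendsto_deriv (h : IsRightSol ε l v v') : Tendsto v' (𝓝[<] 1) (𝓝 (v' 1)) :=
  (h.continuousAt 1 (by norm_num)).tendsto.mono_left nhdsWithin_le_nhds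

theorem IsRightSol.eventually_pos (h : IsRightSol ε l v v') : ∀ᶠ x in 𝓝[<] 1, 0 < v x :=
  h.tendsto.eventually_const_lt one_pos

theorem IsLeftSol.ne_zero (h : IsLeftSol ε l u u') {x : ℝ} (hx : x ∈ Ioo (0 : ℝ) (10 / 19)) :
    u x ≠ 0 ∨ p ε x * u' x ≠ 0 := by
  by_contra! hc
  obtain ⟨y, hy, hy'⟩ := (h.eventually_pos.and
    (Ioo_mem_nhdsGT (show (0 : ℝ) < 10 / 19 by norm_num))).exists
  exact hy.ne' (h.isSol.eq_zero le_rfl (by norm_num) hx hc.1 hc.2 hy').1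

theorem IsRightSol.ne_zero (h : IsRightSol ε l v v') {x : ℝ} (hx : x ∈ Ioo (9 / 19 : ℝ) 1) :
    v x ≠ 0 ∨ p ε x * v' x ≠ 0 := by
  by_contra! hc
  obtain ⟨y, hy, hy'⟩ := (h.eventually_pos.and
    (Ioo_mem_nhdsLT (show (9 / 19 : ℝ) < 1 by norm_num))).exists
  exact hy.ne' (h.isSol.eq_zero (by norm_num) le_rfl hx hc.1 hc.2 hy').1

end Endpoints

/-! ### Classical eigenfunctions -/

/-- `f` is a smooth function on `[0,1]` with `f 0 = 0` and `-w⁻¹ (p f')' = z f` on `(0,1)`. -/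
def IsClassical (ε : ℝ) (z : ℂ) (f : ℝ → ℂ) : Prop :=
  IsSmoothVanishing f ∧ ∀ x ∈ Ioo (0 : ℝ) 1, slExpr ε f x = z * f x

theorem IsSmoothVanishing.hasDerivAt {f : ℝ → ℂ} (hf : IsSmoothVanishing f) {x : ℝ}
    (hx : x ∈ Ioo (0 : ℝ) 1) : HasDerivAt f (deriv f x) x :=
  ((hf.contDiffAt hx).differentiableAt (by simp)).hasDerivAt

theorem IsClassical.hasDerivAt_flux {ε : ℝ} {z : ℂ} {f : ℝ → ℂ} (hf : IsClassical ε z f) {x : ℝ}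
    (hx : x ∈ Ioo (0 : ℝ) 1) :
    HasDerivAt (fun y => p ε y • deriv f y) (-(z * (w ε x • f x))) x := by
  refine (hf.1.differentiableAt_flux ε hx).hasDerivAt.congr_deriv ?_
  have h := hf.2 x hx
  have hw := (w_pos ε hx).ne'
  rw [slExpr, neg_eq_iff_eq_neg, inv_smul_eq_iff₀ hw] at h
  rw [h, smul_neg, mul_smul_comm]

theorem IsClassical.isSol {ε l : ℝ} {f : ℝ → ℂ} (hf : IsClassical ε l f) :
    IsSol ε l 0 1 f fun x => p ε x • deriv f x := by
  intro x hx
  refine ⟨(hf.1.hasDerivAt hx).congr_deriv ?_, (hf.hasDerivAt_flux hx).congr_deriv ?_⟩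
  · rw [inv_smul_smul₀ (p_pos ε hx).ne']
  · rw [neg_smul, mul_smul, ← Complex.real_smul]

theorem IsSmoothVanishing.exists_bound {f : ℝ → ℂ} (hf : IsSmoothVanishing f) :
    ∃ C, ∀ x ∈ Ioo (0 : ℝ) 1, ‖f x‖ ≤ C ∧ ‖deriv f x‖ ≤ C := by
  have c1 : ContinuousOn (derivWithin f (Icc 0 1)) (Icc 0 1) :=
    hf.1.continuousOn_derivWithin (uniqueDiffOn_Icc one_pos) (by simp)
  obtain ⟨A, hA⟩ := isCompact_Icc.exists_bound_of_continuousOn hf.1.continuousOn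
  obtain ⟨B, hB⟩ := isCompact_Icc.exists_bound_of_continuousOn c1
  refine ⟨max A B, fun x hx => ⟨(hA x (Ioo_subset_Icc_self hx)).trans (le_max_left _ _), ?_⟩⟩
  rw [← derivWithin_of_mem_nhds (Icc_mem_nhds hx.1 hx.2)]
  exact (hB x (Ioo_subset_Icc_self hx)).trans (le_max_right _ _)

theorem IsSmoothVanishing.tendsto_zero {f : ℝ → ℂ} (hf : IsSmoothVanishing f) :
    Tendsto f (𝓝[>] 0) (𝓝 0) := by
  have h := hf.1.continuousOn 0 ⟨le_rfl, zero_le_one⟩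
  rw [ContinuousWithinAt, hf.2] at h
  rw [← nhdsWithin_Ioo_eq_nhdsGT one_pos]
  exact h.mono_left (nhdsWithin_mono _ Ioo_subset_Icc_self)

theorem tendsto_smul_zero_of_bound {E : Type*} [NormedAddCommGroup E] [NormedSpace ℝ E]
    {L : Filter ℝ} {k : ℝ → ℝ} {f : ℝ → E} {C : ℝ} (hk : Tendsto k L (𝓝 0))
    (hf : ∀ᶠ x in L, ‖f x‖ ≤ C) : Tendsto (fun x => k x • f x) L (𝓝 0) :=
  hk.zero_smul_isBoundedUnder_le ⟨C, by rwa [eventually_map]⟩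

/-! ### Real eigenvalues as matching of the two endpoint solutions -/

section RealEigenvalue

variable {ε l : ℝ} {f : ℝ → ℂ} {u u' v v' : ℝ → ℝ}

/-- The Wronskian p(u f' - u' f) is constant and tends to 0 at 0, because u and f vanish there while
f' is bounded and u' converges. -/
theorem IsClassical.eq_smul_left (hε : 0 < ε) (hf : IsClassical ε l f) (hu : IsLeftSol ε l u u') :
    ∃ k : ℂ, ∀ x ∈ Ioo (0 : ℝ) (10 / 19),
      f x = u x • k ∧ p ε x • deriv f x = (p ε x * u' x) • k := by
  have hsol : IsSol ε l 0 (10 / 19) f fun x => p ε x • deriv f x :=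
    hf.isSol.mono le_rfl (by norm_num)
  obtain ⟨C, hC⟩ := hf.1.exists_bound
  have hev : ∀ᶠ x in 𝓝[>] (0 : ℝ), ‖deriv f x‖ ≤ C := by
    filter_upwards [Ioo_mem_nhdsGT one_pos] with x hx using (hC x hx).2
  have hlim : Tendsto (fun x => u x • (p ε x • deriv f x) - (p ε x * u' x) • f x) (𝓝[>] 0)
      (𝓝 0) := by
    have h1 : Tendsto (fun x => (u x * p ε x) • deriv f x) (𝓝[>] 0) (𝓝 0) :=
      tendsto_smul_zero_of_bound (by simpa using hu.tendsto.mul (tendsto_p_zero hε)) hev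
    have h2 := ((tendsto_p_zero hε).mul hu.tendsto_deriv).smul hf.1.tendsto_zero
    simpa [mul_smul] using h1.sub h2
  have hm : (1 / 4 : ℝ) ∈ Ioo (0 : ℝ) (10 / 19) := by norm_num
  have hW := hu.isSol.wronskian hsol
  refine hu.isSol.eq_smul hsol le_rfl (by norm_num) hm (hu.ne_zero hm) ?_
  refine tendsto_nhds_unique (tendsto_const_nhds.congr' ?_) hlim
  filter_upwards [Ioo_mem_nhdsGT (show (0 : ℝ) < 10 / 19 by norm_num)] with x hx
  exact eq_of_hasDerivAt_zero hW hm hx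

/-- No boundary condition is needed at 1: f, f', v, v' stay bounded and p(1) = 0, so the constant
Wronskian is 0. -/
theorem IsClassical.eq_smul_right (hε : 0 < ε) (hf : IsClassical ε l f)
    (hv : IsRightSol ε l v v') :
    ∃ k : ℂ, ∀ x ∈ Ioo (9 / 19 : ℝ) 1,
      f x = v x • k ∧ p ε x • deriv f x = (p ε x * v' x) • k := by
  have hsol : IsSol ε l (9 / 19) 1 f fun x => p ε x • deriv f x :=
    hf.isSol.mono (by norm_num) le_rfl
  obtain ⟨C, hC⟩ := hf.1.exists_bound
  have hev : ∀ᶠ x in 𝓝[<] (1 : ℝ), ‖f x‖ ≤ C ∧ ‖deriv f x‖ ≤ C := by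
    filter_upwards [Ioo_mem_nhdsLT one_pos] with x hx using hC x hx
  have hlim : Tendsto (fun x => v x • (p ε x • deriv f x) - (p ε x * v' x) • f x) (𝓝[<] 1)
      (𝓝 0) := by
    have h1 : Tendsto (fun x => (v x * p ε x) • deriv f x) (𝓝[<] 1) (𝓝 0) :=
      tendsto_smul_zero_of_bound (by simpa using hv.tendsto.mul (tendsto_p_one hε))
        (hev.mono fun _ h => h.2)
    have h2 : Tendsto (fun x => (p ε x * v' x) • f x) (𝓝[<] 1) (𝓝 0) :=
      tendsto_smul_zero_of_bound (by simpa using (tendsto_p_one hε).mul hv.tendsto_deriv)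
        (hev.mono fun _ h => h.1)
    simpa [mul_smul] using h1.sub h2
  have hm : (1 / 2 : ℝ) ∈ Ioo (9 / 19 : ℝ) 1 := by norm_num
  have hW := hv.isSol.wronskian hsol
  refine hv.isSol.eq_smul hsol (by norm_num) le_rfl hm (hv.ne_zero hm) ?_
  refine tendsto_nhds_unique (tendsto_const_nhds.congr' ?_) hlim
  filter_upwards [Ioo_mem_nhdsLT (show (9 / 19 : ℝ) < 1 by norm_num)] with x hx
  exact eq_of_hasDerivAt_zero hW hm hx

theorem IsClassical.eq_zero_of_left (hf : IsClassical ε l f)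
    (h : ∀ x ∈ Ioo (0 : ℝ) (10 / 19), f x = 0 ∧ p ε x • deriv f x = 0) {x : ℝ}
    (hx : x ∈ Ioo (0 : ℝ) 1) : f x = 0 :=
  (hf.isSol.eq_zero le_rfl le_rfl (x₀ := 1 / 4) (by norm_num) (h _ (by norm_num)).1
    (h _ (by norm_num)).2 hx).1

/-- Two eigenfunctions for the same eigenvalue are proportional. -/
theorem IsClassical.proportional (hε : 0 < ε) {g : ℝ → ℂ} (hf : IsClassical ε l f)
    (hg : IsClassical ε l g) {x₀ : ℝ} (hx₀ : x₀ ∈ Ioo (0 : ℝ) 1) (hne : g x₀ ≠ 0) :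
    ∃ k : ℂ, ∀ x ∈ Ioo (0 : ℝ) 1, f x = k * g x := by
  obtain ⟨u, u', hu⟩ := exists_isLeftSol ε l
  obtain ⟨k₁, h₁⟩ := hf.eq_smul_left hε hu
  obtain ⟨k₂, h₂⟩ := hg.eq_smul_left hε hu
  have hk₂ : k₂ ≠ 0 := by
    rintro rfl
    exact hne (hg.eq_zero_of_left (fun x hx => by simpa using h₂ x hx) hx₀)
  refine ⟨k₁ / k₂, fun x hx => ?_⟩
  have hs : IsSol ε l 0 1 (fun x => (k₁ / k₂) • g x) (fun x => (k₁ / k₂) • (p ε x • deriv g x)) := by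
    intro x hx
    refine ⟨((hg.isSol x hx).1.const_smul (k₁ / k₂)).congr_deriv ?_,
      ((hg.isSol x hx).2.const_smul (k₁ / k₂)).congr_deriv ?_⟩
    · rw [smul_comm]
    · rw [smul_comm]
  have hq : (1 / 4 : ℝ) ∈ Ioo (0 : ℝ) (10 / 19) := by norm_num
  have := ((hf.isSol.sub hs).eq_zero le_rfl le_rfl (x₀ := 1 / 4) (by norm_num) ?_ ?_ hx).1
  · simpa [sub_eq_zero] using this
  · rw [(h₁ _ hq).1, (h₂ _ hq).1, smul_comm, smul_eq_mul, div_mul_cancel₀ _ hk₂, sub_self]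
  · rw [(h₁ _ hq).2, (h₂ _ hq).2, smul_comm, smul_eq_mul, div_mul_cancel₀ _ hk₂, sub_self]

theorem IsClassical.matching (hε : 0 < ε) (hf : IsClassical ε l f) (hu : IsLeftSol ε l u u')
    (hv : IsRightSol ε l v v') {x₀ : ℝ} (hx₀ : x₀ ∈ Ioo (0 : ℝ) 1) (hne : f x₀ ≠ 0) :
    u (1 / 2) * v' (1 / 2) = u' (1 / 2) * v (1 / 2) := by
  obtain ⟨k₁, h₁⟩ := hf.eq_smul_left hε hu
  obtain ⟨k₂, h₂⟩ := hf.eq_smul_right hε hv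
  have hk₁ : k₁ ≠ 0 := by
    rintro rfl
    exact hne (hf.eq_zero_of_left (fun x hx => by simpa using h₁ x hx) hx₀)
  obtain ⟨a1, a2⟩ := h₁ (1 / 2) (by norm_num)
  obtain ⟨b1, b2⟩ := h₂ (1 / 2) (by norm_num)
  have hp := (p_pos ε (x := 1 / 2) (by norm_num)).ne'
  rw [a1] at b1
  rw [a2, mul_smul, mul_smul] at b2
  have b3 := smul_right_injective ℂ hp b2
  simp only [Complex.real_smul] at b1 b3
  have : ((u (1 / 2) * v' (1 / 2) - u' (1 / 2) * v (1 / 2) : ℝ) : ℂ) * k₁ = 0 := by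
    push_cast
    linear_combination (v' (1 / 2) : ℂ) * b1 - (v (1 / 2) : ℂ) * b3
  rw [mul_eq_zero, or_iff_left hk₁, Complex.ofReal_eq_zero] at this
  exact sub_eq_zero.1 this

/-- If the two endpoint solutions match at `1/2`, they glue to an eigenfunction. -/
theorem exists_isClassical (hu : IsLeftSol ε l u u') (hv : IsRightSol ε l v v')
    (hW : u (1 / 2) * v' (1 / 2) = u' (1 / 2) * v (1 / 2)) :
    ∃ f : ℝ → ℂ, IsClassical ε l f ∧ ∃ x ∈ Ioo (0 : ℝ) 1, f x ≠ 0 := by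
  obtain ⟨k, hk⟩ := IsSol.eq_smul (hv.isSol.mono (le_refl _) (by norm_num : (10 / 19 : ℝ) ≤ 1))
    (hu.isSol.mono (by norm_num : (0 : ℝ) ≤ 9 / 19) (le_refl _)) (by norm_num) (by norm_num)
    (x₀ := 1 / 2) (by norm_num) (hv.ne_zero (by norm_num)) (by
      simp only [smul_eq_mul]; linear_combination p ε (1 / 2) * (-hW))
  -- On the overlap (9/19, 10/19) the two branches coincide, so near every point g equals one of two
  -- smooth functions.
  set g : ℝ → ℝ := fun x => if x < 1 / 2 then u x else v x * k with hg
  have gu : ∀ x < 10 / 19, g x = u x := fun x hx => by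
    simp only [hg]
    split_ifs with h
    · rfl
    · exact (hk x ⟨by linarith, hx⟩).1.symm
  have gv : ∀ x > 9 / 19, g x = v x * k := fun x hx => by
    simp only [hg]
    split_ifs with h
    · exact (hk x ⟨hx, by linarith⟩).1
    · rfl
  have evu : ∀ x : ℝ, x < 10 / 19 → g =ᶠ[𝓝 x] u := fun x hx => by
    filter_upwards [Iio_mem_nhds hx] with y hy using gu y hy
  have evv : ∀ x : ℝ, 9 / 19 < x → g =ᶠ[𝓝 x] fun x => v x * k := fun x hx => by
    filter_upwards [Ioi_mem_nhds hx] with y hy using gv y hy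
  have hcases : ∀ x : ℝ, x < 10 / 19 ∨ 9 / 19 < x := fun x => by
    rcases lt_or_ge x (10 / 19) with h | h
    · exact Or.inl h
    · exact Or.inr (by linarith)
  have hgs : ∀ x ∈ Icc (0 : ℝ) 1, ContDiffAt ℝ ∞ g x := by
    intro x hx
    rcases hcases x with h | h
    · have hI : Ioo (-(10 / 19) : ℝ) (10 / 19) ∈ 𝓝 x := Ioo_mem_nhds (by linarith [hx.1]) h
      exact ((hu.contDiffOn x (mem_of_mem_nhds hI)).contDiffAt hI).congr_of_eventuallyEq (evu x h)
    · have hI : Ioo (9 / 19 : ℝ) (29 / 19) ∈ 𝓝 x := Ioo_mem_nhds h (by linarith [hx.2])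
      exact (((hv.contDiffOn x (mem_of_mem_nhds hI)).contDiffAt hI).mul
        contDiffAt_const).congr_of_eventuallyEq (evv x h)
  have hgsol : ∀ x ∈ Ioo (0 : ℝ) 1, HasDerivAt (fun x => p ε x * deriv g x)
      (-(l * w ε x) * g x) x := by
    intro x hx
    rcases hcases x with h | h
    · have h1 := (hu.isSol x ⟨hx.1, h⟩).2
      rw [gu x h]
      refine h1.congr_of_eventuallyEq ?_
      filter_upwards [Ioo_mem_nhds hx.1 h] with y hy
      rw [(evu y hy.2).deriv_eq, (hu.hasDerivAt y ⟨by linarith [hy.1], hy.2⟩).deriv]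
    · have h1 := ((hv.isSol x ⟨h, hx.2⟩).2).mul_const k
      rw [gv x h, ← mul_assoc]
      refine h1.congr_of_eventuallyEq ?_
      filter_upwards [Ioo_mem_nhds h hx.2] with y hy
      rw [(evv y hy.1).deriv_eq,
        ((hv.hasDerivAt y ⟨hy.1, by linarith [hy.2]⟩).mul_const k).deriv, mul_assoc]
  refine ⟨fun x => (g x : ℂ), ⟨⟨fun x hx => ?_, ?_⟩, fun x hx => ?_⟩, ?_⟩
  · exact (Complex.ofRealCLM.contDiff.contDiffAt.comp x (hgs x hx)).contDiffWithinAt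
  · simp only
    rw [gu 0 (by norm_num), hu.zero, Complex.ofReal_zero]
  · have hd : ∀ y ∈ Ioo (0 : ℝ) 1, deriv (fun x => (g x : ℂ)) y = ((deriv g y : ℝ) : ℂ) := fun y hy =>
      (((hgs y (Ioo_subset_Icc_self hy)).differentiableAt (by simp)).hasDerivAt.ofReal_comp).deriv
    have h2 : HasDerivAt (fun y => p ε y • deriv (fun x => (g x : ℂ)) y)
        ((-(l * w ε x) * g x : ℝ) : ℂ) x := by
      refine (hgsol x hx).ofReal_comp.congr_of_eventuallyEq ?_
      filter_upwards [Ioo_mem_nhds hx.1 hx.2] with y hy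
      rw [hd y hy, Complex.real_smul, Complex.ofReal_mul]
    have hw : (w ε x : ℂ) ≠ 0 := by exact_mod_cast (w_pos ε hx).ne'
    rw [slExpr, h2.deriv, Complex.real_smul]
    push_cast
    field_simp
  · obtain ⟨y, hy, hy'⟩ := (hu.eventually_pos.and
      (Ioo_mem_nhdsGT (show (0 : ℝ) < 10 / 19 by norm_num))).exists
    refine ⟨y, ⟨hy'.1, hy'.2.trans (by norm_num)⟩, ?_⟩
    simp only
    rw [gu y hy'.2]
    exact_mod_cast hy.ne'

end RealEigenvalue

/-- There are no eigenfunctions for nonreal spectral parameters. -/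
theorem IsClassical.eq_zero_of_im_ne_zero {ε : ℝ} (hε : 0 < ε) {z : ℂ} {f : ℝ → ℂ}
    (hf : IsClassical ε z f) (hz : z.im ≠ 0) {x : ℝ} (hx : x ∈ Ioo (0 : ℝ) 1) : f x = 0 := by
  -- H' = -(Im z)² w |f|², the extra factor Im z fixing the sign. H is monotone and tends to 0 at
  -- both ends, hence vanishes identically, and so does f.
  set H : ℝ → ℝ := fun x => z.im * ((p ε x • deriv f x) * starRingEnd ℂ (f x)).im with hH
  have hd : ∀ x ∈ Ioo (0 : ℝ) 1, HasDerivAt H (-(z.im ^ 2 * w ε x * Complex.normSq (f x))) x := by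
    intro x hx
    have h1 : HasDerivAt (fun x => starRingEnd ℂ (f x)) (starRingEnd ℂ (deriv f x)) x :=
      (hf.1.hasDerivAt hx).star
    have h2 := (hf.hasDerivAt_flux hx).mul h1
    have h3 := (Complex.imCLM.hasFDerivAt.comp_hasDerivAt x h2).const_mul z.im
    refine h3.congr_deriv ?_
    simp only [Complex.imCLM_apply, Complex.real_smul, Complex.add_im, Complex.mul_im,
      Complex.mul_re, Complex.neg_re, Complex.neg_im, Complex.conj_re, Complex.conj_im,
      Complex.ofReal_re, Complex.ofReal_im, Complex.normSq_apply]
    ring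
  have hanti := antitoneOn_Ioo_of_hasDerivAt hd fun x hx => by
    have := w_pos ε hx
    have := Complex.normSq_nonneg (f x)
    rw [neg_nonpos]
    positivity
  obtain ⟨C, hC⟩ := hf.1.exists_bound
  have hbd : ∀ y ∈ Ioo (0 : ℝ) 1, ‖H y‖ ≤ |z.im| * (p ε y * (C * ‖f y‖)) := by
    intro y hy
    have hp := p_pos ε hy
    rw [hH, norm_mul, Real.norm_eq_abs, Real.norm_eq_abs]
    refine mul_le_mul_of_nonneg_left ((Complex.abs_im_le_norm _).trans ?_) (abs_nonneg _)
    rw [norm_mul, norm_smul, RCLike.norm_conj, Real.norm_of_nonneg hp.le, mul_assoc]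
    have := (hC y hy).2
    gcongr
  have lim0 : Tendsto H (𝓝[>] 0) (𝓝 0) := by
    have h1 : Tendsto (fun y => |z.im| * (p ε y * (C * ‖f y‖))) (𝓝[>] 0)
        (𝓝 (|z.im| * (1 * (C * ‖(0 : ℂ)‖)))) :=
      ((tendsto_p_zero hε).mul (hf.1.tendsto_zero.norm.const_mul C)).const_mul _
    simp only [norm_zero, mul_zero] at h1
    refine squeeze_zero_norm' ?_ h1
    filter_upwards [Ioo_mem_nhdsGT one_pos] with y hy using hbd y hy
  have lim1 : Tendsto H (𝓝[<] 1) (𝓝 0) := by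
    have h1 : Tendsto (fun y => |z.im| * (p ε y * (C * C))) (𝓝[<] 1)
        (𝓝 (|z.im| * (0 * (C * C)))) :=
      ((tendsto_p_one hε).mul_const _).const_mul _
    simp only [zero_mul, mul_zero] at h1
    refine squeeze_zero_norm' ?_ h1
    filter_upwards [Ioo_mem_nhdsLT one_pos] with y hy
    refine (hbd y hy).trans ?_
    have hp := p_pos ε hy
    obtain ⟨c1, c2⟩ := hC y hy
    have : 0 ≤ C := (norm_nonneg _).trans c1
    gcongr
  have hzero : ∀ y ∈ Ioo (0 : ℝ) 1, H y = 0 := by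
    intro y hy
    refine le_antisymm ?_ ?_
    · refine ge_of_tendsto lim0 ?_
      filter_upwards [Ioo_mem_nhdsGT hy.1] with t ht
      exact hanti ⟨ht.1, ht.2.trans hy.2⟩ hy ht.2.le
    · refine le_of_tendsto lim1 ?_
      filter_upwards [Ioo_mem_nhdsLT hy.2] with t ht
      exact hanti hy ⟨hy.1.trans ht.1, ht.2⟩ ht.1.le
  have h0 : HasDerivAt H 0 x := by
    refine (hasDerivAt_const x (0 : ℝ)).congr_of_eventuallyEq ?_
    filter_upwards [Ioo_mem_nhds hx.1 hx.2] with y hy using hzero y hy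
  have := (hd x hx).unique h0
  rw [neg_eq_zero, mul_eq_zero, or_iff_right (mul_pos (by positivity) (w_pos ε hx)).ne'] at this
  exact Complex.normSq_eq_zero.1 this

/-! ### Eigenspaces -/

/-- An identity in L² holds almost everywhere; as w > 0 and both sides are continuous on (0,1), it
holds at every point. -/
theorem mem_eigenspace_iff {ε : ℝ} {z : ℂ} {a : L2w ε} :
    a ∈ eigenspace (slOperator ε) z ↔
      ∃ f, IsClassical ε z f ∧ (a : ℝ → ℂ) =ᵐ[weightMeasure ε] f := by
  have hmem : a ∈ eigenspace (slOperator ε) z ↔ (a, z • a) ∈ slGraph ε := by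
    rw [← slOperator_graph]
    rfl
  rw [hmem]
  constructor
  · rintro ⟨f, hf, h1, h2⟩
    refine ⟨f, ⟨hf, ?_⟩, h1⟩
    have hc : ContinuousOn (slExpr ε f) (Ioo 0 1) := by
      have hO : ContDiffOn ℝ ∞ f (Ioo 0 1) := hf.1.mono Ioo_subset_Icc_self
      have h1' : ContDiffOn ℝ 2 (deriv f) (Ioo 0 1) := hO.deriv_of_isOpen isOpen_Ioo (by
        norm_num
        exact WithTop.coe_le_coe.2 le_top)
      have h2' : ContDiffOn ℝ 1 (deriv (deriv f)) (Ioo 0 1) := h1'.deriv_of_isOpen isOpen_Ioo (by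
        norm_num)
      have hw := continuousOn_w ε
      have hp : ContinuousOn (p ε) (Ioo 0 1) := fun x hx =>
        (differentiableAt_p ε hx).continuousAt.continuousWithinAt
      have hform : ContinuousOn (fun x => -((w ε x)⁻¹ • (p ε x • deriv (deriv f) x +
          (w ε x * (x * (-2 / ε - 2 * x))) • deriv f x))) (Ioo 0 1) := by
        refine ((hw.inv₀ fun x hx => (w_pos ε hx).ne').smul ((hp.smul h2'.continuousOn).add
          ((hw.mul (by fun_prop)).smul h1'.continuousOn))).neg
      refine hform.congr fun x hx => ?_
      have hd2 : HasDerivAt (deriv f) (deriv (deriv f) x) x :=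
        (((h1' x hx).contDiffAt (Ioo_mem_nhds hx.1 hx.2)).differentiableAt (by simp)).hasDerivAt
      have hd3 : HasDerivAt (fun y => p ε y • deriv f y) _ x := (hasDerivAt_p ε hx).smul hd2
      rw [slExpr, hd3.deriv]
    have hc2 : ContinuousOn (fun x => z * f x) (Ioo 0 1) :=
      continuousOn_const.mul (hf.1.continuousOn.mono Ioo_subset_Icc_self)
    refine eqOn_of_ae_weightMeasure ε hc hc2 (h2.symm.trans ?_)
    filter_upwards [Lp.coeFn_smul z a, h1] with x e1 e2
    rw [e1, Pi.smul_apply, smul_eq_mul, e2]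
  · rintro ⟨f, hf, h1⟩
    refine ⟨f, hf.1, h1, ?_⟩
    filter_upwards [Lp.coeFn_smul z a, h1, ae_weightMeasure_mem ε] with x e1 e2 e3
    rw [e1, Pi.smul_apply, smul_eq_mul, e2, hf.2 x e3]

theorem eq_zero_of_ae_eq {ε : ℝ} {a : L2w ε} {f : ℝ → ℂ}
    (h : (a : ℝ → ℂ) =ᵐ[weightMeasure ε] f) (hf : ∀ x ∈ Ioo (0 : ℝ) 1, f x = 0) : a = 0 := by
  refine Lp.ext (h.trans ?_)
  filter_upwards [Lp.coeFn_zero ℂ 2 (weightMeasure ε), ae_weightMeasure_mem ε] with x e1 e2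
  rw [e1, hf x e2, Pi.zero_apply]

theorem eigenspace_eq_bot {ε : ℝ} {z : ℂ}
    (h : ∀ f, IsClassical ε z f → ∀ x ∈ Ioo (0 : ℝ) 1, f x = 0) :
    eigenspace (slOperator ε) z = ⊥ := by
  rw [Submodule.eq_bot_iff]
  intro a ha
  obtain ⟨f, hf, hfa⟩ := mem_eigenspace_iff.1 ha
  exact eq_zero_of_ae_eq hfa (h f hf)

theorem rank_eigenspace_eq_one {ε l : ℝ} (hε : 0 < ε) {u u' v v' : ℝ → ℝ}
    (hu : IsLeftSol ε l u u') (hv : IsRightSol ε l v v')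
    (hW : u (1 / 2) * v' (1 / 2) = u' (1 / 2) * v (1 / 2)) :
    Module.rank ℂ (eigenspace (slOperator ε) (l : ℂ)) = 1 := by
  obtain ⟨g, hg, x₀, hx₀, hne⟩ := exists_isClassical hu hv hW
  have hgm := (hg.1.memLp hε).1
  rw [rank_submodule_eq_one_iff]
  refine ⟨hgm.toLp g, mem_eigenspace_iff.2 ⟨g, hg, hgm.coeFn_toLp⟩, fun h0 => hne ?_, ?_⟩
  · have h1 : g =ᵐ[weightMeasure ε] 0 := by
      have := hgm.coeFn_toLp
      rw [h0] at this
      exact this.symm.trans (Lp.coeFn_zero ℂ 2 (weightMeasure ε))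
    exact eqOn_of_ae_weightMeasure ε (hg.1.1.continuousOn.mono Ioo_subset_Icc_self)
      continuousOn_const h1 hx₀
  · intro a ha
    obtain ⟨f, hf, hfa⟩ := mem_eigenspace_iff.1 ha
    obtain ⟨k, hk⟩ := hf.proportional hε hg hx₀ hne
    refine Submodule.mem_span_singleton.2 ⟨k, Lp.ext ?_⟩
    filter_upwards [Lp.coeFn_smul k (hgm.toLp g), hgm.coeFn_toLp, hfa, ae_weightMeasure_mem ε]
      with x e1 e2 e3 e4
    rw [e1, Pi.smul_apply, e2, e3, hk x e4, smul_eq_mul]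

theorem rank_eigenspace_eq_zero {ε l : ℝ} (hε : 0 < ε) {u u' v v' : ℝ → ℝ}
    (hu : IsLeftSol ε l u u') (hv : IsRightSol ε l v v')
    (hW : u (1 / 2) * v' (1 / 2) ≠ u' (1 / 2) * v (1 / 2)) :
    Module.rank ℂ (eigenspace (slOperator ε) (l : ℂ)) = 0 := by
  rw [eigenspace_eq_bot, rank_bot]
  intro f hf x hx
  by_contra hne
  exact hW (hf.matching hε hu hv hx hne)

theorem rank_eigenspace_of_im_ne_zero {ε : ℝ} (hε : 0 < ε) {z : ℂ} (hz : z.im ≠ 0) :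
    Module.rank ℂ (eigenspace (slOperator ε) z) = 0 := by
  rw [eigenspace_eq_bot, rank_bot]
  exact fun f hf x hx => hf.eq_zero_of_im_ne_zero hε hz hx

/-! ### The Liouville transformation of solutions -/

/-- The Liouville transform of a function. -/
def liouville (ε : ℝ) (f : ℝ → ℝ) (s : ℝ) : ℝ := f (φ ε s) * amp ε (φ ε s)

/-- The derivative of the Liouville transform of `f`, where `F = p f'`. -/
def liouvilleDeriv (ε : ℝ) (f F : ℝ → ℝ) (s : ℝ) : ℝ :=
  F (φ ε s) / amp ε (φ ε s) + ampLog ε (φ ε s) * liouville ε f s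

theorem φ_mem_Ioo {ε a b s : ℝ} (ha : a ∈ Icc (0 : ℝ) 1) (hb : b ∈ Icc (0 : ℝ) 1)
    (hs : s ∈ Ioo (ψ ε a) (ψ ε b)) : s ∈ Ioo 0 β ∧ φ ε s ∈ Ioo a b := by
  have ha' : ψ ε a ∈ Icc 0 β := image_ψ ε ▸ mem_image_of_mem _ ha
  have hb' : ψ ε b ∈ Icc 0 β := image_ψ ε ▸ mem_image_of_mem _ hb
  have hsβ : s ∈ Ioo 0 β := ⟨ha'.1.trans_lt hs.1, hs.2.trans_le hb'.2⟩
  have h1 := strictMonoOn_φ ε ha' (Ioo_subset_Icc_self hsβ) hs.1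
  have h2 := strictMonoOn_φ ε (Ioo_subset_Icc_self hsβ) hb' hs.2
  rw [φ_ψ ε ha] at h1
  rw [φ_ψ ε hb] at h2
  exact ⟨hsβ, h1, h2⟩

/-- With M = `amp` and λ its logarithmic derivative, g = fM has derivative F/M + λg. Differentiating
again, the terms in F cancel, λ' + λ² gives V, and F' gives -l g. -/
theorem IsSol.hasDerivAt_liouville {ε l a b : ℝ} {f F : ℝ → ℝ} (h : IsSol ε l a b f F)
    (ha : a ∈ Icc (0 : ℝ) 1) (hb : b ∈ Icc (0 : ℝ) 1) {s : ℝ} (hs : s ∈ Ioo (ψ ε a) (ψ ε b)) :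
    HasDerivAt (liouville ε f) (liouvilleDeriv ε f F s) s ∧
      HasDerivAt (liouvilleDeriv ε f F) (-((l - V ε s) * liouville ε f s)) s := by
  obtain ⟨hsβ, hx⟩ := φ_mem_Ioo ha hb hs
  have hx1 := φ_mem ε hsβ
  have hp := p_pos ε hx1
  have hσ := speed_pos hx1
  have hM := amp_pos ε hx1
  have hM2 := amp_sq ε hx1
  have hφ := hasDerivAt_φ ε hsβ
  have hf : HasDerivAt (fun s => f (φ ε s)) _ s := (h _ hx).1.comp s hφ
  have hF : HasDerivAt (fun s => F (φ ε s)) _ s := (h _ hx).2.comp s hφ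
  have hpM : p ε (φ ε s) = amp ε (φ ε s) ^ 2 * speed (φ ε s) := by
    rw [hM2]; field_simp
  have hwM : w ε (φ ε s) * speed (φ ε s) = amp ε (φ ε s) ^ 2 := by
    rw [hM2, p_eq ε hx1, ← speed_sq hx1]; field_simp
  have d1 : HasDerivAt (liouville ε f) (liouvilleDeriv ε f F s) s := by
    refine (hf.mul (hasDerivAt_amp_φ ε hsβ)).congr_deriv ?_
    simp only [liouvilleDeriv, liouville, smul_eq_mul]
    rw [hpM]
    field_simp
  refine ⟨d1, ?_⟩
  refine ((hF.div (hasDerivAt_amp_φ ε hsβ) hM.ne').add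
    ((hasDerivAt_ampLog_φ ε hsβ).mul d1)).congr_deriv ?_
  simp only [liouvilleDeriv, liouville, smul_eq_mul]
  rw [V_eq ε hsβ]
  set M := amp ε (φ ε s)
  rw [show -(l * w ε (φ ε s)) * f (φ ε s) * speed (φ ε s) =
    -(l * (w ε (φ ε s) * speed (φ ε s))) * f (φ ε s) by ring, hwM]
  field_simp
  ring

theorem liouville_ne_zero {ε : ℝ} {f F : ℝ → ℝ} {s : ℝ} (hs : s ∈ Ioo 0 β)
    (h : f (φ ε s) ≠ 0 ∨ F (φ ε s) ≠ 0) :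
    liouville ε f s ≠ 0 ∨ liouvilleDeriv ε f F s ≠ 0 := by
  have hM := (amp_pos ε (φ_mem ε hs)).ne'
  by_contra! hc
  obtain ⟨h1, h2⟩ := hc
  rw [liouvilleDeriv, h1, mul_zero, add_zero, div_eq_zero_iff, or_iff_left hM] at h2
  rw [liouville, mul_eq_zero, or_iff_left hM] at h1
  rcases h with h | h
  · exact h h1
  · exact h h2

/-- The logarithmic derivative is split into the factor 1/(4 `speed`), which blows up at both ends,
and a factor with a nonzero limit for the endpoint solutions. -/
theorem liouvilleDeriv_div {ε : ℝ} {f f' : ℝ → ℝ} {s : ℝ} (hs : s ∈ Ioo 0 β)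
    (hf : f (φ ε s) ≠ 0) :
    liouvilleDeriv ε f (fun x => p ε x * f' x) s / liouville ε f s =
      (4 * (φ ε s * (1 - φ ε s ^ 2) * f' (φ ε s) / f (φ ε s)) -
        (1 + 4 * (1 / ε) * φ ε s + φ ε s ^ 2)) * ((1 / 4) * (speed (φ ε s))⁻¹) := by
  have hx := φ_mem ε hs
  have hσ := speed_pos hx
  have hM := amp_pos ε hx
  have hpM : p ε (φ ε s) = amp ε (φ ε s) ^ 2 * speed (φ ε s) := by
    rw [amp_sq ε hx]; field_simp
  rw [← speed_sq hx, liouvilleDeriv, liouville, hpM, ampLog]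
  set M := amp ε (φ ε s)
  generalize 1 + 4 * (1 / ε) * φ ε s + φ ε s ^ 2 = k
  field_simp
  ring

theorem tendsto_speed_inv {x₀ : ℝ} (hx₀ : x₀ * (1 - x₀ ^ 2) = 0) {L : Filter ℝ} (hL : L ≤ 𝓝 x₀)
    (hL' : ∀ᶠ x in L, x ∈ Ioo (0 : ℝ) 1) : Tendsto (fun x => (1 / 4) * (speed x)⁻¹) L atTop := by
  have h : Tendsto speed L (𝓝[>] 0) := by
    refine tendsto_nhdsWithin_iff.2 ⟨?_, hL'.mono fun x hx => speed_pos hx⟩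
    have := continuous_speed.tendsto x₀
    rw [speed, hx₀, Real.sqrt_zero] at this
    exact this.mono_left hL
  exact h.inv_tendsto_nhdsGT_zero.const_mul_atTop (by norm_num)

/-! ### Prüfer angles of the endpoint solutions -/

section Angles

variable {ε l : ℝ} {u u' v v' : ℝ → ℝ}

/-- Since x u'/u → 1, the regular factor of g'/g tends to 4 - 1 = 3 > 0, so g'/g → +∞ and the angle
starts at 0. -/
theorem IsLeftSol.exists_angle (h : IsLeftSol ε l u u') :
    ∃ θ, IsPrueferAngle (fun s => l - V ε s) (ψ ε (10 / 19)) θ ∧ ∃ r > 0,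
      liouville ε u (ψ ε (1 / 2)) = r * Real.sin (θ (ψ ε (1 / 2))) ∧
      liouvilleDeriv ε u (fun x => p ε x * u' x) (ψ ε (1 / 2)) =
        r * Real.cos (θ (ψ ε (1 / 2))) := by
  have hm : (10 / 19 : ℝ) ∈ Ioo (0 : ℝ) 1 := by norm_num
  have hψ := ψ_mem ε hm
  have hmem : ∀ {s}, s ∈ Ioo 0 (ψ ε (10 / 19)) → s ∈ Ioo (ψ ε 0) (ψ ε (10 / 19)) := fun hs => by
    rwa [ψ_zero]
  have h0 : (0 : ℝ) ∈ Icc (0 : ℝ) 1 := by norm_num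
  have hne : ∀ s ∈ Ioo 0 (ψ ε (10 / 19)), liouville ε u s ≠ 0 ∨
      liouvilleDeriv ε u (fun x => p ε x * u' x) s ≠ 0 := fun s hs => by
    obtain ⟨h1, h2⟩ := φ_mem_Ioo h0 (Ioo_subset_Icc_self hm) (hmem hs)
    exact liouville_ne_zero h1 (h.ne_zero h2)
  have hpos := (tendsto_φ_zero ε).eventually h.eventually_pos
  obtain ⟨θ, hθ, hpol⟩ := exists_isPrueferAngle (q := fun s => l - V ε s) hψ.1
    (continuousOn_const.sub ((continuousOn_V ε).mono (Ioo_subset_Ioo_right hψ.2.le)))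
    (fun s hs => (h.isSol.hasDerivAt_liouville h0 (Ioo_subset_Icc_self hm) (hmem hs)).1)
    (fun s hs => (h.isSol.hasDerivAt_liouville h0 (Ioo_subset_Icc_self hm) (hmem hs)).2) hne
    (by
      filter_upwards [hpos, Ioo_mem_nhdsGT β_pos] with s h1 h2
      exact mul_pos h1 (amp_pos ε (φ_mem ε h2)))
    (by
      have h1 : Tendsto (fun x => 4 * (x * (1 - x ^ 2) * u' x / u x) -
          (1 + 4 * (1 / ε) * x + x ^ 2)) (𝓝[>] 0) (𝓝 3) := by
        have e1 : Tendsto (fun x : ℝ => 1 - x ^ 2) (𝓝[>] 0) (𝓝 (1 - 0 ^ 2)) :=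
          (Continuous.tendsto (by fun_prop) 0).mono_left nhdsWithin_le_nhds
        have e2 : Tendsto (fun x : ℝ => 1 + 4 * (1 / ε) * x + x ^ 2) (𝓝[>] 0)
            (𝓝 (1 + 4 * (1 / ε) * 0 + 0 ^ 2)) :=
          (Continuous.tendsto (by fun_prop) 0).mono_left nhdsWithin_le_nhds
        have e3 := (((e1.mul h.tendsto_deriv).mul (h.tendsto_div.inv₀ one_ne_zero)).const_mul
          4).sub e2
        refine (e3.congr fun x => ?_).trans (by norm_num)
        rw [inv_div]
        ring
      have h2 : Tendsto (fun x => (1 / 4) * (speed x)⁻¹) (𝓝[>] 0) atTop :=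
        tendsto_speed_inv (by norm_num) nhdsWithin_le_nhds (Ioo_mem_nhdsGT one_pos)
      refine ((h1.pos_mul_atTop (by norm_num) h2).comp (tendsto_φ_zero ε)).congr' ?_
      filter_upwards [hpos, Ioo_mem_nhdsGT β_pos] with s h1 h2
      exact (liouvilleDeriv_div h2 h1.ne').symm)
  have hs₀ : ψ ε (1 / 2) ∈ Ioo 0 (ψ ε (10 / 19)) := ⟨(ψ_mem ε (by norm_num)).1,
    strictMonoOn_ψ ε (by norm_num) (by norm_num) (by norm_num)⟩
  refine ⟨θ, hθ, _, Real.sqrt_pos.2 ?_, hpol _ hs₀⟩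
  rcases hne _ hs₀ with h | h
  · have := sq_pos_of_ne_zero h; positivity
  · have := sq_pos_of_ne_zero h; positivity

/-- In the reflected variable t = β - s the derivative changes sign, and the regular factor of the
logarithmic derivative tends to 2 + 4/ε > 0. -/
theorem IsRightSol.exists_angle (hε : 0 < ε) (h : IsRightSol ε l v v') :
    ∃ θ, IsPrueferAngle (fun t => l - V ε (β - t)) (β - ψ ε (9 / 19)) θ ∧ ∃ r > 0,
      liouville ε v (ψ ε (1 / 2)) = r * Real.sin (θ (β - ψ ε (1 / 2))) ∧
      liouvilleDeriv ε v (fun x => p ε x * v' x) (ψ ε (1 / 2)) =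
        -(r * Real.cos (θ (β - ψ ε (1 / 2)))) := by
  have hm : (9 / 19 : ℝ) ∈ Ioo (0 : ℝ) 1 := by norm_num
  have hψ := ψ_mem ε hm
  have hmem : ∀ {t}, t ∈ Ioo 0 (β - ψ ε (9 / 19)) → β - t ∈ Ioo (ψ ε (9 / 19)) (ψ ε 1) :=
    fun ht => by rw [ψ_one]; exact ⟨by linarith [ht.2], by linarith [ht.1]⟩
  have h1 : (1 : ℝ) ∈ Icc (0 : ℝ) 1 := by norm_num
  have hne : ∀ t ∈ Ioo 0 (β - ψ ε (9 / 19)), liouville ε v (β - t) ≠ 0 ∨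
      -liouvilleDeriv ε v (fun x => p ε x * v' x) (β - t) ≠ 0 := fun t ht => by
    obtain ⟨a1, a2⟩ := φ_mem_Ioo (Ioo_subset_Icc_self hm) h1 (hmem ht)
    rw [neg_ne_zero]
    exact liouville_ne_zero a1 (h.ne_zero a2)
  have hpos := (tendsto_φ_β ε).eventually h.eventually_pos
  have hr : ∀ t : ℝ, HasDerivAt (fun t : ℝ => β - t) (-1) t := fun t =>
    (hasDerivAt_id t).const_sub β
  obtain ⟨θ, hθ, hpol⟩ := exists_isPrueferAngle (q := fun t => l - V ε (β - t))
    (g := fun t => liouville ε v (β - t))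
    (G := fun t => -liouvilleDeriv ε v (fun x => p ε x * v' x) (β - t)) (sub_pos.2 hψ.2)
    (continuousOn_const.sub ((continuousOn_V ε).comp (by fun_prop) fun t ht =>
      (φ_mem_Ioo (Ioo_subset_Icc_self hm) h1 (hmem ht)).1))
    (fun t ht => ((h.isSol.hasDerivAt_liouville (Ioo_subset_Icc_self hm) h1 (hmem ht)).1.comp t
      (hr t)).congr_deriv (by ring))
    (fun t ht => ((h.isSol.hasDerivAt_liouville (Ioo_subset_Icc_self hm) h1 (hmem ht)).2.comp t
      (hr t)).neg.congr_deriv (by ring)) hne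
    (by
      filter_upwards [hpos, Ioo_mem_nhdsGT β_pos] with t a1 a2
      exact mul_pos a1 (amp_pos ε (φ_mem ε ⟨by linarith [a2.2], by linarith [a2.1]⟩)))
    (by
      have h1 : Tendsto (fun x => (1 + 4 * (1 / ε) * x + x ^ 2) -
          4 * (x * (1 - x ^ 2) * v' x / v x)) (𝓝[<] 1) (𝓝 (2 + 4 * (1 / ε))) := by
        have e1 : Tendsto (fun x : ℝ => x * (1 - x ^ 2)) (𝓝[<] 1) (𝓝 (1 * (1 - 1 ^ 2))) :=
          (Continuous.tendsto (by fun_prop) 1).mono_left nhdsWithin_le_nhds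
        have e2 : Tendsto (fun x : ℝ => 1 + 4 * (1 / ε) * x + x ^ 2) (𝓝[<] 1)
            (𝓝 (1 + 4 * (1 / ε) * 1 + 1 ^ 2)) :=
          (Continuous.tendsto (by fun_prop) 1).mono_left nhdsWithin_le_nhds
        have e3 := e2.sub (((e1.mul h.tendsto_deriv).div h.tendsto one_ne_zero).const_mul 4)
        refine e3.trans (le_of_eq ?_)
        congr 1
        ring
      have h2 : Tendsto (fun x => (1 / 4) * (speed x)⁻¹) (𝓝[<] 1) atTop :=
        tendsto_speed_inv (by norm_num) nhdsWithin_le_nhds (Ioo_mem_nhdsLT one_pos)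
      refine ((h1.pos_mul_atTop (by positivity) h2).comp (tendsto_φ_β ε)).congr' ?_
      filter_upwards [hpos, Ioo_mem_nhdsGT β_pos] with t a1 a2
      rw [neg_div, liouvilleDeriv_div ⟨by linarith [a2.2], by linarith [a2.1]⟩ a1.ne']
      simp only [Function.comp_apply]
      ring)
  have hs₀ : β - ψ ε (1 / 2) ∈ Ioo 0 (β - ψ ε (9 / 19)) :=
    ⟨sub_pos.2 (ψ_mem ε (by norm_num)).2, sub_lt_sub_left
      (strictMonoOn_ψ ε (by norm_num) (by norm_num) (by norm_num)) _⟩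
  have hpos₀ : 0 < liouville ε v (β - (β - ψ ε (1 / 2))) ^ 2 +
      (-liouvilleDeriv ε v (fun x => p ε x * v' x) (β - (β - ψ ε (1 / 2)))) ^ 2 := by
    rcases hne _ hs₀ with h | h
    · have := sq_pos_of_ne_zero h; positivity
    · have := sq_pos_of_ne_zero h; positivity
  have hp := hpol _ hs₀
  rw [sub_sub_cancel] at hp hpos₀
  exact ⟨θ, hθ, _, Real.sqrt_pos.2 hpos₀, hp.1, neg_eq_iff_eq_neg.1 hp.2⟩

end Angles

/-- The Prüfer angles from both endpoints, and the criterion for eigenvalues in terms of them. -/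
theorem exists_angles {ε : ℝ} (hε : 0 < ε) (l : ℝ) :
    ∃ θ₁ θ₂ : ℝ → ℝ, IsPrueferAngle (fun s => l - V ε s) (ψ ε (10 / 19)) θ₁ ∧
      IsPrueferAngle (fun t => l - V ε (β - t)) (β - ψ ε (9 / 19)) θ₂ ∧
      (Real.sin (θ₁ (ψ ε (1 / 2)) + θ₂ (β - ψ ε (1 / 2))) = 0 →
        Module.rank ℂ (eigenspace (slOperator ε) (l : ℂ)) = 1) ∧
      (Real.sin (θ₁ (ψ ε (1 / 2)) + θ₂ (β - ψ ε (1 / 2))) ≠ 0 →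
        Module.rank ℂ (eigenspace (slOperator ε) (l : ℂ)) = 0) := by
  obtain ⟨u, u', hu⟩ := exists_isLeftSol ε l
  obtain ⟨v, v', hv⟩ := exists_isRightSol hε l
  obtain ⟨θ₁, h₁, r₁, hr₁, a1, a2⟩ := hu.exists_angle
  obtain ⟨θ₂, h₂, r₂, hr₂, b1, b2⟩ := hv.exists_angle hε
  have hm : (1 / 2 : ℝ) ∈ Ioo (0 : ℝ) 1 := by norm_num
  have key : p ε (1 / 2) * (u' (1 / 2) * v (1 / 2) - u (1 / 2) * v' (1 / 2)) =
      r₁ * r₂ * Real.sin (θ₁ (ψ ε (1 / 2)) + θ₂ (β - ψ ε (1 / 2))) := by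
    have hM := (amp_pos ε hm).ne'
    -- The `ampLog` terms cancel, so the Liouville transformation preserves the Wronskian up to the
    -- weight p. The reflected sign of cos θ₂ turns the difference of products into the sine of a
    -- sum.
    have e : liouvilleDeriv ε u (fun x => p ε x * u' x) (ψ ε (1 / 2)) *
        liouville ε v (ψ ε (1 / 2)) - liouville ε u (ψ ε (1 / 2)) *
        liouvilleDeriv ε v (fun x => p ε x * v' x) (ψ ε (1 / 2)) =
        p ε (1 / 2) * (u' (1 / 2) * v (1 / 2) - u (1 / 2) * v' (1 / 2)) := by
      simp only [liouvilleDeriv, liouville, φ_ψ ε (Ioo_subset_Icc_self hm)]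
      field_simp
      ring
    rw [← e, a1, a2, b1, b2, Real.sin_add]
    ring
  have hp := (p_pos ε hm).ne'
  have hr : r₁ * r₂ ≠ 0 := (mul_pos hr₁ hr₂).ne'
  refine ⟨θ₁, θ₂, h₁, h₂, fun h => ?_, fun h => ?_⟩
  · rw [h, mul_zero, mul_eq_zero, or_iff_right hp, sub_eq_zero] at key
    exact rank_eigenspace_eq_one hε hu hv key.symm
  · refine rank_eigenspace_eq_zero hε hu hv fun hW => mul_ne_zero hr h ?_
    rw [← key, hW, sub_self, mul_zero]

/-! ### The total Prüfer angle -/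

/-- The properties of the total Prüfer angle `Θ` as a function of the spectral parameter. -/
structure IsTotalAngle (ε : ℝ) (Θ : ℝ → ℝ) : Prop where
  strictMono : StrictMono Θ
  continuous : Continuous Θ
  pos : ∀ l, 0 < Θ l
  rank_eq_one : ∀ l, Real.sin (Θ l) = 0 →
    Module.rank ℂ (eigenspace (slOperator ε) (l : ℂ)) = 1
  rank_eq_zero : ∀ l, Real.sin (Θ l) ≠ 0 →
    Module.rank ℂ (eigenspace (slOperator ε) (l : ℂ)) = 0
  -- This makes the attained levels nπ start at n = 1.
  lt_pi : ∀ α ∈ lowerBounds (V ε '' Ioo 0 β), Θ α < Real.pi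
  le_of_eq : ∀ α ∈ lowerBounds (V ε '' Ioo 0 β), ∀ κ > 0, ∀ l ≤ α + κ ^ 2, ∀ n : ℕ,
    Θ l = n * Real.pi → n * Real.pi ≤ κ * β
  -- The condition 4d ≤ β keeps β - 2δ at least β/2.
  lower : ∃ C d : ℝ, 0 < C ∧ 0 < d ∧ 4 * d ≤ β ∧ ∀ δ, 0 < δ → δ ≤ d → ∀ κ > 0, ∀ l,
    κ ^ 2 + C / δ ^ 2 ≤ l → κ * (β - 2 * δ) - Real.pi ≤ Θ l ∧
      ∀ n : ℕ, Θ l = n * Real.pi → κ * (β - 2 * δ) ≤ n * Real.pi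

theorem exists_isTotalAngle {ε : ℝ} (hε0 : 0 < ε) (hε2 : ε < 2) : ∃ Θ, IsTotalAngle ε Θ := by
  choose θ₁ θ₂ h₁ h₂ hr1 hr0 using exists_angles hε0
  set s₀ := ψ ε (1 / 2) with hs₀
  have hψl := ψ_mem ε (x := 10 / 19) (by norm_num)
  have hψr := ψ_mem ε (x := 9 / 19) (by norm_num)
  have hψm := ψ_mem ε (x := 1 / 2) (by norm_num)
  have hs : s₀ ∈ Ioo 0 (ψ ε (10 / 19)) :=
    ⟨hψm.1, strictMonoOn_ψ ε (by norm_num) (by norm_num) (by norm_num)⟩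
  have ht : β - s₀ ∈ Ioo 0 (β - ψ ε (9 / 19)) := ⟨sub_pos.2 hψm.2,
    sub_lt_sub_left (strictMonoOn_ψ ε (by norm_num) (by norm_num) (by norm_num)) _⟩
  have hsubl : Ioo 0 (ψ ε (10 / 19)) ⊆ Ioo 0 β := Ioo_subset_Ioo_right hψl.2.le
  have hsubr : ∀ t ∈ Ioo 0 (β - ψ ε (9 / 19)), β - t ∈ Ioo 0 β := fun t ht =>
    ⟨by linarith [ht.2, hψr.1], by linarith [ht.1]⟩
  obtain ⟨m₁, c₁⟩ := IsPrueferAngle.strictMono_continuous ((continuousOn_V ε).mono hsubl)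
    (tendsto_V_zero ε) h₁ hs
  obtain ⟨m₂, c₂⟩ := IsPrueferAngle.strictMono_continuous (V := fun t => V ε (β - t))
    ((continuousOn_V ε).comp (by fun_prop) hsubr) (tendsto_V_β hε0 hε2) h₂ ht
  have upper : ∀ α ∈ lowerBounds (V ε '' Ioo 0 β), ∀ κ > 0, ∀ l ≤ α + κ ^ 2,
      rescale κ (θ₁ l s₀) + rescale κ (θ₂ l (β - s₀)) ≤ κ * β := by
    intro α hα κ hκ l hl
    have a1 := (h₁ l).rescale_le hκ (fun s hs => by
      have := hα (mem_image_of_mem _ (hsubl hs)); linarith) hs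
    have a2 := (h₂ l).rescale_le hκ (fun t ht => by
      have := hα (mem_image_of_mem _ (hsubr t ht)); linarith) ht
    linarith
  have hflip : ∀ κ l (n : ℕ), θ₁ l s₀ + θ₂ l (β - s₀) = n * Real.pi →
      rescale κ (θ₁ l s₀) + rescale κ (θ₂ l (β - s₀)) = n * Real.pi := fun κ l n h => by
    rw [← eq_sub_iff_add_eq'] at h
    rw [h, rescale_nat_mul_pi_sub]
    ring
  refine ⟨fun l => θ₁ l s₀ + θ₂ l (β - s₀), m₁.add m₂, c₁.add c₂,
    fun l => add_pos ((h₁ l).pos _ hs) ((h₂ l).pos _ ht), hr1, hr0, ?_, ?_, ?_⟩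
  · intro α hα
    -- With this κ the rescaled angles have sum at most π/2. Monotonicity of `rescale` and its
    -- reflection rule then carry "sum below π" back to the original angles.
    have hκ : 0 < Real.pi / (2 * β) := by have := β_pos; positivity
    have h := upper α hα _ hκ α (by linarith [sq_nonneg (Real.pi / (2 * β))])
    have e : Real.pi / (2 * β) * β = Real.pi / 2 := by have := β_pos.ne'; field_simp
    rw [e] at h
    have h2 := rescale_nat_mul_pi_sub (Real.pi / (2 * β)) 1 (θ₁ α s₀)
    have h3 : rescale (Real.pi / (2 * β)) (θ₂ α (β - s₀)) <
        rescale (Real.pi / (2 * β)) ((1 : ℕ) * Real.pi - θ₁ α s₀) := by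
      rw [h2]
      push_cast
      linarith [Real.pi_pos]
    have h4 := (rescale_strictMono hκ).lt_iff_lt.1 h3
    push_cast at h4
    linarith
  · intro α hα κ hκ l hl n hn
    rw [← hflip κ l n hn]
    exact upper α hα κ hκ l hl
  -- C is the inverse-square constant of `V_le_left` and `V_le_right`. Halving the minimum gives 4d
  -- ≤ s₀ + (β - s₀) = β.
  · refine ⟨(2 + 4 * (1 / ε)) * (4 + 4 * (1 / ε)), min s₀ (β - s₀) / 2, by positivity,
      half_pos (lt_min hs.1 ht.1), ?_, fun δ hδ hδd κ hκ l hl => ?_⟩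
    · have := min_le_left s₀ (β - s₀)
      have := min_le_right s₀ (β - s₀)
      linarith
    · have hmin : 0 < min s₀ (β - s₀) := lt_min hs.1 ht.1
      have d1 : δ ≤ s₀ := by have := min_le_left s₀ (β - s₀); linarith
      have d2 : δ ≤ β - s₀ := by have := min_le_right s₀ (β - s₀); linarith
      have hq : ∀ t, δ ≤ t → (2 + 4 * (1 / ε)) * (4 + 4 * (1 / ε)) / t ^ 2 ≤
          (2 + 4 * (1 / ε)) * (4 + 4 * (1 / ε)) / δ ^ 2 := fun t ht => by gcongr
      have a1 := (h₁ l).le_rescale hκ hδ (fun t ht htδ => by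
        have := V_le_left hε0 ht
        have := hq t htδ
        linarith) d1 hs.2
      have a2 := (h₂ l).le_rescale hκ hδ (fun t ht htδ => by
        have := V_le_right hε0 ht
        have := hq t htδ
        linarith) d2 ht.2
      constructor
      -- Returning from rescaled to original angles costs less than π/2 on each side.
      · have b1 := rescale_lt κ (θ₁ l s₀)
        have b2 := rescale_lt κ (θ₂ l (β - s₀))
        linarith
      · intro n hn
        rw [← hflip κ l n hn]
        linarith

theorem IsTotalAngle.exists_eq {ε : ℝ} (hε0 : 0 < ε) (hε2 : ε < 2) {Θ : ℝ → ℝ}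
    (h : IsTotalAngle ε Θ) (n : ℕ+) : ∃ l, Θ l = n * Real.pi := by
  obtain ⟨α, hα⟩ := exists_isLeast_V hε0 hε2
  obtain ⟨C, d, hC, hd, hdβ, hlow⟩ := h.lower
  have hβ := β_pos
  have hn : (1 : ℝ) ≤ n := by exact_mod_cast n.2
  have h1 : Θ α ≤ n * Real.pi := (h.lt_pi α hα.2).le.trans (by nlinarith [Real.pi_pos])
  have hpos : 0 < β - 2 * d := by linarith
  -- The spare π compensates the loss of π in `lower`, so that Θ reaches nπ and the intermediate
  -- value theorem applies.
  set κ := ((n + 1) * Real.pi) / (β - 2 * d) with hκ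
  have hκ0 : 0 < κ := by have := Real.pi_pos; positivity
  have h2 := (hlow d hd le_rfl κ hκ0 _ le_rfl).1
  rw [hκ, div_mul_cancel₀ _ hpos.ne'] at h2
  exact mem_range_of_exists_le_of_exists_ge h.continuous ⟨_, h1⟩ ⟨_, by linarith⟩

theorem IsTotalAngle.exists_of_sin_eq_zero {ε : ℝ} {Θ : ℝ → ℝ} (h : IsTotalAngle ε Θ) {l : ℝ}
    (hl : Real.sin (Θ l) = 0) : ∃ n : ℕ+, Θ l = n * Real.pi := by
  obtain ⟨m, hm⟩ := Real.sin_eq_zero_iff.1 hl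
  have hp := h.pos l
  rw [← hm] at hp
  have hm0 : 0 < m := by
    have := (mul_pos_iff_of_pos_right Real.pi_pos).1 hp
    exact_mod_cast this
  lift m to ℕ using hm0.le
  exact ⟨⟨m, by exact_mod_cast hm0⟩, by rw [← hm]; simp⟩

theorem sin_eq_zero_of_eq_nat_mul_pi {Θ : ℝ → ℝ} {l : ℝ} {n : ℕ+} (hl : Θ l = n * Real.pi) :
    Real.sin (Θ l) = 0 := by
  rw [hl]
  exact Real.sin_nat_mul_pi n

theorem IsTotalAngle.exists_isEigenvalueSequence {ε : ℝ} (hε0 : 0 < ε) (hε2 : ε < 2) {Θ : ℝ → ℝ}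
    (h : IsTotalAngle ε Θ) : ∃ μ : ℕ+ → ℝ, IsEigenvalueSequence (slOperator ε) μ := by
  choose μ hμ using h.exists_eq hε0 hε2
  have hmono : StrictMono μ := fun m n hmn => h.strictMono.lt_iff_lt.1 (by
    rw [hμ, hμ]
    have : (m : ℝ) < n := by exact_mod_cast hmn
    exact mul_lt_mul_of_pos_right this Real.pi_pos)
  refine ⟨μ, hmono.monotone, fun z => ?_⟩
  have hempty : (∀ n, (μ n : ℂ) ≠ z) →
      Cardinal.lift (Cardinal.mk {n : ℕ+ // (μ n : ℂ) = z}) = 0 := fun hz => by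
    have : IsEmpty {n : ℕ+ // (μ n : ℂ) = z} := ⟨fun n => hz n.1 n.2⟩
    simp
  by_cases hz : z.im = 0
  · obtain ⟨l, rfl⟩ : ∃ l : ℝ, (l : ℂ) = z := ⟨z.re, Complex.ext rfl hz.symm⟩
    by_cases hl : Real.sin (Θ l) = 0
    · obtain ⟨n, hn⟩ := h.exists_of_sin_eq_zero hl
      have hnl : μ n = l := h.strictMono.injective ((hμ n).trans hn.symm)
      have hone : Cardinal.mk {n : ℕ+ // (μ n : ℂ) = l} = 1 := by
        rw [Cardinal.eq_one_iff_unique]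
        refine ⟨⟨fun a b => Subtype.ext (hmono.injective ?_)⟩, ⟨⟨n, by rw [hnl]⟩⟩⟩
        exact_mod_cast a.2.trans b.2.symm
      rw [h.rank_eq_one l hl, hone, Cardinal.lift_one]
    · rw [h.rank_eq_zero l hl, hempty]
      intro n hn
      have : μ n = l := by exact_mod_cast hn
      exact hl (this ▸ sin_eq_zero_of_eq_nat_mul_pi (hμ n))
  · rw [rank_eigenspace_of_im_ne_zero hε0 hz, hempty]
    rintro n rfl
    exact hz (Complex.ofReal_im _)

/-- Each μ m sits at some level k m. The map k is monotone, injective because eigenvalues are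
simple, and surjective because every level is attained at an eigenvalue; the only order automorphism
of ℕ+ is the identity. -/
theorem IsTotalAngle.eq_of_isEigenvalueSequence {ε : ℝ} (hε0 : 0 < ε) (hε2 : ε < 2) {Θ : ℝ → ℝ}
    (h : IsTotalAngle ε Θ) {μ : ℕ+ → ℝ} (hμ : IsEigenvalueSequence (slOperator ε) μ) (n : ℕ+) :
    Θ (μ n) = n * Real.pi := by
  have hsin : ∀ m, Real.sin (Θ (μ m)) = 0 := fun m => by
    by_contra h0
    have h1 := (hμ.2 (μ m)).symm.trans (h.rank_eq_zero _ h0)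
    rw [Cardinal.lift_eq_zero, Cardinal.mk_eq_zero_iff] at h1
    exact h1.false ⟨m, rfl⟩
  have hone : ∀ l, Real.sin (Θ l) = 0 → Cardinal.mk {n : ℕ+ // (μ n : ℂ) = l} = 1 := fun l hl => by
    have h1 := (hμ.2 l).symm.trans (h.rank_eq_one _ hl)
    rwa [Cardinal.lift_eq_one] at h1
  choose k hk using fun m => h.exists_of_sin_eq_zero (hsin m)
  have hkmono : Monotone k := fun a b hab => by
    have := h.strictMono.monotone (hμ.1 hab)
    rw [hk, hk] at this
    have := le_of_mul_le_mul_right this Real.pi_pos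
    exact_mod_cast this
  have hkinj : Function.Injective k := fun a b hab => by
    have e : Θ (μ a) = Θ (μ b) := by rw [hk, hk, hab]
    have e' := h.strictMono.injective e
    obtain ⟨hs, -⟩ := Cardinal.eq_one_iff_unique.1 (hone (μ b) (hsin b))
    have := hs.elim ⟨a, by rw [e']⟩ ⟨b, rfl⟩
    exact congrArg Subtype.val this
  have hksurj : Function.Surjective k := fun m => by
    obtain ⟨l, hl⟩ := h.exists_eq hε0 hε2 m
    obtain ⟨-, ⟨⟨a, ha⟩⟩⟩ := Cardinal.eq_one_iff_unique.1 (hone l (sin_eq_zero_of_eq_nat_mul_pi hl))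
    refine ⟨a, ?_⟩
    have ha' : μ a = l := by exact_mod_cast ha
    have := (hk a).symm.trans (ha' ▸ hl)
    have := mul_right_cancel₀ Real.pi_ne_zero this
    exact_mod_cast this
  have hkid : ∀ m, k m = m := fun m => by
    have e := Subsingleton.elim
      ((hkmono.strictMono_of_injective hkinj).orderIsoOfSurjective k hksurj) (OrderIso.refl ℕ+)
    exact congrArg (fun f : ℕ+ ≃o ℕ+ => f m) e
  rw [hk, hkid]

/-! ### Eigenvalue bounds -/

/-- The comparison is made with κ = √(l - α); Θ α < π ≤ Θ l gives α < l, so κ is positive. -/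
theorem IsTotalAngle.le_eigenvalue {ε : ℝ} {Θ : ℝ → ℝ} (h : IsTotalAngle ε Θ) {α l : ℝ} {n : ℕ+}
    (hα : α ∈ lowerBounds (V ε '' Ioo 0 β)) (hl : Θ l = n * Real.pi) :
    (n : ℝ) ^ 2 * Real.pi ^ 2 / β ^ 2 + α ≤ l := by
  have hβ := β_pos
  have hn : (1 : ℝ) ≤ n := by exact_mod_cast n.2
  have hαl : α < l := by
    refine h.strictMono.lt_iff_lt.1 ((h.lt_pi α hα).trans_le ?_)
    rw [hl]
    nlinarith [Real.pi_pos]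
  have hκ : 0 < √(l - α) := Real.sqrt_pos.2 (sub_pos.2 hαl)
  have hsq := Real.sq_sqrt (sub_pos.2 hαl).le
  have h1 := h.le_of_eq α hα _ hκ l (by linarith) n hl
  have h2 := pow_le_pow_left₀ (by have := Real.pi_pos; positivity) h1 2
  rw [mul_pow, mul_pow, hsq] at h2
  have h3 : (n : ℝ) ^ 2 * Real.pi ^ 2 / β ^ 2 ≤ l - α := by
    rw [div_le_iff₀ (by positivity)]
    exact h2
  linarith

/-- With δ = d n^(-2/3), the cost n²δ of shortening the interval and the cost C/δ² of the potential
are both of order n^(4/3); they give the two summands of K. -/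
theorem IsTotalAngle.exists_eigenvalue_le {ε : ℝ} {Θ : ℝ → ℝ} (h : IsTotalAngle ε Θ) :
    ∃ K : ℝ, ∀ (l : ℝ) (n : ℕ+), Θ l = n * Real.pi →
      l ≤ (n : ℝ) ^ 2 * Real.pi ^ 2 / β ^ 2 + K * (n : ℝ) ^ (4 / 3 : ℝ) := by
  obtain ⟨C, d, hC, hd, hdβ, hlow⟩ := h.lower
  have hβ := β_pos
  have hπ := Real.pi_pos
  refine ⟨16 * Real.pi ^ 2 * d / β ^ 3 + C / d ^ 2, fun l n hl => ?_⟩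
  have hn : (1 : ℝ) ≤ n := by exact_mod_cast n.2
  have hn0 : (0 : ℝ) < n := by linarith
  set x : ℝ := (n : ℝ) ^ (2 / 3 : ℝ) with hx
  have hx1 : 1 ≤ x := Real.one_le_rpow hn (by norm_num)
  have hx0 : 0 < x := by linarith
  have e1 : (n : ℝ) ^ (4 / 3 : ℝ) = x ^ 2 := by
    rw [hx, ← Real.rpow_natCast, ← Real.rpow_mul hn0.le]
    norm_num
  have e2 : (n : ℝ) ^ 2 = x ^ 3 := by
    rw [hx, ← Real.rpow_natCast (_ ^ _) 3, ← Real.rpow_mul hn0.le]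
    norm_num
  set δ := d / x with hδ
  have hδ0 : 0 < δ := by positivity
  have hδd : δ ≤ d := div_le_self hd.le hx1
  have e3 : C / δ ^ 2 = C / d ^ 2 * x ^ 2 := by rw [hδ]; field_simp
  have hβδ : β / 2 ≤ β - 2 * δ := by linarith
  have hβδ0 : 0 < β - 2 * δ := by linarith
  have main : l - C / δ ^ 2 ≤ (n : ℝ) ^ 2 * Real.pi ^ 2 / (β - 2 * δ) ^ 2 := by
    rcases le_or_gt (l - C / δ ^ 2) 0 with h0 | h0
    · exact h0.trans (by positivity)
    · have hκ : 0 < √(l - C / δ ^ 2) := Real.sqrt_pos.2 h0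
      have hsq := Real.sq_sqrt h0.le
      have h1 := (hlow δ hδ0 hδd _ hκ l (by linarith)).2 n hl
      have h2 := pow_le_pow_left₀ (by positivity) h1 2
      rw [mul_pow, mul_pow, hsq] at h2
      rwa [le_div_iff₀ (by positivity)]
  -- A linear bound in δ for the increase of 1/β² caused by shortening, valid for 4δ ≤ β.
  have inv : 1 / (β - 2 * δ) ^ 2 ≤ 1 / β ^ 2 + 16 * δ / β ^ 3 := by
    have h1 : 1 / β ^ 2 + 16 * δ / β ^ 3 = (β + 16 * δ) / β ^ 3 := by field_simp
    rw [h1, div_le_div_iff₀ (by positivity) (by positivity), one_mul]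
    have h2 : β - 4 * δ ≥ 0 := by linarith
    have h3 : (β + 16 * δ) * (β - 2 * δ) ^ 2 - β ^ 3 =
        δ * (12 * β ^ 2 - 60 * β * δ + 64 * δ ^ 2) := by ring
    have h4 : 0 ≤ 12 * β ^ 2 - 60 * β * δ + 64 * δ ^ 2 := by
      have : 12 * β ^ 2 - 60 * β * δ + 64 * δ ^ 2 = 4 * (β - 4 * δ) * (3 * β - 3 * δ) + 16 * δ ^ 2 := by
        ring
      rw [this]
      have : 0 ≤ 3 * β - 3 * δ := by linarith
      positivity
    nlinarith [mul_nonneg hδ0.le h4]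
  have step : (n : ℝ) ^ 2 * Real.pi ^ 2 / (β - 2 * δ) ^ 2 ≤
      (n : ℝ) ^ 2 * Real.pi ^ 2 / β ^ 2 + 16 * Real.pi ^ 2 * d / β ^ 3 * x ^ 2 := by
    calc (n : ℝ) ^ 2 * Real.pi ^ 2 / (β - 2 * δ) ^ 2
        = (n : ℝ) ^ 2 * Real.pi ^ 2 * (1 / (β - 2 * δ) ^ 2) := by ring
      _ ≤ (n : ℝ) ^ 2 * Real.pi ^ 2 * (1 / β ^ 2 + 16 * δ / β ^ 3) := by gcongr
      _ = (n : ℝ) ^ 2 * Real.pi ^ 2 / β ^ 2 + 16 * Real.pi ^ 2 * d / β ^ 3 * x ^ 2 := by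
          rw [e2, hδ]
          field_simp
  rw [e1, add_mul, ← e3]
  linarith

theorem eigenvalue_bounds {ε : ℝ} (hε0 : 0 < ε) (hε2 : ε < 2) {μ : ℕ+ → ℝ}
    (hμ : IsEigenvalueSequence (slOperator ε) μ) :
    (∃ α, IsLeast (V ε '' Ioo 0 β) α ∧
      ∀ n : ℕ+, (n : ℝ) ^ 2 * Real.pi ^ 2 / β ^ 2 + α ≤ μ n) ∧
    (fun n : ℕ+ => μ n - (n : ℝ) ^ 2 * Real.pi ^ 2 / β ^ 2) =O[atTop]
      fun n : ℕ+ => (n : ℝ) ^ (4 / 3 : ℝ) := by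
  obtain ⟨Θ, hΘ⟩ := exists_isTotalAngle hε0 hε2
  obtain ⟨α, hα⟩ := exists_isLeast_V hε0 hε2
  obtain ⟨K, hK⟩ := hΘ.exists_eigenvalue_le
  have hm := hΘ.eq_of_isEigenvalueSequence hε0 hε2 hμ
  have hlow : ∀ n : ℕ+, (n : ℝ) ^ 2 * Real.pi ^ 2 / β ^ 2 + α ≤ μ n := fun n =>
    hΘ.le_eigenvalue hα.2 (hm n)
  refine ⟨⟨α, hα, hlow⟩, IsBigO.of_bound (|α| + |K|) (Eventually.of_forall fun n => ?_)⟩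
  have hn : (1 : ℝ) ≤ n := by exact_mod_cast n.2
  have hx : 1 ≤ (n : ℝ) ^ (4 / 3 : ℝ) := Real.one_le_rpow hn (by norm_num)
  have h1 := hlow n
  have h2 := hK (μ n) n (hm n)
  rw [Real.norm_eq_abs, Real.norm_of_nonneg (by linarith)]
  set x := (n : ℝ) ^ (4 / 3 : ℝ)
  have a1 := neg_abs_le α
  have a2 := le_abs_self K
  have a3 := abs_nonneg α
  have a4 := abs_nonneg K
  have a5 : |α| ≤ |α| * x := le_mul_of_one_le_right a3 hx
  have a6 : K * x ≤ |K| * x := by gcongr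
  have a7 : 0 ≤ |K| * x := by positivity
  rw [abs_le]
  constructor <;> linarith

end

end SturmLiouville

theorem mainTheorem5 (ε : ℝ) (hε0 : 0 < ε) (hε2 : ε < 2) :
    (∃ μ : ℕ+ → ℝ, SturmLiouville.IsEigenvalueSequence (SturmLiouville.slOperator ε) μ) ∧
    ∀ μ : ℕ+ → ℝ, SturmLiouville.IsEigenvalueSequence (SturmLiouville.slOperator ε) μ →
      Tendsto (fun n : ℕ+ => μ n / (n : ℝ) ^ 2) atTop (𝓝 (Real.pi ^ 2 / SturmLiouville.β ^ 2)) ∧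
      (∃ α : ℝ, IsLeast (SturmLiouville.V ε '' Ioo 0 SturmLiouville.β) α ∧
        ∀ n : ℕ+, (n : ℝ) ^ 2 * Real.pi ^ 2 / SturmLiouville.β ^ 2 + α ≤ μ n) ∧
      ∃ r : ℕ+ → ℝ, r =O[atTop] (fun n : ℕ+ => (n : ℝ) ^ (4 / 3 : ℝ)) ∧
        ∀ n : ℕ+, μ n ≤ (n : ℝ) ^ 2 * Real.pi ^ 2 / SturmLiouville.β ^ 2 + r n := by
  constructor
  · obtain ⟨Θ, hΘ⟩ := SturmLiouville.exists_isTotalAngle hε0 hε2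
    exact hΘ.exists_isEigenvalueSequence hε0 hε2
  intro μ hμ
  obtain ⟨hlow, hO⟩ := SturmLiouville.eigenvalue_bounds hε0 hε2 hμ
  -- The remainder is the exact difference between μ n and the main term, which is bounded on both
  -- sides by a multiple of n^(4/3).
  refine ⟨?_, hlow, _, hO, fun n => by linarith⟩
  have hcast : Tendsto (fun n : ℕ+ => (n : ℝ)) atTop atTop :=
    tendsto_natCast_atTop_atTop.comp tendsto_PNat_val_atTop_atTop
  have ho : (fun n : ℕ+ => (n : ℝ) ^ (4 / 3 : ℝ)) =o[atTop] fun n : ℕ+ => (n : ℝ) ^ (2 : ℝ) := by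
    have hn : ∀ n : ℕ+, 0 < (n : ℝ) := fun n => by exact_mod_cast n.pos
    refine (isLittleO_iff_tendsto fun n h => absurd h (Real.rpow_pos_of_pos (hn n) _).ne').2 ?_
    refine ((tendsto_rpow_neg_atTop (y := 2 / 3) (by norm_num)).comp hcast).congr fun n => ?_
    rw [Function.comp_apply, ← Real.rpow_sub (hn n)]
    norm_num
  have h0 := (hO.trans_isLittleO ho).tendsto_div_nhds_zero
  have h1 := h0.add_const (Real.pi ^ 2 / SturmLiouville.β ^ 2)
  rw [zero_add] at h1
  refine h1.congr fun n => ?_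
  have hn : (n : ℝ) ≠ 0 := by exact_mod_cast n.ne_zero
  have hβ := SturmLiouville.β_pos.ne'
  rw [Real.rpow_two]
  field_simp
  ring
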